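/- Let $S=\{(z,w)\in\mathbb C^2:\ v=|z|^2\}$, $w=u+iv$, be the Heisenberg sphere. For a real hypersurface $M\subset\mathbb C^2$ with complex tangent spaces $H_p=T_pM\cap iT_pM$, an infinitesimal CR automorphism is a smooth tangent vector field $X$ on $M$ with $[X,Y]\in H$ and $[X,iY]=i[X,Y]$ for all smooth sections $Y$ of $H$. A spherical Sasakian manifold of dimension $3$ is (locally) a relatively open subset $M$ of $S$ together with a Reeb field $Z$, i.e. an infinitesimal CR automorphism $Z$ of $M$ with $Z(p)\notin H_p$ for all $p\in M$. The infinitesimal Sasakian automorphisms of $(M,Z)$ are the infinitesimal CR automorphisms $X$ of $M$ with $[X,Z]=0$. A homothety $(M,Z)\to(M',Z')$ is a CR diffeomorphism $f$ with $f_*Z=\kappa Z'$ for a real constant $\kappa\ne0$; it is an isomorphism if $\kappa=1$. Vector fields $f\,\partial_z+g\,\partial_w$ stand for their real parts. For $\tau,\rho\in\mathbb R$ and $a\in\mathbb C$ let $$Z_{\tau,a,\rho}=(i\tau z+aw+2i\bar a z^2+\rho zw)\frac{\partial}{\partial z}+(1+2i\bar a zw+\rho w^2)\frac{\partial}{\partial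 w}.$$ **Theorem 2.** For every relatively open $M\subset S$, every Reeb field $X$ on $M$ and every $p\in M$ there are $\tau,\rho\in\mathbb R$, $a\in\mathbb C$ such that the germ of $(M,X)$ at $p$ is homothetic to the germ of $(S,Z_{\tau,a,\rho})$ at $0$. The field $Z_{\tau,a,\rho}$ is transversal to $H$ at $0$. Let $M\subset S$ be non-empty, relatively open and connected such that $Z_{\tau,a,\rho}$ is transversal to $H$ at every point of $M$. Then $Z_{\tau,a,\rho}$ is a Reeb field on $M$, and the infinitesimal Sasakian automorphisms of $(M,Z_{\tau,a,\rho})$ form a real Lie algebra which is 1. $4$-dimensional if $\tau=0$, $a=0$, $\rho=0$. This is the Heisenberg sphere with Reeb field $\partial/\partial u$. In the coordinates $(z,u)$ on $S$, the maps $$(z,u)\mapsto\bigl(e^{i\phi}(z+b),\ u+q-2\,\mathrm{Im}(z\bar b)\bigr),\qquad b\in\mathbb C,\ q\in\mathbb R,\ \phi\in[0,2\pi),$$ are Sasakian automorphisms of $(S,\partial/\partial u)$, and every Sasakian isomorphism between relatively open subsets of $S$, the first one connected and non-empty, is the restriction of such a map. 2. $4$-dimensional if $a=0$, $\rho=\tau^2$,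 $\tau>0$. In this case the germ of $(S,Z_{\tau,0,\tau^2})$ at $0$ is homothetic to the germ of the rigid sphere $v=\log(1+|z|^2)$ with Reeb field $\partial/\partial u$ at each of its points, and to the germ of the round sphere $|z|^2+|w|^2=1$ with Reeb field $p\mapsto ip$ at each of its points. The unitary transformations of $\mathbb C^2$ are Sasakian automorphisms of the round sphere, and every Sasakian isomorphism between relatively open subsets of the round sphere, the first one connected and non-empty, is the restriction of a unitary transformation. 3. $4$-dimensional if $a=0$, $\rho=\tau^2$, $\tau<0$. In this case the germ of $(S,Z_{\tau,0,\tau^2})$ at $0$ is homothetic to the germ of the rigid sphere $v=-\log(1-|z|^2)$, $|z|<1$, with Reeb field $\partial/\partial u$ at each of its points, and to the germ of the hyperboloid $|z|^2-|w|^2=1$ with Reeb field $p\mapsto ip$ at each of its points. The linear transformations of $\mathbb C^2$ that preserve the form $|z|^2-|w|^2$ (the pseudounitary transformations) are Sasakian automorphisms of the hyperboloid, and every Sasakian isomorphism between relatively open subsets of the hyperboloid, the first one connected and non-empty, is the restriction of such a transformation. 4. $2$-dimensional in all other cases, that is, unless $a=0$ and $\rho=\tau^2$. -/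

import Mathlib

open scoped ContDiff ComplexConjugate

noncomputable section

/-- The complex plane `ℂ²` with coordinates `(z, w)`. Its real smooth structure is all that matters,
so the choice of norm is irrelevant. -/
abbrev C2 : Type := ℂ × ℂ

/-! ### Geometry of real hypersurfaces in `ℂ²`

A hypersurface is given as a subset `M` of `ℂ²` (below always a relatively open part of an explicit
embedded real hypersurface). A map on `M` is smooth iff it is `ContDiffOn ℝ ∞` on `M`. Derivatives
along `M` are taken with `fderivWithin`; its value on vectors tangent to `M` does not depend on
any choice. A real vector field on `M` is a map `X : C2 → C2`, of which only the values on `M`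
matter; the real part of `f ∂/∂z + g ∂/∂w` is represented by the vector field `(f, g)`. -/

/-- The real tangent space of `M` at `p`, as a real subspace of `ℂ²`. -/
def realTangent (M : Set C2) (p : C2) : Submodule ℝ C2 :=
  Submodule.span ℝ (tangentConeAt ℝ M p)

/-- The complex tangent space `H_p = T_p M ∩ i T_p M`, as a set of vectors. Its complex structure
is the multiplication by `i` of `ℂ²`. -/
def cplxTangent (M : Set C2) (p : C2) : Set C2 :=
  {v | v ∈ realTangent M p ∧ Complex.I • v ∈ realTangent M p}

/-- `X` is a smooth (real, tangent) vector field on `M`. -/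
def IsTangentField (M : Set C2) (X : C2 → C2) : Prop :=
  ContDiffOn ℝ ∞ X M ∧ ∀ p ∈ M, X p ∈ realTangent M p

/-- `Y` is a smooth section of the complex tangent bundle of `M`. -/
def IsCplxTangentField (M : Set C2) (Y : C2 → C2) : Prop :=
  ContDiffOn ℝ ∞ Y M ∧ ∀ p ∈ M, Y p ∈ cplxTangent M p

/-- `X` is an infinitesimal CR automorphism of `M`: the Lie derivative along `X` preserves the
complex tangent bundle `H` and its complex structure `J`, that is `[X, Y] ∈ H` and
`[X, J Y] = J [X, Y]` for all sections `Y` of `H`. -/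
def IsInfCRAut (M : Set C2) (X : C2 → C2) : Prop :=
  IsTangentField M X ∧ ∀ Y, IsCplxTangentField M Y → ∀ p ∈ M,
    VectorField.lieBracketWithin ℝ X Y M p ∈ cplxTangent M p ∧
    VectorField.lieBracketWithin ℝ X (fun q => Complex.I • Y q) M p =
      Complex.I • VectorField.lieBracketWithin ℝ X Y M p

/-- `Z` is the Reeb field of a Sasakian structure compatible with the CR structure of `M`: an
infinitesimal CR automorphism that is transversal to the complex tangent space at each point. -/
def IsReebField (M : Set C2) (Z : C2 → C2) : Prop :=
  IsInfCRAut M Z ∧ ∀ p ∈ M, Z p ∉ cplxTangent M p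

/-- `X` is an infinitesimal Sasakian automorphism of `(M, Z)`: an infinitesimal CR automorphism that
commutes with the Reeb field. -/
def IsInfSasakiAut (M : Set C2) (Z X : C2 → C2) : Prop :=
  IsInfCRAut M X ∧ ∀ p ∈ M, VectorField.lieBracketWithin ℝ X Z M p = 0

/-- The infinitesimal Sasakian automorphisms of `(M, Z)` form a real Lie algebra of dimension `n`.
A vector field on `M` is identified with its extension by zero to `ℂ²`. -/
def SasakiAutAlgebraHasDim (M : Set C2) (Z : C2 → C2) (n : ℕ) : Prop :=
  ∃ V : Submodule ℝ (C2 → C2),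
    (∀ X, X ∈ V ↔ IsInfSasakiAut M Z X ∧ ∀ p ∉ M, X p = 0) ∧
    (∀ X ∈ V, ∀ Y ∈ V, M.indicator (VectorField.lieBracketWithin ℝ X Y M) ∈ V) ∧
    Module.Finite ℝ V ∧ Module.finrank ℝ V = n

/-- `f` restricts to a CR diffeomorphism `M → M'` with `f_* Z = κ Z'`. -/
structure IsSasakiHomothety (κ : ℝ) (M : Set C2) (Z : C2 → C2) (M' : Set C2) (Z' : C2 → C2)
    (f : C2 → C2) : Prop where
  bijOn : Set.BijOn f M M'
  smooth : ContDiffOn ℝ ∞ f M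
  smooth_inverse : ∃ g : C2 → C2, ContDiffOn ℝ ∞ g M' ∧ Set.InvOn g f M M'
  cplxTangent_map : ∀ p ∈ M, ∀ v ∈ cplxTangent M p,
    fderivWithin ℝ f M p v ∈ cplxTangent M' (f p) ∧
    fderivWithin ℝ f M p (Complex.I • v) = Complex.I • fderivWithin ℝ f M p v
  reeb_map : ∀ p ∈ M, fderivWithin ℝ f M p (Z p) = κ • Z' (f p)

/-- `f` restricts to a Sasakian isomorphism `(M, Z) → (M', Z')`. -/
def IsSasakiIso (M : Set C2) (Z : C2 → C2) (M' : Set C2) (Z' : C2 → C2) (f : C2 → C2) : Prop :=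
  IsSasakiHomothety 1 M Z M' Z' f

/-- The germ of `(M, Z)` at `p` is homothetic to the germ of `(M', Z')` at `p'`. -/
def LocallyHomothetic (M : Set C2) (Z : C2 → C2) (p : C2) (M' : Set C2) (Z' : C2 → C2)
    (p' : C2) : Prop :=
  ∃ U U' : Set C2, IsOpen U ∧ IsOpen U' ∧ p ∈ M ∩ U ∧ p' ∈ M' ∩ U' ∧
    ∃ κ : ℝ, κ ≠ 0 ∧ ∃ f : C2 → C2, f p = p' ∧ IsSasakiHomothety κ (M ∩ U) Z (M' ∩ U') Z' f

/-! ### The models -/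

/-- The Heisenberg sphere `v = |z|²`, where `w = u + i v`. -/
def heisenbergSphere : Set C2 := {p | p.2.im = ‖p.1‖ ^ 2}

/-- The vector field
`Z = (iτz + aw + 2iāz² + ρzw) ∂/∂z + (1 + 2iāzw + ρw²) ∂/∂w`. -/
def reebField (τ : ℝ) (a : ℂ) (ρ : ℝ) (p : C2) : C2 :=
  (Complex.I * τ * p.1 + a * p.2 + 2 * Complex.I * conj a * p.1 ^ 2 + ρ * p.1 * p.2,
    1 + 2 * Complex.I * conj a * p.1 * p.2 + ρ * p.2 ^ 2)

/-- The rigid sphere `v = log (1 + |z|²)`. -/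
def rigidSpherePos : Set C2 := {p | p.2.im = Real.log (1 + ‖p.1‖ ^ 2)}

/-- The rigid sphere `v = - log (1 - |z|²)`, `|z| < 1`. -/
def rigidSphereNeg : Set C2 := {p | ‖p.1‖ < 1 ∧ p.2.im = -Real.log (1 - ‖p.1‖ ^ 2)}

/-- The rigid symmetry `∂/∂u`. -/
def rigidField (_ : C2) : C2 := (0, 1)

/-- The round sphere `|z|² + |w|² = 1`. -/
def roundSphere : Set C2 := {p | ‖p.1‖ ^ 2 + ‖p.2‖ ^ 2 = 1}

/-- The hyperboloid `|z|² - |w|² = 1`. -/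
def hyperboloid : Set C2 := {p | ‖p.1‖ ^ 2 - ‖p.2‖ ^ 2 = 1}

/-- The natural Reeb field `p ↦ i p` of the round sphere and of the hyperboloid, which generates
the flow `p ↦ e^{it} p`. -/
def standardField (p : C2) : C2 := Complex.I • p

/-- The affine map `(z, u) ↦ (e^{iφ} (z + b), u + q - 2 Im (z b̄))` of the Heisenberg sphere in its
coordinates `(z, u)`; the point with coordinates `(z, u)` is `(z, u + i |z|²)`. -/
def heisenbergAffine (b : ℂ) (q φ : ℝ) (p : C2) : C2 :=
  (Complex.exp (Complex.I * φ) * (p.1 + b),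
    ((p.2.re + q - 2 * (p.1 * conj b).im : ℝ) : ℂ) +
      Complex.I * ((‖Complex.exp (Complex.I * φ) * (p.1 + b)‖ ^ 2 : ℝ) : ℂ))

/-- The linear map of `ℂ²` given by a matrix. -/
def matrixAct (A : Matrix (Fin 2) (Fin 2) ℂ) (p : C2) : C2 :=
  (A 0 0 * p.1 + A 0 1 * p.2, A 1 0 * p.1 + A 1 1 * p.2)

/-- `A` preserves the Hermitian form `|z|² + |w|²`. -/
def IsUnitaryMatrix (A : Matrix (Fin 2) (Fin 2) ℂ) : Prop :=
  A ∈ Matrix.unitaryGroup (Fin 2) ℂ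

/-- `A` preserves the Hermitian form `|z|² - |w|²`. -/
def IsPseudoUnitaryMatrix (A : Matrix (Fin 2) (Fin 2) ℂ) : Prop :=
  A.conjTranspose * Matrix.diagonal ![1, -1] * A = Matrix.diagonal ![1, -1]

end

/-! ### Calculus on a subset of `ℂ²` that is a smooth retract of an open set. -/

noncomputable section

/-! Everything rests on two derivations. For a frame `E` of `H` put `L = (E - iJE)/2` and `Lb = (E +
iJE)/2`. Maps and fields whose differential is complex linear on `H` have components killed by `Lb`,
and on the models `[L, Lb]` is a constant multiple of the flow field `T`. A function killed by `L`
and `Lb` is therefore killed by `T` and is locally constant. Hence the classification problems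
become identities in a commutative ring with involution and two conjugate derivations, where `i` is
just a ring element with square `-1`. No analyticity and no extension off the hypersurface is
needed. The passage from geometry to algebra uses a smooth retraction, which reduces derivatives
along `M` to derivatives on an open set.

Let `X` be an infinitesimal CR automorphism of the Heisenberg sphere. Its component along `T` modulo
`H`, a real function `f`, determines `X`, since `Lb f = -2i X₁`. Repeated commutators give an
overdetermined system that closes: `X` is a quadratic field with eight real parameters
(`IsHeisenbergFrame.exists_coefficients`, `IsInfCRAut.exists_coefficients`).

For the normal form, a Heisenberg translation moves the point to the origin
(`holoHomothetic_translate`). Transversality says that the `T`-component there is non-zero, so a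
homothety makes it `1`. The projective isotropy maps then remove the value of the `z`-component at
the origin and the real part of its coefficient at `z` (`holoHomothetic_normalForm`).

For the dimensions, brackets of polynomial fields are computed on their coefficients, and the
Sasakian algebra is the centralizer of the Reeb field (`CRCoeff.hasDim`,
`CRCoeff.bracket_reeb_eq_zero_iff`). What remains is linear algebra in which `ρ - τ²` and `a` are
the obstructions to the larger dimension.

The round sphere and the hyperboloid are treated together as `|z|² + ε|w|² = 1` with `ε² = 1`. A
Cayley transform (`heisenberg_quadric`), the map `(e^{kw}, z e^{kw})` (`rigidSphere_quadric`) and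
homogeneity (`quadric_homogeneous`) relate the models. Rigidity of isomorphisms is again algebraic:
preserving `T` gives `T F = 0`, `T W = 1` on the Heisenberg sphere and `T F = iF` on the quadric,
and this forces the first derivatives of the map to have constant coefficients in the frame
(`IsHeisenbergFrame.exists_affine`, `IsQuadricFrame.exists_linear`). -/

/-- `π` is a smooth retraction of the open set `O` onto `M`. -/
structure SmoothRetract (M O : Set C2) (π : C2 → C2) : Prop where
  isOpen : IsOpen O
  subset : M ⊆ O
  smooth : ContDiffOn ℝ ∞ π O
  mapsTo : Set.MapsTo π O M
  fix : ∀ p ∈ M, π p = p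

section TangentCalculus

variable {G : Type*} [NormedAddCommGroup G] [NormedSpace ℝ G]

/-- A hypersurface does not have unique derivatives in `ℂ²`, so `fderivWithin` involves a choice.
Any two derivatives within `M` agree on the tangent cone, hence on its span, and there the choice is
invisible. -/
theorem HasFDerivWithinAt.fderivWithin_apply_of_mem_realTangent {f : C2 → G} {f' : C2 →L[ℝ] G}
    {M : Set C2} {p v : C2} (h : HasFDerivWithinAt f f' M p) (hv : v ∈ realTangent M p) :
    fderivWithin ℝ f M p v = f' v := by
  have h2 := h.differentiableWithinAt.hasFDerivWithinAt.unique_on h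
  have h3 : Set.EqOn (fderivWithin ℝ f M p : C2 →ₗ[ℝ] G) (f' : C2 →ₗ[ℝ] G)
      (Submodule.span ℝ (tangentConeAt ℝ M p)) := LinearMap.eqOn_span h2
  exact h3 hv

theorem HasFDerivWithinAt.map_mem_realTangent {f : C2 → C2} {f' : C2 →L[ℝ] C2}
    {M M' : Set C2} {p v : C2} (h : HasFDerivWithinAt f f' M p) (hm : Set.MapsTo f M M')
    (hv : v ∈ realTangent M p) : f' v ∈ realTangent M' (f p) := by
  have h1 : Submodule.map (f' : C2 →ₗ[ℝ] C2) (realTangent M p) ≤ realTangent M' (f p) := by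
    rw [realTangent, Submodule.map_span, Submodule.span_le]
    rintro _ ⟨u, hu, rfl⟩
    exact Submodule.subset_span (tangentConeAt_mono hm.image_subset (h.mapsTo_tangent_cone hu))
  exact h1 (Submodule.mem_map_of_mem hv)

theorem realTangent_inter {M U : Set C2} {p : C2} (hU : IsOpen U) (hp : p ∈ U) :
    realTangent (M ∩ U) p = realTangent M p := by
  rw [realTangent, tangentConeAt_inter_nhds (hU.mem_nhds hp), realTangent]

theorem cplxTangent_inter {M U : Set C2} {p : C2} (hU : IsOpen U) (hp : p ∈ U) :
    cplxTangent (M ∩ U) p = cplxTangent M p := by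
  simp only [cplxTangent, realTangent_inter hU hp]

end TangentCalculus

namespace SmoothRetract

variable {M O U : Set C2} {π : C2 → C2} {p v : C2}
variable {G : Type*} [NormedAddCommGroup G] [NormedSpace ℝ G]

theorem inter (h : SmoothRetract M O π) (hU : IsOpen U) :
    SmoothRetract (M ∩ U) (O ∩ π ⁻¹' U) π where
  isOpen := h.smooth.continuousOn.isOpen_inter_preimage h.isOpen hU
  subset := fun p hp => ⟨h.subset hp.1, by simpa [h.fix p hp.1] using hp.2⟩
  smooth := h.smooth.mono Set.inter_subset_left
  mapsTo := fun p hp => ⟨h.mapsTo hp.1, hp.2⟩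
  fix := fun p hp => h.fix p hp.1

theorem contDiffAt (h : SmoothRetract M O π) (hp : p ∈ O) : ContDiffAt ℝ ∞ π p :=
  h.smooth.contDiffAt (h.isOpen.mem_nhds hp)

theorem hasFDerivAt (h : SmoothRetract M O π) (hp : p ∈ O) : HasFDerivAt π (fderiv ℝ π p) p :=
  ((h.contDiffAt hp).differentiableAt (by simp)).hasFDerivAt

theorem fderiv_mem (h : SmoothRetract M O π) (hp : p ∈ M) (v : C2) :
    fderiv ℝ π p v ∈ realTangent M p := by
  have h1 := (h.hasFDerivAt (h.subset hp)).hasFDerivWithinAt (s := O)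
  have h2 := h1.map_mem_realTangent (v := v) h.mapsTo (Submodule.subset_span (by
    rw [tangentConeAt_of_mem_nhds (h.isOpen.mem_nhds (h.subset hp))]; trivial))
  rwa [h.fix p hp] at h2

theorem fderiv_eq (h : SmoothRetract M O π) (hp : p ∈ M) (hv : v ∈ realTangent M p) :
    fderiv ℝ π p v = v := by
  have h1 := (h.hasFDerivAt (h.subset hp)).hasFDerivWithinAt (s := M)
  have h2 : HasFDerivWithinAt π (ContinuousLinearMap.id ℝ C2) M p :=
    (hasFDerivWithinAt_id p M).congr (fun x hx => h.fix x hx) (h.fix p hp)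
  rw [← h1.fderivWithin_apply_of_mem_realTangent hv, h2.fderivWithin_apply_of_mem_realTangent hv]
  rfl

theorem mem_realTangent_iff (h : SmoothRetract M O π) (hp : p ∈ M) :
    v ∈ realTangent M p ↔ fderiv ℝ π p v = v :=
  ⟨h.fderiv_eq hp, fun h2 => h2 ▸ h.fderiv_mem hp v⟩

theorem contDiffOn_comp (h : SmoothRetract M O π) {F : C2 → G} (hF : ContDiffOn ℝ ∞ F M) :
    ContDiffOn ℝ ∞ (F ∘ π) O :=
  hF.comp h.smooth h.mapsTo

theorem contDiffAt_comp (h : SmoothRetract M O π) {F : C2 → G} (hF : ContDiffOn ℝ ∞ F M)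
    (hp : p ∈ O) : ContDiffAt ℝ ∞ (F ∘ π) p :=
  (h.contDiffOn_comp hF).contDiffAt (h.isOpen.mem_nhds hp)

theorem hasFDerivAt_comp (h : SmoothRetract M O π) {F : C2 → G} (hF : ContDiffOn ℝ ∞ F M)
    (hp : p ∈ O) : HasFDerivAt (F ∘ π) (fderiv ℝ (F ∘ π) p) p :=
  ((h.contDiffAt_comp hF hp).differentiableAt (by simp)).hasFDerivAt

theorem hasFDerivWithinAt (h : SmoothRetract M O π) {F : C2 → G} (hF : ContDiffOn ℝ ∞ F M)
    (hp : p ∈ M) : HasFDerivWithinAt F (fderiv ℝ (F ∘ π) p) M p :=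
  (h.hasFDerivAt_comp hF (h.subset hp)).hasFDerivWithinAt.congr
    (fun x hx => by simp [h.fix x hx]) (by simp [h.fix p hp])

theorem fderivWithin_apply (h : SmoothRetract M O π) {F : C2 → G} (hF : ContDiffOn ℝ ∞ F M)
    (hp : p ∈ M) (hv : v ∈ realTangent M p) :
    fderivWithin ℝ F M p v = fderiv ℝ (F ∘ π) p v :=
  (h.hasFDerivWithinAt hF hp).fderivWithin_apply_of_mem_realTangent hv

/-- The derivative of a smooth function along a smooth tangent field is smooth. -/
theorem contDiffOn_fderivWithin_apply (h : SmoothRetract M O π) {F : C2 → G} {V : C2 → C2}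
    (hF : ContDiffOn ℝ ∞ F M) (hV : IsTangentField M V) :
    ContDiffOn ℝ ∞ (fun q => fderivWithin ℝ F M q (V q)) M := by
  have h1 : ContDiffOn ℝ ∞ (fderiv ℝ (F ∘ π)) O :=
    (h.contDiffOn_comp hF).fderiv_of_isOpen h.isOpen (by simp)
  exact ((h1.mono h.subset).clm_apply hV.1).congr
    fun q hq => h.fderivWithin_apply hF hq (hV.2 q hq)

/-- The second derivative along two tangent fields, in terms of the extension by the retraction. -/
theorem fderivWithin_fderivWithin_apply (h : SmoothRetract M O π) {F : C2 → G} {V : C2 → C2}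
    (hF : ContDiffOn ℝ ∞ F M) (hV : IsTangentField M V) (hp : p ∈ M) (hv : v ∈ realTangent M p) :
    fderivWithin ℝ (fun q => fderivWithin ℝ F M q (V q)) M p v =
      fderiv ℝ (fderiv ℝ (F ∘ π)) p v (V p) + fderiv ℝ (F ∘ π) p (fderivWithin ℝ V M p v) := by
  have h1 : ContDiffOn ℝ ∞ (fderiv ℝ (F ∘ π)) O :=
    (h.contDiffOn_comp hF).fderiv_of_isOpen h.isOpen (by simp)
  have h2 : HasFDerivAt (fderiv ℝ (F ∘ π)) (fderiv ℝ (fderiv ℝ (F ∘ π)) p) p :=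
    ((h1.contDiffAt (h.isOpen.mem_nhds (h.subset hp))).differentiableAt (by simp)).hasFDerivAt
  have h3 := h2.hasFDerivWithinAt (s := M) |>.clm_apply (h.hasFDerivWithinAt hV.1 hp)
  have h4 := h3.congr (f₁ := fun q => fderivWithin ℝ F M q (V q))
    (fun q hq => h.fderivWithin_apply hF hq (hV.2 q hq))
    (h.fderivWithin_apply hF hp (hV.2 p hp))
  rw [h4.fderivWithin_apply_of_mem_realTangent hv, h.fderivWithin_apply hV.1 hp hv]
  simp [add_comm]

/-- Apply the second derivative formula to the identity function, whose derivative along `V` is `V`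
itself. It gives `dV(W) = D²π(W, V) + dπ(dV(W))`. In the difference with the roles exchanged the
symmetric term cancels, so `dπ` fixes the bracket. -/
theorem lieBracketWithin_mem (h : SmoothRetract M O π) {V W : C2 → C2}
    (hV : IsTangentField M V) (hW : IsTangentField M W) (hp : p ∈ M) :
    VectorField.lieBracketWithin ℝ V W M p ∈ realTangent M p := by
  have hid : ContDiffOn ℝ ∞ (fun q : C2 => q) M := contDiffOn_id
  have key : ∀ {V W : C2 → C2}, IsTangentField M V → IsTangentField M W →
      fderivWithin ℝ V M p (W p) =
        fderiv ℝ (fderiv ℝ ((fun q : C2 => q) ∘ π)) p (W p) (V p) +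
          fderiv ℝ ((fun q : C2 => q) ∘ π) p (fderivWithin ℝ V M p (W p)) := by
    intro V W hV hW
    rw [← h.fderivWithin_fderivWithin_apply hid hV hp (hW.2 p hp)]
    have hc : ∀ q ∈ M, fderivWithin ℝ (fun q : C2 => q) M q (V q) = V q := fun q hq => by
      exact (hasFDerivWithinAt_id q M).fderivWithin_apply_of_mem_realTangent (hV.2 q hq)
    rw [fderivWithin_congr hc (hc p hp)]
  have hs : IsSymmSndFDerivAt ℝ ((fun q : C2 => q) ∘ π) p :=
    (h.contDiffAt_comp hid (h.subset hp)).isSymmSndFDerivAt (by simpa using ENat.LEInfty.out)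
  rw [h.mem_realTangent_iff hp, VectorField.lieBracketWithin]
  have e1 := key hV hW
  have e2 := key hW hV
  have e3 := hs (V p) (W p)
  change _ = _ + fderiv ℝ π p _ at e1
  change _ = _ + fderiv ℝ π p _ at e2
  rw [map_sub]
  conv_rhs => rw [e1, e2, e3]
  abel

theorem commutator (h : SmoothRetract M O π) {F : C2 → G} {V W : C2 → C2}
    (hF : ContDiffOn ℝ ∞ F M) (hV : IsTangentField M V) (hW : IsTangentField M W) (hp : p ∈ M) :
    fderivWithin ℝ (fun q => fderivWithin ℝ F M q (W q)) M p (V p) -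
      fderivWithin ℝ (fun q => fderivWithin ℝ F M q (V q)) M p (W p) =
      fderivWithin ℝ F M p (VectorField.lieBracketWithin ℝ V W M p) := by
  rw [h.fderivWithin_fderivWithin_apply hF hW hp (hV.2 p hp),
    h.fderivWithin_fderivWithin_apply hF hV hp (hW.2 p hp),
    h.fderivWithin_apply hF hp (h.lieBracketWithin_mem hV hW hp), VectorField.lieBracketWithin,
    map_sub]
  have hs : IsSymmSndFDerivAt ℝ (F ∘ π) p :=
    (h.contDiffAt_comp hF (h.subset hp)).isSymmSndFDerivAt (by simpa using ENat.LEInfty.out)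
  rw [hs (V p) (W p)]
  abel

/-- A function whose tangential derivative vanishes is locally constant. -/
theorem isLocallyConstant (h : SmoothRetract M O π) {F : C2 → G} (hF : ContDiffOn ℝ ∞ F M)
    (h0 : ∀ p ∈ M, ∀ v ∈ realTangent M p, fderivWithin ℝ F M p v = 0) :
    IsLocallyConstant (fun p : M => F p) := by
  -- By the chain rule `d(F ∘ π)` is `dF` after `dπ`, and `dπ` takes values in the tangent space at
  -- `π q`, where `dF` vanishes.
  have hd : ∀ q ∈ O, fderiv ℝ (F ∘ π) q = 0 := by
    intro q hq
    have hm := h.mapsTo hq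
    have h1 := (h.hasFDerivWithinAt hF hm).comp q
      ((h.hasFDerivAt hq).hasFDerivWithinAt (s := O)) h.mapsTo
    have h2 := h1.hasFDerivAt (h.isOpen.mem_nhds hq)
    rw [h2.fderiv]
    refine ContinuousLinearMap.ext fun v => ?_
    have h3 : fderiv ℝ π q v ∈ realTangent M (π q) :=
      ((h.hasFDerivAt hq).hasFDerivWithinAt (s := O)).map_mem_realTangent h.mapsTo
        (Submodule.subset_span (by
          rw [tangentConeAt_of_mem_nhds (h.isOpen.mem_nhds hq)]; trivial))
    have := h0 _ hm _ h3
    rw [h.fderivWithin_apply hF hm h3] at this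
    simpa using this
  intro s
  have h1 := h.isOpen.isOpen_inter_preimage_of_fderiv_eq_zero (𝕜 := ℝ) (f := F ∘ π)
    ((h.contDiffOn_comp hF).differentiableOn (by simp)) (fun q hq => hd q hq) s
  have : (fun p : M => F p) ⁻¹' s = Subtype.val ⁻¹' (O ∩ F ∘ π ⁻¹' s) := by
    ext p
    have := h.subset p.2
    simp [h.fix p p.2, this]
  rw [this]
  exact h1.preimage continuous_subtype_val

end SmoothRetract

end

/-! ### The star algebra of smooth functions on `M` and the derivations given by tangent fields. -/

noncomputable section

/-- Smooth complex valued functions on `M`. -/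
def smoothFunctions (M : Set C2) : StarSubalgebra ℂ (M → ℂ) where
  carrier := {F | ∃ G : C2 → ℂ, ContDiffOn ℝ ∞ G M ∧ ∀ p : M, F p = G p}
  mul_mem' := by
    rintro _ _ ⟨G, hG, h⟩ ⟨G', hG', h'⟩
    exact ⟨_, hG.mul hG', fun p => by simp [h, h']⟩
  add_mem' := by
    rintro _ _ ⟨G, hG, h⟩ ⟨G', hG', h'⟩
    exact ⟨_, hG.add hG', fun p => by simp [h, h']⟩
  algebraMap_mem' := fun c => ⟨fun _ => c, contDiffOn_const, fun p => by simp⟩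
  star_mem' := by
    rintro _ ⟨G, hG, h⟩
    exact ⟨fun p => conj (G p), Complex.conjCLE.contDiff.comp_contDiffOn hG,
      fun p => by simp [h]⟩

variable {M : Set C2}

namespace smoothFunctions

/-- The restriction of a smooth function. -/
def restrict (G : C2 → ℂ) (hG : ContDiffOn ℝ ∞ G M) : smoothFunctions M :=
  ⟨fun p => G p, G, hG, fun _ => rfl⟩

/-- The extension by zero of a function on `M`. -/
def ext0 (F : smoothFunctions M) : C2 → ℂ :=
  open Classical in fun p => if h : p ∈ M then F.1 ⟨p, h⟩ else 0

theorem ext0_apply (F : smoothFunctions M) {p : C2} (hp : p ∈ M) : (ext0 F) p = F.1 ⟨p, hp⟩ := by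
  simp [ext0, hp]

theorem ext0_apply_coe (F : smoothFunctions M) (p : M) : (ext0 F) p = F.1 p :=
  ext0_apply F p.2

theorem contDiffOn_ext0 (F : smoothFunctions M) : ContDiffOn ℝ ∞ (ext0 F) M := by
  obtain ⟨G, hG, h⟩ := F.2
  exact hG.congr fun p hp => by rw [ext0_apply F hp, h]

theorem ext0_restrict {G : C2 → ℂ} (hG : ContDiffOn ℝ ∞ G M) :
    Set.EqOn (ext0 (restrict G hG)) G M :=
  fun _ hp => ext0_apply _ hp

theorem ext {F F' : smoothFunctions M} (h : ∀ p : M, F.1 p = F'.1 p) : F = F' :=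
  Subtype.ext (funext h)

/-- The coordinate `z`. -/
def z (M : Set C2) : smoothFunctions M := restrict Prod.fst contDiff_fst.contDiffOn

/-- The coordinate `w`. -/
def w (M : Set C2) : smoothFunctions M := restrict Prod.snd contDiff_snd.contDiffOn

end smoothFunctions

namespace SmoothRetract

open smoothFunctions

variable {O : Set C2} {π : C2 → C2} {V W : C2 → C2}

/-- The derivation of the ring of smooth functions given by a smooth tangent field. -/
def derivation (h : SmoothRetract M O π) (hV : IsTangentField M V) :
    Derivation ℂ (smoothFunctions M) (smoothFunctions M) :=
  Derivation.mk'
    { toFun := fun F => restrict _ (h.contDiffOn_fderivWithin_apply (contDiffOn_ext0 F) hV)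
      map_add' := fun F F' => smoothFunctions.ext fun p => by
        have h1 := ((h.hasFDerivWithinAt (contDiffOn_ext0 F) p.2).add
          (h.hasFDerivWithinAt (contDiffOn_ext0 F') p.2)).congr (f₁ := (ext0 (F + F')))
          (fun q hq => by simp [ext0_apply _ hq]) (by simp [ext0_apply _ p.2])
        change fderivWithin ℝ (ext0 (F + F')) M p (V p) =
          fderivWithin ℝ (ext0 F) M p (V p) + fderivWithin ℝ (ext0 F') M p (V p)
        rw [h1.fderivWithin_apply_of_mem_realTangent (hV.2 p p.2),
          h.fderivWithin_apply (contDiffOn_ext0 F) p.2 (hV.2 p p.2),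
          h.fderivWithin_apply (contDiffOn_ext0 F') p.2 (hV.2 p p.2)]
        simp
      map_smul' := fun c F => smoothFunctions.ext fun p => by
        have h1 := ((h.hasFDerivWithinAt (contDiffOn_ext0 F) p.2).const_smul c).congr
          (f₁ := (ext0 (c • F)))
          (fun q hq => by simp [ext0_apply _ hq]) (by simp [ext0_apply _ p.2])
        change fderivWithin ℝ _ _ _ _ = c * fderivWithin ℝ _ _ _ _
        rw [h1.fderivWithin_apply_of_mem_realTangent (hV.2 p p.2),
          h.fderivWithin_apply (contDiffOn_ext0 F) p.2 (hV.2 p p.2)]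
        simp }
    (fun F F' => smoothFunctions.ext fun p => by
      have h1 := ((h.hasFDerivWithinAt (contDiffOn_ext0 F) p.2).mul
          (h.hasFDerivWithinAt (contDiffOn_ext0 F') p.2)).congr (f₁ := (ext0 (F * F')))
          (fun q hq => by simp [ext0_apply _ hq]) (by simp [ext0_apply _ p.2])
      change fderivWithin ℝ _ _ _ _ = F.1 p * fderivWithin ℝ _ _ _ _ +
        F'.1 p * fderivWithin ℝ _ _ _ _
      rw [h1.fderivWithin_apply_of_mem_realTangent (hV.2 p p.2),
        h.fderivWithin_apply (contDiffOn_ext0 F) p.2 (hV.2 p p.2),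
        h.fderivWithin_apply (contDiffOn_ext0 F') p.2 (hV.2 p p.2)]
      simp [ext0_apply_coe])

theorem derivation_eq (h : SmoothRetract M O π) (hV : IsTangentField M V)
    (F : smoothFunctions M) : h.derivation hV F =
      restrict _ (h.contDiffOn_fderivWithin_apply (contDiffOn_ext0 F) hV) := rfl

theorem derivation_apply (h : SmoothRetract M O π) (hV : IsTangentField M V)
    (F : smoothFunctions M) (p : M) :
    (h.derivation hV F).1 p = fderivWithin ℝ (ext0 F) M p (V p) := rfl

theorem derivation_restrict_apply (h : SmoothRetract M O π) (hV : IsTangentField M V)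
    {G : C2 → ℂ} (hG : ContDiffOn ℝ ∞ G M) (p : M) :
    (h.derivation hV (restrict G hG)).1 p = fderivWithin ℝ G M p (V p) := by
  rw [derivation_apply, fderivWithin_congr (ext0_restrict hG) (ext0_restrict hG p.2)]

theorem derivation_star (h : SmoothRetract M O π) (hV : IsTangentField M V)
    (F : smoothFunctions M) : h.derivation hV (star F) = star (h.derivation hV F) := by
  refine smoothFunctions.ext fun p => ?_
  have h1 := (Complex.conjCLE.toContinuousLinearMap.hasFDerivAt.comp_hasFDerivWithinAt p.1
    (h.hasFDerivWithinAt (contDiffOn_ext0 F) p.2)).congr (f₁ := (ext0 (star F)))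
    (fun q hq => by simp [ext0_apply _ hq]) (by simp [ext0_apply _ p.2])
  change fderivWithin ℝ _ _ _ _ = conj (fderivWithin ℝ _ _ _ _)
  rw [h1.fderivWithin_apply_of_mem_realTangent (hV.2 p p.2),
    h.fderivWithin_apply (contDiffOn_ext0 F) p.2 (hV.2 p p.2)]
  simp

theorem derivation_z (h : SmoothRetract M O π) (hV : IsTangentField M V) (p : M) :
    (h.derivation hV (z M)).1 p = (V p).1 := by
  rw [z, derivation_restrict_apply,
    hasFDerivAt_fst.hasFDerivWithinAt.fderivWithin_apply_of_mem_realTangent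
    (hV.2 p p.2)]
  rfl

theorem derivation_w (h : SmoothRetract M O π) (hV : IsTangentField M V) (p : M) :
    (h.derivation hV (w M)).1 p = (V p).2 := by
  rw [w, derivation_restrict_apply,
    hasFDerivAt_snd.hasFDerivWithinAt.fderivWithin_apply_of_mem_realTangent
    (hV.2 p p.2)]
  rfl

theorem commutator_derivation (h : SmoothRetract M O π) {X : C2 → C2} (hV : IsTangentField M V)
    (hW : IsTangentField M W) (hX : IsTangentField M X)
    (hb : ∀ p ∈ M, VectorField.lieBracketWithin ℝ V W M p = X p) (F : smoothFunctions M) :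
    h.derivation hV (h.derivation hW F) - h.derivation hW (h.derivation hV F) =
      h.derivation hX F := by
  refine smoothFunctions.ext fun p => ?_
  have := h.commutator (contDiffOn_ext0 F) hV hW p.2
  rw [hb p p.2] at this
  rw [derivation_apply, ← this]
  change (h.derivation hV (h.derivation hW F)).1 p - (h.derivation hW (h.derivation hV F)).1 p = _
  rw [h.derivation_eq hW, h.derivation_eq hV F, derivation_restrict_apply,
    derivation_restrict_apply]

/-- The components of a smooth map on `M`. -/
theorem derivation_component (h : SmoothRetract M O π) (hV : IsTangentField M V) {f : C2 → C2}
    (hf : ContDiffOn ℝ ∞ f M) (p : M) :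
    ((h.derivation hV (restrict (fun q => (f q).1) hf.fst)).1 p,
      (h.derivation hV (restrict (fun q => (f q).2) hf.snd)).1 p) = fderivWithin ℝ f M p (V p) := by
  have h1 := h.hasFDerivWithinAt hf p.2
  rw [derivation_restrict_apply, derivation_restrict_apply,
    h1.fst.fderivWithin_apply_of_mem_realTangent (hV.2 p p.2),
    h1.snd.fderivWithin_apply_of_mem_realTangent (hV.2 p p.2),
    h1.fderivWithin_apply_of_mem_realTangent (hV.2 p p.2)]
  rfl

end SmoothRetract

end

/-! ### The derivations of types `(1, 0)` and `(0, 1)` attached to a section of `H`. -/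

noncomputable section

variable {M O U : Set C2} {π : C2 → C2} {V W E : C2 → C2}

theorem IsTangentField.lieBracketWithin_eq {V' W' : C2 →L[ℝ] C2} {p : C2}
    (hV : IsTangentField M V) (hW : IsTangentField M W) (hp : p ∈ M)
    (hV' : HasFDerivAt V V' p) (hW' : HasFDerivAt W W' p) :
    VectorField.lieBracketWithin ℝ V W M p = W' (V p) - V' (W p) := by
  rw [VectorField.lieBracketWithin,
    hV'.hasFDerivWithinAt.fderivWithin_apply_of_mem_realTangent (hW.2 p hp),
    hW'.hasFDerivWithinAt.fderivWithin_apply_of_mem_realTangent (hV.2 p hp)]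

theorem IsCplxTangentField.tangent (h : IsCplxTangentField M E) : IsTangentField M E :=
  ⟨h.1, fun p hp => (h.2 p hp).1⟩

theorem IsCplxTangentField.tangent_I (h : IsCplxTangentField M E) :
    IsTangentField M (fun q => Complex.I • E q) :=
  ⟨h.1.const_smul Complex.I, fun p hp => (h.2 p hp).2⟩

theorem IsTangentField.inter (h : IsTangentField M V) (hU : IsOpen U) :
    IsTangentField (M ∩ U) V :=
  ⟨h.1.mono Set.inter_subset_left, fun p hp => by
    rw [realTangent_inter hU hp.2]; exact h.2 p hp.1⟩

theorem IsCplxTangentField.inter (h : IsCplxTangentField M V) (hU : IsOpen U) :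
    IsCplxTangentField (M ∩ U) V :=
  ⟨h.1.mono Set.inter_subset_left, fun p hp => by
    rw [cplxTangent_inter hU hp.2]; exact h.2 p hp.1⟩

namespace SmoothRetract

open smoothFunctions

/-- The structure equations of the frames used below have a constant real multiple of one fixed
field on the right. The value `c = 0` covers commuting fields. -/
theorem smul_commutator_derivation (h : SmoothRetract M O π) {X : C2 → C2} {c : ℝ}
    (hV : IsTangentField M V) (hW : IsTangentField M W) (hX : IsTangentField M X)
    (hb : ∀ p ∈ M, VectorField.lieBracketWithin ℝ V W M p = c • X p) (F : smoothFunctions M) :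
    h.derivation hV (h.derivation hW F) - h.derivation hW (h.derivation hV F) =
      (c : ℂ) • h.derivation hX F := by
  have hcX : IsTangentField M (fun q => c • X q) :=
    ⟨hX.1.const_smul c, fun p hp => Submodule.smul_mem _ _ (hX.2 p hp)⟩
  rw [h.commutator_derivation hV hW hcX hb]
  refine smoothFunctions.ext fun p => ?_
  change fderivWithin ℝ (ext0 F) M p (c • X p) = c * fderivWithin ℝ (ext0 F) M p (X p)
  simp

/-- The `(1, 0)` derivation of a section of the complex tangent bundle. -/
def del (h : SmoothRetract M O π) (hE : IsCplxTangentField M E) :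
    Derivation ℂ (smoothFunctions M) (smoothFunctions M) :=
  (1 / 2 : ℂ) • (h.derivation hE.tangent - Complex.I • h.derivation hE.tangent_I)

/-- The `(0, 1)` derivation of a section of the complex tangent bundle. -/
def delbar (h : SmoothRetract M O π) (hE : IsCplxTangentField M E) :
    Derivation ℂ (smoothFunctions M) (smoothFunctions M) :=
  (1 / 2 : ℂ) • (h.derivation hE.tangent + Complex.I • h.derivation hE.tangent_I)

theorem del_apply (h : SmoothRetract M O π) (hE : IsCplxTangentField M E)
    (F : smoothFunctions M) : h.del hE F =
      (1 / 2 : ℂ) • (h.derivation hE.tangent F - Complex.I • h.derivation hE.tangent_I F) := rfl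

theorem delbar_apply (h : SmoothRetract M O π) (hE : IsCplxTangentField M E)
    (F : smoothFunctions M) : h.delbar hE F =
      (1 / 2 : ℂ) • (h.derivation hE.tangent F + Complex.I • h.derivation hE.tangent_I F) := rfl

theorem derivation_eq_del_add_delbar (h : SmoothRetract M O π) (hE : IsCplxTangentField M E)
    (F : smoothFunctions M) : h.derivation hE.tangent F = h.del hE F + h.delbar hE F := by
  rw [del_apply, delbar_apply]; module

theorem derivation_I_eq (h : SmoothRetract M O π) (hE : IsCplxTangentField M E)
    (F : smoothFunctions M) :
    h.derivation hE.tangent_I F = Complex.I • (h.del hE F - h.delbar hE F) := by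
  rw [del_apply, delbar_apply]
  have hI : ∀ F : smoothFunctions M, Complex.I • Complex.I • F = -F := fun F => by
    rw [smul_smul, Complex.I_mul_I, neg_one_smul]
  simp only [smul_sub, smul_add, smul_comm Complex.I (1 / 2 : ℂ), hI]
  module

theorem del_star (h : SmoothRetract M O π) (hE : IsCplxTangentField M E)
    (F : smoothFunctions M) : h.del hE (star F) = star (h.delbar hE F) := by
  simp only [del_apply, delbar_apply, derivation_star, star_smul, star_add]
  simp
  module

theorem delbar_star (h : SmoothRetract M O π) (hE : IsCplxTangentField M E)
    (F : smoothFunctions M) : h.delbar hE (star F) = star (h.del hE F) := by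
  rw [← star_star (h.delbar hE (star F)), ← del_star, star_star]

/-- Expanding `[E - iJE, E + iJE] / 4` gives `(i/2) [E, JE]`. -/
theorem del_delbar_sub (h : SmoothRetract M O π) (hE : IsCplxTangentField M E) {X : C2 → C2}
    {c : ℝ} (hX : IsTangentField M X)
    (hb : ∀ p ∈ M, VectorField.lieBracketWithin ℝ E (fun q => Complex.I • E q) M p = c • X p)
    (F : smoothFunctions M) : h.del hE (h.delbar hE F) - h.delbar hE (h.del hE F) =
      (Complex.I / 2 * c) • h.derivation hX F := by
  rw [mul_smul, ← h.smul_commutator_derivation hE.tangent hE.tangent_I hX hb]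
  simp only [del_apply, delbar_apply, Derivation.map_smul, Derivation.map_add, Derivation.map_sub]
  module

theorem del_z (h : SmoothRetract M O π) (hE : IsCplxTangentField M E) (p : M) :
    (h.del hE (z M)).1 p = (E p).1 := by
  change (1 / 2 : ℂ) * ((h.derivation hE.tangent (z M)).1 p -
    Complex.I * (h.derivation hE.tangent_I (z M)).1 p) = _
  rw [derivation_z, derivation_z]
  simp only [Prod.smul_fst, smul_eq_mul]
  linear_combination (-1 / 2 * (E p).1) * Complex.I_sq

theorem del_w (h : SmoothRetract M O π) (hE : IsCplxTangentField M E) (p : M) :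
    (h.del hE (w M)).1 p = (E p).2 := by
  change (1 / 2 : ℂ) * ((h.derivation hE.tangent (w M)).1 p -
    Complex.I * (h.derivation hE.tangent_I (w M)).1 p) = _
  rw [derivation_w, derivation_w]
  simp only [Prod.smul_snd, smul_eq_mul]
  linear_combination (-1 / 2 * (E p).2) * Complex.I_sq

/-- The components of a map whose differential commutes with `i` on `E` are CR functions. -/
theorem delbar_component (h : SmoothRetract M O π) (hE : IsCplxTangentField M E) {f : C2 → C2}
    (hf : ContDiffOn ℝ ∞ f M) (hI : ∀ p ∈ M, fderivWithin ℝ f M p (Complex.I • E p) =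
      Complex.I • fderivWithin ℝ f M p (E p)) :
    h.delbar hE (restrict (fun q => (f q).1) hf.fst) = 0 ∧
      h.delbar hE (restrict (fun q => (f q).2) hf.snd) = 0 := by
  have key : ∀ p : M, _ := fun p => hI p p.2
  simp only [← h.derivation_component hE.tangent hf, ← h.derivation_component hE.tangent_I hf,
    Prod.ext_iff] at key
  constructor <;> refine smoothFunctions.ext fun p => ?_
  · change (1 / 2 : ℂ) * ((h.derivation hE.tangent _).1 p +
      Complex.I * (h.derivation hE.tangent_I _).1 p) = 0
    rw [(key p).1]
    simp only [Prod.smul_fst, smul_eq_mul]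
    linear_combination (1 / 2 * (h.derivation hE.tangent (restrict _ hf.fst)).1 p) * Complex.I_sq
  · change (1 / 2 : ℂ) * ((h.derivation hE.tangent _).1 p +
      Complex.I * (h.derivation hE.tangent_I _).1 p) = 0
    rw [(key p).2]
    simp only [Prod.smul_snd, smul_eq_mul]
    linear_combination (1 / 2 * (h.derivation hE.tangent (restrict _ hf.snd)).1 p) * Complex.I_sq

theorem delbar_z (h : SmoothRetract M O π) (hE : IsCplxTangentField M E) :
    h.delbar hE (z M) = 0 :=
  (h.delbar_component hE (f := fun q => q) contDiffOn_id fun p hp => by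
    change fderivWithin ℝ id M p _ = _ • fderivWithin ℝ id M p _
    rw [(hasFDerivWithinAt_id (𝕜 := ℝ) p M).fderivWithin_apply_of_mem_realTangent (hE.2 p hp).2,
      (hasFDerivWithinAt_id (𝕜 := ℝ) p M).fderivWithin_apply_of_mem_realTangent (hE.2 p hp).1]
    rfl).1

theorem delbar_w (h : SmoothRetract M O π) (hE : IsCplxTangentField M E) :
    h.delbar hE (w M) = 0 :=
  (h.delbar_component hE (f := fun q => q) contDiffOn_id fun p hp => by
    change fderivWithin ℝ id M p _ = _ • fderivWithin ℝ id M p _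
    rw [(hasFDerivWithinAt_id (𝕜 := ℝ) p M).fderivWithin_apply_of_mem_realTangent (hE.2 p hp).2,
      (hasFDerivWithinAt_id (𝕜 := ℝ) p M).fderivWithin_apply_of_mem_realTangent (hE.2 p hp).1]
    rfl).2

theorem isLocallyConstant_of_del_eq_zero (h : SmoothRetract M O π) (hE : IsCplxTangentField M E)
    (hV : IsTangentField M V)
    (hspan : ∀ p ∈ M, ∀ v ∈ realTangent M p, ∃ a b c : ℝ,
      v = a • E p + b • Complex.I • E p + c • V p)
    {F : smoothFunctions M} (h1 : h.del hE F = 0) (h2 : h.delbar hE F = 0)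
    (h3 : h.derivation hV F = 0) : IsLocallyConstant F.1 := by
  have h4 := h.derivation_eq_del_add_delbar hE F
  have h5 := h.derivation_I_eq hE F
  rw [h1, h2, add_zero] at h4
  rw [h1, h2, sub_zero, smul_zero] at h5
  have := h.isLocallyConstant (contDiffOn_ext0 F) fun p hp v hv => by
    obtain ⟨a, b, c, rfl⟩ := hspan p hp v hv
    have e1 : fderivWithin ℝ (ext0 F) M p (E p) = 0 :=
      congrArg (fun G : smoothFunctions M => G.1 ⟨p, hp⟩) h4
    have e2 : fderivWithin ℝ (ext0 F) M p (Complex.I • E p) = 0 :=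
      congrArg (fun G : smoothFunctions M => G.1 ⟨p, hp⟩) h5
    have e3 : fderivWithin ℝ (ext0 F) M p (V p) = 0 :=
      congrArg (fun G : smoothFunctions M => G.1 ⟨p, hp⟩) h3
    simp [e1, e2, e3]
  simpa [ext0_apply_coe] using this

end SmoothRetract

end

/-! ### The algebraic core: commutative rings with conjugate derivations and constant structure
equations. -/

noncomputable section

section Algebra

/-- Rings of smooth functions have zero divisors, so integer factors are cancelled through the
scalars `ℂ`. -/
theorem eq_zero_of_natCast_mul {A : Type*} [CommRing A] [Algebra ℂ A] {n : ℕ} (hn : n ≠ 0)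
    {x : A} (h : (n : A) * x = 0) : x = 0 := by
  have h2 : (n : ℂ) • x = 0 := by rw [Algebra.smul_def, map_natCast, h]
  exact (smul_eq_zero.1 h2).resolve_left (by exact_mod_cast hn)

variable {A : Type*} [CommRing A] [StarRing A] [Algebra ℂ A]

/-- Derivations `L`, `Lb` of types `(1, 0)` and `(0, 1)`, conjugate to each other. -/
structure IsCRFrame (L Lb T : Derivation ℂ A A) (i : A) : Prop where
  i_sq : i * i = -1
  star_i : star i = -i
  L_i : L i = 0
  Lb_i : Lb i = 0
  T_i : T i = 0
  L_star : ∀ F, L (star F) = star (Lb F)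
  Lb_star : ∀ F, Lb (star F) = star (L F)
  T_star : ∀ F, T (star F) = star (T F)

/-- The frame of the Heisenberg sphere `v = |z|²`. -/
structure IsHeisenbergFrame (L Lb T : Derivation ℂ A A) (i z w : A) : Prop
    extends IsCRFrame L Lb T i where
  comm : ∀ F, L (Lb F) - Lb (L F) = -2 * i * T F
  comm_T : ∀ F, T (L F) = L (T F)
  L_z : L z = 1
  Lb_z : Lb z = 0
  T_z : T z = 0
  L_w : L w = 2 * i * star z
  Lb_w : Lb w = 0
  T_w : T w = 1
  w_sub : w - star w = 2 * i * z * star z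

namespace IsHeisenbergFrame

variable {L Lb T : Derivation ℂ A A} {i z w : A}

theorem comm_Tb (h : IsHeisenbergFrame L Lb T i z w) (F : A) : T (Lb F) = Lb (T F) := by
  have := congrArg star (h.comm_T (star F))
  rw [h.L_star, h.T_star, h.T_star, h.L_star, star_star, star_star] at this
  exact this

/-- `T` is the commutator of `L` and `Lb` up to the unit `-2i`. Thus the common kernel of `L` and
`Lb` plays the role of the constants. -/
theorem T_eq_zero (h : IsHeisenbergFrame L Lb T i z w) {F : A} (h1 : L F = 0) (h2 : Lb F = 0) :
    T F = 0 := by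
  have := h.comm F
  rw [h1, h2, map_zero, map_zero, sub_zero] at this
  refine eq_zero_of_natCast_mul (n := 2) two_ne_zero ?_
  push_cast
  linear_combination -i * this + 2 * T F * h.i_sq

theorem star_const (h : IsHeisenbergFrame L Lb T i z w) {F : A} (h1 : L F = 0)
    (h2 : Lb F = 0) : L (star F) = 0 ∧ Lb (star F) = 0 := by
  rw [h.L_star, h.Lb_star, h1, h2, star_zero]; exact ⟨rfl, rfl⟩

/-- The components of an infinitesimal CR automorphism are quadratic polynomials. -/
theorem exists_coefficients (h : IsHeisenbergFrame L Lb T i z w) {X₁ X₂ : A}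
    (h1 : Lb X₁ = 0) (h2 : Lb X₂ = 0)
    (h3 : X₂ - star X₂ = 2 * i * (star z * X₁ + z * star X₁)) :
    ∃ α β a r t : A, (L α = 0 ∧ Lb α = 0) ∧ (L β = 0 ∧ Lb β = 0) ∧ (L a = 0 ∧ Lb a = 0) ∧
      (L r = 0 ∧ Lb r = 0) ∧ (L t = 0 ∧ Lb t = 0) ∧ star r = r ∧ star t = t ∧
      X₁ = α + β * z + a * w + 2 * i * star a * z ^ 2 + r * z * w ∧
      X₂ = t + 2 * i * star α * z + (β + star β) * w + 2 * i * star a * z * w + r * w ^ 2 := by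
  -- Conjugates are renamed, so that they become independent atoms with known derivatives and the
  -- star does not get distributed again.
  obtain ⟨y, hy⟩ : ∃ y, star z = y := ⟨_, rfl⟩
  obtain ⟨b, hb⟩ : ∃ b, star X₁ = b := ⟨_, rfl⟩
  have hsy : star y = z := by rw [← hy, star_star]
  have hsb : star b = X₁ := by rw [← hb, star_star]
  have hLy : L y = 0 := by rw [← hy, h.L_star, h.Lb_z, star_zero]
  have hLby : Lb y = 1 := by rw [← hy, h.Lb_star, h.L_z, star_one]
  have hTy : T y = 0 := by rw [← hy, h.T_star, h.T_z, star_zero]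
  have hLb' : L b = 0 := by rw [← hb, h.L_star, h1, star_zero]
  have hLw := h.L_w
  have hww := h.w_sub
  have hi := h.i_sq
  rw [hy] at hLw hww
  rw [hy, hb] at h3
  have D2 : ∀ D : Derivation ℂ A A, D 2 = 0 := fun D => by
    simpa using D.map_natCast 2
  have D4 : ∀ D : Derivation ℂ A A, D 4 = 0 := fun D => by
    simpa using D.map_natCast 4
  -- `f` is the component of `X` along `T` modulo `H`. Tangency says that it is real, and it is a
  -- potential for `X₁` and its conjugate.
  obtain ⟨f, hf⟩ : ∃ f, f = X₂ - 2 * i * y * X₁ := ⟨_, rfl⟩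
  have hLbf : Lb f = -2 * i * X₁ := by
    rw [hf]; simp [h1, h2, hLby, D2, h.Lb_i]; ring
  have hsf : star f = f := by
    rw [hf]; simp only [star_sub, star_mul, hb, hsy, h.star_i, star_ofNat]
    linear_combination -h3
  have hLf : L f = 2 * i * b := by
    rw [← hsf, h.L_star, hLbf]; simp [h.star_i, hb]
  -- The commutation relation is now applied to `f`, `X₁`, `b` and `L X₁` in turn. Each application
  -- expresses a second or third derivative through `T`, until `T (T b) = 0` closes the system.
  have E1 : L X₁ + Lb b = T f := by
    have := h.comm f
    rw [hLf, hLbf] at this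
    simp [D2, h.L_i, h.Lb_i] at this
    refine sub_eq_zero.1 (eq_zero_of_natCast_mul (n := 2) two_ne_zero ?_)
    push_cast
    linear_combination i * this + 2 * (L X₁ + Lb b - T f) * hi
  have E2 : Lb (L X₁) = 2 * i * T X₁ := by
    have := h.comm X₁
    rw [h1, map_zero] at this
    linear_combination -this
  have E2' : L (Lb b) = -2 * i * T b := by
    have := h.comm b
    rw [hLb', map_zero] at this
    linear_combination this
  have E3 : L (L X₁) = 4 * i * T b := by
    have := congrArg L E1
    rw [map_add, E2', ← h.comm_T, hLf] at this
    simp [D2, h.T_i] at this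
    linear_combination this
  have E4 : T (Lb b) = T (L X₁) := by
    have e1 := h.comm (L X₁)
    rw [E2, E3] at e1
    simp [D2, D4, h.L_i, h.Lb_i, ← h.comm_T, ← h.comm_Tb] at e1
    refine sub_eq_zero.1 (eq_zero_of_natCast_mul (n := 4) four_ne_zero ?_)
    push_cast
    linear_combination i * e1 + 4 * (T (Lb b) - T (L X₁)) * hi
  -- The coefficients are peeled off from the highest one down. Each of `r`, `a`, `β`, `α`, `t` is a
  -- component of `X` or one of its derivatives, minus the contribution of the coefficients already
  -- found, and is killed by both `L` and `Lb`. Reality of `r` is exactly `E4`.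
  obtain ⟨r, hr⟩ : ∃ r, r = T (L X₁) := ⟨_, rfl⟩
  have hrs : star r = r := by
    rw [hr, ← h.T_star, ← h.Lb_star, hb, E4]
  have hTTb : T (T b) = 0 := by
    have := congrArg L E4
    rw [← h.comm_T, ← h.comm_T, E2', E3] at this
    simp [D2, D4, h.T_i] at this
    refine eq_zero_of_natCast_mul (n := 6) (by norm_num) ?_
    push_cast
    linear_combination i * this + 6 * T (T b) * hi
  have hTTX : T (T X₁) = 0 := by
    rw [← hsb, h.T_star, h.T_star, hTTb, star_zero]
  have hLr : L r = 0 := by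
    rw [hr, ← h.comm_T, E3]; simp [D4, h.T_i, hTTb]
  have hLbr : Lb r = 0 := by
    rw [hr, ← h.comm_Tb, E2]; simp [D2, h.T_i, hTTX]
  obtain ⟨a, ha⟩ : ∃ a, a = T X₁ - r * z := ⟨_, rfl⟩
  have hLa : L a = 0 := by rw [ha]; simp [h.L_z, hLr, ← h.comm_T, ← hr]
  have hLba : Lb a = 0 := by rw [ha]; simp [h.Lb_z, hLbr, ← h.comm_Tb, h1]
  obtain ⟨c, hc⟩ : ∃ c, star a = c := ⟨_, rfl⟩
  obtain ⟨hLc, hLbc⟩ := h.star_const hLa hLba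
  rw [hc] at hLc hLbc
  have hc' : c = T b - r * y := by
    rw [← hc, ha]; simp [← h.T_star, hb, hy, hrs, mul_comm]
  -- The subtracted terms are what `L` produces from `a w + 2i ā z² + r z w`, because `L w = 2i z̄`.
  obtain ⟨β, hβ⟩ : ∃ β, β = L X₁ - 2 * i * y * a - 4 * i * c * z - r * w - 2 * i * y * z * r :=
    ⟨_, rfl⟩
  have hLβ : L β = 0 := by
    rw [hβ]; simp [D2, D4, h.L_i, h.L_z, hLw, hLy, hLa, hLc, hLr, E3]
    rw [hc']; ring
  have hLbβ : Lb β = 0 := by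
    rw [hβ]; simp [D2, D4, h.Lb_i, h.Lb_z, h.Lb_w, hLby, hLba, hLbc, hLbr, E2]
    rw [ha]; ring
  obtain ⟨α, hα⟩ : ∃ α, α = X₁ - β * z - a * w - 2 * i * c * z ^ 2 - r * z * w := ⟨_, rfl⟩
  have hLα : L α = 0 := by
    rw [hα]; simp [pow_two, D2, h.L_i, h.L_z, hLw, hLβ, hLa, hLc, hLr]
    rw [hβ]; ring
  have hLbα : Lb α = 0 := by
    rw [hα]; simp [pow_two, D2, h.Lb_i, h.Lb_z, h.Lb_w, hLbβ, hLba, hLbc, hLbr, h1]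
  obtain ⟨α', hα'⟩ : ∃ α', star α = α' := ⟨_, rfl⟩
  obtain ⟨β', hβ'⟩ : ∃ β', star β = β' := ⟨_, rfl⟩
  obtain ⟨w', hw'⟩ : ∃ w', star w = w' := ⟨_, rfl⟩
  have hsw : star w' = w := by rw [← hw', star_star]
  rw [hw'] at hww
  have hsc : star c = a := by rw [← hc, star_star]
  have hsα : star α' = α := by rw [← hα', star_star]
  have hsβ : star β' = β := by rw [← hβ', star_star]
  obtain ⟨hLα', hLbα'⟩ := h.star_const hLα hLbα
  obtain ⟨hLβ', hLbβ'⟩ := h.star_const hLβ hLbβ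
  rw [hα'] at hLα' hLbα'
  rw [hβ'] at hLβ' hLbβ'
  have hbe : b = α' + β' * y + c * w' - 2 * i * a * y ^ 2 + r * y * w' := by
    have := congrArg star hα
    simp only [star_sub, star_mul, star_pow, hα', hb, hβ', hy, hw', hc, hsc, h.star_i, hrs,
      star_ofNat] at this
    linear_combination -this
  obtain ⟨t, ht⟩ : ∃ t, t = X₂ - 2 * i * α' * z - (β + β') * w - 2 * i * c * z * w - r * w ^ 2 :=
    ⟨_, rfl⟩
  have hX2 : X₂ = f + 2 * i * y * X₁ := by rw [hf]; ring
  have hLX2 : L X₂ = 2 * i * b + 2 * i * y * L X₁ := by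
    rw [hX2]; simp [D2, h.L_i, hLy, hLf]
  have hLt : L t = 0 := by
    rw [ht]; simp [pow_two, D2, h.L_i, h.L_z, hLw, hLβ, hLc, hLr, hLα', hLβ', hLX2]
    linear_combination (2 * i) * hbe - 2 * i * y * hβ + (-2 * i * c - 2 * i * r * y) * hww
  have hLbt : Lb t = 0 := by
    rw [ht]; simp [pow_two, D2, h.Lb_i, h.Lb_z, h.Lb_w, hLbβ, hLbc, hLbr, hLbα', hLbβ', h2]
  have hst : star t = t := by
    rw [ht]; simp only [star_sub, star_mul, star_add, star_pow, hsα, hβ', hsβ, hy, hw', hsc,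
      h.star_i, hrs, star_ofNat]
    linear_combination -h3 + 2 * i * y * hα - 2 * i * z * hbe +
      (β + β' - 2 * i * y * a + 2 * i * z * c + r * (w + w')) * hww
  refine ⟨α, β, a, r, t, ⟨hLα, hLbα⟩, ⟨hLβ, hLbβ⟩, ⟨hLa, hLba⟩, ⟨hLr, hLbr⟩, ⟨hLt, hLbt⟩, hrs, hst,
    ?_, ?_⟩
  · rw [hc, hα]; ring
  · rw [hc, hα', hβ', ht]; ring

/-- A quadratic polynomial field with vanishing components has vanishing coefficients. -/
theorem coefficients_eq_zero (h : IsHeisenbergFrame L Lb T i z w) {α β a r t : A}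
    (hα : L α = 0 ∧ Lb α = 0) (hβ : L β = 0 ∧ Lb β = 0) (ha : L a = 0 ∧ Lb a = 0)
    (hr : L r = 0 ∧ Lb r = 0)
    (h1 : α + β * z + a * w + 2 * i * star a * z ^ 2 + r * z * w = 0)
    (h2 : t + 2 * i * star α * z + (β + star β) * w + 2 * i * star a * z * w + r * w ^ 2 = 0) :
    α = 0 ∧ β = 0 ∧ a = 0 ∧ r = 0 ∧ t = 0 := by
  have D2 : ∀ D : Derivation ℂ A A, D 2 = 0 := fun D => by
    simpa using D.map_natCast 2
  have hTα := h.T_eq_zero hα.1 hα.2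
  have hTβ := h.T_eq_zero hβ.1 hβ.2
  have hTa := h.T_eq_zero ha.1 ha.2
  have hTr := h.T_eq_zero hr.1 hr.2
  obtain ⟨hLc, hLbc⟩ := h.star_const ha.1 ha.2
  have hTc := h.T_eq_zero hLc hLbc
  -- `T` leaves `a + r z = 0`, and `L` then isolates `r`. With `r = a = 0` the same step applied to
  -- `α + β z` isolates `β`.
  have e1 := congrArg T h1
  simp only [map_add, Derivation.leibniz, smul_eq_mul, pow_two, h.T_i, h.T_z, h.T_w, hTα, hTβ, hTa,
    hTr, hTc, D2, map_zero] at e1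
  have e2 := congrArg L e1
  simp [h.L_z, hr.1, ha.1] at e2
  have e3 : a = 0 := by simpa [e2] using e1
  have e4 := congrArg L h1
  simp [e2, e3, hα.1, hβ.1, h.L_z] at e4
  have e5 : α = 0 := by simpa [e2, e3, e4] using h1
  refine ⟨e5, e4, e3, e2, by simpa [e2, e3, e4, e5] using h2⟩

/-- CR maps of the Heisenberg sphere that preserve `∂/∂u` are affine. -/
theorem exists_affine (h : IsHeisenbergFrame L Lb T i z w) {F W : A}
    (hF : Lb F = 0) (hW : Lb W = 0) (hTF : T F = 0) (hTW : T W = 1)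
    (hS : W - star W = 2 * i * F * star F) :
    ∃ g c d : A, (L g = 0 ∧ Lb g = 0) ∧ (L c = 0 ∧ Lb c = 0) ∧ (L d = 0 ∧ Lb d = 0) ∧
      g * star g = 1 ∧ F = g * z + c ∧ W = w + 2 * i * g * star c * z + d := by
  have D2 : ∀ D : Derivation ℂ A A, D 2 = 0 := fun D => by
    simpa using D.map_natCast 2
  have hi := h.i_sq
  -- `g` is the differential of the map on `H`. The commutation relation on `F`, with `T F = 0`,
  -- shows `Lb g = 0`.
  obtain ⟨g, hg⟩ : ∃ g, g = L F := ⟨_, rfl⟩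
  have hLF' : L (star F) = 0 := by rw [h.L_star, hF, star_zero]
  have hLW' : L (star W) = 0 := by rw [h.L_star, hW, star_zero]
  have hLbF' : Lb (star F) = star g := by rw [h.Lb_star, hg]
  have hLbg : Lb g = 0 := by
    have := h.comm F
    rw [hF, hTF, map_zero, ← hg] at this
    linear_combination -this
  have hLg' : L (star g) = 0 := by rw [h.L_star, hLbg, star_zero]
  have hLW : L W = 2 * i * g * star F := by
    have := congrArg L hS
    simp [D2, h.L_i, hLF', hLW', ← hg] at this
    linear_combination this
  -- The commutation relation on `W`, where `T W = 1`, compares the two Levi forms.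
  have hgg : g * star g = 1 := by
    have := h.comm W
    rw [hLW, hW, hTW] at this
    simp [D2, h.Lb_i, hLbg, hLbF'] at this
    refine sub_eq_zero.1 (eq_zero_of_natCast_mul (n := 2) two_ne_zero ?_)
    push_cast
    linear_combination -i * this + 2 * (g * star g - 1) * hi
  -- As `L` kills `star g`, differentiating `g * star g = 1` leaves `L g * star g = 0`, and `star g`
  -- is invertible.
  have hLg : L g = 0 := by
    have := congrArg L hgg
    simp [hLg'] at this
    linear_combination g * this - L g * hgg
  obtain ⟨hLs, hLbs⟩ := h.star_const hLg hLbg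
  have hc : L (F - g * z) = 0 ∧ Lb (F - g * z) = 0 := by
    simp [hF, hLg, hLbg, h.L_z, h.Lb_z, ← hg]
  obtain ⟨hLc', hLbc'⟩ := h.star_const hc.1 hc.2
  refine ⟨g, F - g * z, W - w - 2 * i * g * star (F - g * z) * z, ⟨hLg, hLbg⟩, hc, ⟨?_, ?_⟩, hgg,
    by ring, by ring⟩
  · simp only [map_sub, Derivation.leibniz, smul_eq_mul, hLc', D2, h.L_i, hLg, h.L_w, h.L_z, hLW]
    simp only [star_sub, star_mul]
    linear_combination 2 * i * star z * hgg
  · simp only [map_sub, Derivation.leibniz, smul_eq_mul, hLbc', D2, h.Lb_i, hLbg, h.Lb_w, h.Lb_z,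
      hW]
    ring

end IsHeisenbergFrame

/-- The frame of the quadric `|z|² + ε |w|² = 1`. -/
structure IsQuadricFrame (L Lb T : Derivation ℂ A A) (i ε z w : A) : Prop
    extends IsCRFrame L Lb T i where
  ε_sq : ε * ε = 1
  star_ε : star ε = ε
  L_ε : L ε = 0
  comm : ∀ F, L (Lb F) - Lb (L F) = -i * ε * T F
  L_z : L z = star w
  Lb_z : Lb z = 0
  L_w : L w = -ε * star z
  Lb_w : Lb w = 0
  quadric : z * star z + ε * w * star w = 1

namespace IsQuadricFrame

variable {L Lb T : Derivation ℂ A A} {i ε z w : A}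

theorem T_eq_zero (h : IsQuadricFrame L Lb T i ε z w) {F : A} (h1 : L F = 0) (h2 : Lb F = 0) :
    T F = 0 := by
  have := h.comm F
  rw [h1, h2, map_zero, map_zero, sub_zero] at this
  linear_combination -i * ε * this + T F * h.i_sq + i * i * T F * h.ε_sq

/-- CR maps of the quadric that commute with the flow `p ↦ e^{it} p` are linear. -/
theorem exists_linear (h : IsQuadricFrame L Lb T i ε z w) {F₁ F₂ : A}
    (h1 : Lb F₁ = 0) (h2 : Lb F₂ = 0) (hT1 : T F₁ = i * F₁) (hT2 : T F₂ = i * F₂)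
    (hS : F₁ * star F₁ + ε * F₂ * star F₂ = 1) :
    ∃ a b c d : A, (L a = 0 ∧ Lb a = 0) ∧ (L b = 0 ∧ Lb b = 0) ∧ (L c = 0 ∧ Lb c = 0) ∧
      (L d = 0 ∧ Lb d = 0) ∧ F₁ = a * z + b * w ∧ F₂ = c * z + d * w ∧
      star a * a + ε * star c * c = 1 ∧ star a * b + ε * star c * d = 0 ∧
      star b * b + ε * star d * d = ε := by
  have hi := h.i_sq
  have hε := h.ε_sq
  have hLε := h.L_ε
  have hLbε : Lb ε = 0 := by rw [← h.star_ε, h.Lb_star, hLε, star_zero]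
  have hq := h.quadric
  have hLzs : L (star z) = 0 := by rw [h.L_star, h.Lb_z, star_zero]
  have hLws : L (star w) = 0 := by rw [h.L_star, h.Lb_w, star_zero]
  have hLbzs : Lb (star z) = w := by rw [h.Lb_star, h.L_z, star_star]
  have hLbws : Lb (star w) = -ε * z := by
    rw [h.Lb_star, h.L_w, star_mul, star_star, star_neg, h.star_ε]; ring
  have hLz := h.L_z
  have hLw := h.L_w
  obtain ⟨y, hy⟩ : ∃ y, star z = y := ⟨_, rfl⟩
  obtain ⟨v, hv⟩ : ∃ v, star w = v := ⟨_, rfl⟩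
  obtain ⟨f₁, hf₁⟩ : ∃ f, star F₁ = f := ⟨_, rfl⟩
  obtain ⟨f₂, hf₂⟩ : ∃ f, star F₂ = f := ⟨_, rfl⟩
  obtain ⟨G₁, hG₁⟩ : ∃ G, G = L F₁ := ⟨_, rfl⟩
  obtain ⟨G₂, hG₂⟩ : ∃ G, G = L F₂ := ⟨_, rfl⟩
  obtain ⟨g₁, hg₁⟩ : ∃ f, star G₁ = f := ⟨_, rfl⟩
  obtain ⟨g₂, hg₂⟩ : ∃ f, star G₂ = f := ⟨_, rfl⟩
  have hsy : star y = z := by rw [← hy, star_star]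
  have hsv : star v = w := by rw [← hv, star_star]
  rw [hy] at hLzs hLbzs hLw hq
  rw [hv] at hLws hLbws hLz hq
  rw [hf₁, hf₂] at hS
  have hLf₁ : L f₁ = 0 := by rw [← hf₁, h.L_star, h1, star_zero]
  have hLf₂ : L f₂ = 0 := by rw [← hf₂, h.L_star, h2, star_zero]
  have hLbf₁ : Lb f₁ = g₁ := by rw [← hf₁, h.Lb_star, ← hG₁, hg₁]
  have hLbf₂ : Lb f₂ = g₂ := by rw [← hf₂, h.Lb_star, ← hG₂, hg₂]
  -- Here `T F = iF` enters: the commutator on `F` is `-iε · iF = εF`, so `Lb` brings the derivative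
  -- back to `F`.
  have hLbG₁ : Lb G₁ = -ε * F₁ := by
    have := h.comm F₁
    rw [h1, hT1, map_zero, ← hG₁] at this
    linear_combination -this + ε * F₁ * hi
  have hLbG₂ : Lb G₂ = -ε * F₂ := by
    have := h.comm F₂
    rw [h2, hT2, map_zero, ← hG₂] at this
    linear_combination -this + ε * F₂ * hi
  have hLg₁ : L g₁ = -ε * f₁ := by
    rw [← hg₁, h.L_star, hLbG₁]; simp [h.star_ε, hf₁, mul_comm]
  have hLg₂ : L g₂ = -ε * f₂ := by
    rw [← hg₂, h.L_star, hLbG₂]; simp [h.star_ε, hf₂, mul_comm]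
  -- Differentiating `⟨F, F⟩ = 1`, for the Hermitian form `diag(1, ε)`, shows that `F` and `G = L F`
  -- are orthogonal with `⟨G, G⟩ = ε`, and that `L G` is orthogonal to both of them.
  have o1 : G₁ * f₁ + ε * G₂ * f₂ = 0 := by
    have := congrArg L hS
    simp [hLf₁, hLf₂, ← hG₁, ← hG₂, hLε] at this
    linear_combination this
  have o1' : g₁ * F₁ + ε * g₂ * F₂ = 0 := by
    have := congrArg Lb hS
    simp [h1, h2, hLbf₁, hLbf₂, hLbε] at this
    linear_combination this
  have o2 : G₁ * g₁ + ε * G₂ * g₂ = ε := by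
    have := congrArg Lb o1
    simp [hLbf₁, hLbf₂, hLbG₁, hLbG₂, hLbε] at this
    linear_combination this + ε * hS
  have o3 : L G₁ * g₁ + ε * L G₂ * g₂ = 0 := by
    have := congrArg L o2
    simp [hLg₁, hLg₂, hLε] at this
    linear_combination this + ε * o1
  have o4 : L G₁ * f₁ + ε * L G₂ * f₂ = 0 := by
    have := congrArg L o1
    simp [hLf₁, hLf₂, hLε] at this
    linear_combination this
  -- The Gram determinant of `F, G` is `ε` times this product, and it equals `ε`. So `F, G` is a
  -- frame, and `L G`, being orthogonal to it, vanishes by Cramer's rule.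
  have hdet : (F₁ * G₂ - F₂ * G₁) * (f₁ * g₂ - f₂ * g₁) = 1 := by
    have : ε * ((F₁ * G₂ - F₂ * G₁) * (f₁ * g₂ - f₂ * g₁)) = ε := by
      linear_combination (G₁ * g₁ + ε * G₂ * g₂) * hS + o2 - o1 * (g₁ * F₁ + ε * g₂ * F₂)
    linear_combination ε * this + (1 - (F₁ * G₂ - F₂ * G₁) * (f₁ * g₂ - f₂ * g₁)) * hε
  have hLG₁ : L G₁ = 0 := by
    have : L G₁ * (f₁ * g₂ - f₂ * g₁) = 0 := by linear_combination g₂ * o4 - f₂ * o3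
    linear_combination (F₁ * G₂ - F₂ * G₁) * this - L G₁ * hdet
  have hLG₂ : L G₂ = 0 := by
    have : L G₂ * (f₁ * g₂ - f₂ * g₁) = 0 := by
      linear_combination ε * (f₁ * o3 - g₁ * o4) - L G₂ * (f₁ * g₂ - f₂ * g₁) * hε
    linear_combination (F₁ * G₂ - F₂ * G₁) * this - L G₂ * hdet
  have ha : star (y * F₁ + ε * w * G₁) = z * f₁ + ε * v * g₁ := by
    simp only [star_add, star_mul, hsy, hv, hf₁, hg₁, h.star_ε]; ring
  have hc : star (y * F₂ + ε * w * G₂) = z * f₂ + ε * v * g₂ := by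
    simp only [star_add, star_mul, hsy, hv, hf₂, hg₂, h.star_ε]; ring
  have hb : star (ε * (v * F₁ - z * G₁)) = ε * (w * f₁ - y * g₁) := by
    simp only [star_sub, star_mul, hsv, hy, hf₁, hg₁, h.star_ε]; ring
  have hd : star (ε * (v * F₂ - z * G₂)) = ε * (w * f₂ - y * g₂) := by
    simp only [star_sub, star_mul, hsv, hy, hf₂, hg₂, h.star_ε]; ring
  -- The coefficients solve `F = a z + b w` together with its image under `L`, which is `G = a w̄ -
  -- ε b z̄`, and likewise for the second component. The determinant of this system is a unit by the
  -- equation of the quadric.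
  refine ⟨y * F₁ + ε * w * G₁, ε * (v * F₁ - z * G₁), y * F₂ + ε * w * G₂,
    ε * (v * F₂ - z * G₂), ⟨?_, ?_⟩, ⟨?_, ?_⟩, ⟨?_, ?_⟩, ⟨?_, ?_⟩, ?_, ?_, ?_, ?_, ?_⟩
  · simp [hLzs, hLw, hLε, hLG₁, ← hG₁]; linear_combination -y * G₁ * hε
  · simp [hLbzs, h.Lb_w, hLbε, hLbG₁, h1]; linear_combination -w * F₁ * hε
  · simp [hLws, hLz, hLε, hLG₁, ← hG₁]; ring
  · simp [hLbws, h.Lb_z, hLbε, hLbG₁, h1]; ring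
  · simp [hLzs, hLw, hLε, hLG₂, ← hG₂]; linear_combination -y * G₂ * hε
  · simp [hLbzs, h.Lb_w, hLbε, hLbG₂, h2]; linear_combination -w * F₂ * hε
  · simp [hLws, hLz, hLε, hLG₂, ← hG₂]; ring
  · simp [hLbws, h.Lb_z, hLbε, hLbG₂, h2]; ring
  · linear_combination -F₁ * hq
  · linear_combination -F₂ * hq
  · rw [ha, hc]
    linear_combination z * y * hS + w * v * ε * ε * o2 + z * w * ε * o1 + v * y * ε * o1' +
      ε * w * v * hε + hq
  · rw [ha, hc]
    linear_combination ε * z * v * hS - ε * z * z * o1 + ε * ε * v * v * o1' - ε * ε * z * v * o2 -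
      ε * z * v * hε
  · rw [hb, hd]
    linear_combination ε * ε * (w * v * hS - z * w * o1 - v * y * o1' + z * y * o2) +
      ε * hq + (w * v + z * y * ε - w * v) * hε

end IsQuadricFrame

end Algebra

end

/-! ### The Heisenberg sphere: tangent spaces and structure equations. -/

noncomputable section

variable {M O U : Set C2} {π : C2 → C2} {V E : C2 → C2}

open smoothFunctions

theorem SmoothRetract.isCRFrame (h : SmoothRetract M O π) (hE : IsCplxTangentField M E)
    (hV : IsTangentField M V) : IsCRFrame (h.del hE) (h.delbar hE) (h.derivation hV)
      (algebraMap ℂ (smoothFunctions M) Complex.I) where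
  i_sq := by rw [← map_mul, Complex.I_mul_I, map_neg, map_one]
  star_i := by rw [← algebraMap_star_comm, ← map_neg]; simp
  L_i := Derivation.map_algebraMap _ _
  Lb_i := Derivation.map_algebraMap _ _
  T_i := Derivation.map_algebraMap _ _
  L_star := h.del_star hE
  Lb_star := h.delbar_star hE
  T_star := h.derivation_star hV

/-- A map of `ℂ²` viewed as a pair of smooth functions. -/
theorem SmoothRetract.derivation_component_eq (h : SmoothRetract M O π) (hV : IsTangentField M V)
    {f : C2 → C2} (hf : ContDiffOn ℝ ∞ f M) {G₁ G₂ : smoothFunctions M}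
    (hG : ∀ p : M, fderivWithin ℝ f M p (V p) = (G₁.1 p, G₂.1 p)) :
    h.derivation hV (restrict (fun q => (f q).1) hf.fst) = G₁ ∧
      h.derivation hV (restrict (fun q => (f q).2) hf.snd) = G₂ := by
  simp only [← h.derivation_component hV hf, Prod.ext_iff] at hG
  exact ⟨smoothFunctions.ext fun p => (hG p).1, smoothFunctions.ext fun p => (hG p).2⟩

section Heisenberg

/-- The projection of `ℂ²` to the Heisenberg sphere along the `v`-axis. -/
def heisenbergProj (p : C2) : C2 := (p.1, (p.2.re : ℂ) + Complex.I * ((‖p.1‖ ^ 2 : ℝ) : ℂ))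

theorem heisenbergProj_contDiff : ContDiff ℝ ∞ heisenbergProj := by
  refine contDiff_fst.prodMk ((Complex.ofRealCLM.contDiff.comp
    (Complex.reCLM.contDiff.comp contDiff_snd)).add (contDiff_const.mul
      (Complex.ofRealCLM.contDiff.comp (contDiff_fst.norm_sq ℝ))))

theorem heisenbergSphere_retract :
    SmoothRetract heisenbergSphere Set.univ heisenbergProj where
  isOpen := isOpen_univ
  subset := Set.subset_univ _
  smooth := heisenbergProj_contDiff.contDiffOn
  mapsTo := fun p _ => by simp [heisenbergSphere, heisenbergProj, -Complex.ofReal_pow]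
  fix := fun p hp => by
    have : p.2.im = ‖p.1‖ ^ 2 := hp
    refine Prod.ext rfl ?_
    rw [heisenbergProj, ← this]
    apply Complex.ext <;> simp

theorem fderiv_heisenbergProj (p v : C2) : fderiv ℝ heisenbergProj p v =
    (v.1, (v.2.re : ℂ) + Complex.I * ((2 * (conj p.1 * v.1).re : ℝ) : ℂ)) := by
  have h1 : HasFDerivAt (fun q : C2 => q.1) (ContinuousLinearMap.fst ℝ ℂ ℂ) p := hasFDerivAt_fst
  have h2 : HasFDerivAt (fun q : C2 => q.2) (ContinuousLinearMap.snd ℝ ℂ ℂ) p := hasFDerivAt_snd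
  have h3 := h1.prodMk (((Complex.ofRealCLM.hasFDerivAt.comp p
    (Complex.reCLM.hasFDerivAt.comp p h2))).add
      ((Complex.ofRealCLM.hasFDerivAt.comp p h1.norm_sq).const_mul Complex.I))
  have h4 : HasFDerivAt heisenbergProj _ p := h3
  rw [h4.fderiv]
  simp [Complex.inner]
  ring

theorem mem_realTangent_heisenbergSphere {p v : C2} (hp : p ∈ heisenbergSphere) :
    v ∈ realTangent heisenbergSphere p ↔ v.2.im = 2 * (conj p.1 * v.1).re := by
  rw [heisenbergSphere_retract.mem_realTangent_iff hp, fderiv_heisenbergProj]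
  generalize 2 * (conj p.1 * v.1).re = x
  rw [Prod.ext_iff, Complex.ext_iff (w := v.2)]
  simp [eq_comm]

theorem mem_cplxTangent_heisenbergSphere {p v : C2} (hp : p ∈ heisenbergSphere) :
    v ∈ cplxTangent heisenbergSphere p ↔ v.2 = 2 * Complex.I * conj p.1 * v.1 := by
  rw [cplxTangent, Set.mem_ofPred_eq, mem_realTangent_heisenbergSphere hp,
    mem_realTangent_heisenbergSphere hp, Complex.ext_iff]
  simp
  constructor
  · rintro ⟨h1, h2⟩; constructor <;> linarith
  · rintro ⟨h1, h2⟩; constructor <;> linarith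

/-- A frame of the complex tangent bundle of the Heisenberg sphere. -/
def heisenbergFrame (p : C2) : C2 := (1, 2 * Complex.I * conj p.1)

theorem heisenbergFrame_hasFDerivAt (p : C2) : HasFDerivAt heisenbergFrame
    ((0 : C2 →L[ℝ] ℂ).prod ((2 * Complex.I) • (Complex.conjCLE.toContinuousLinearMap.comp
      (ContinuousLinearMap.fst ℝ ℂ ℂ)))) p :=
  (hasFDerivAt_const (1 : ℂ) p).prodMk
    (((Complex.conjCLE.toContinuousLinearMap.comp
      (ContinuousLinearMap.fst ℝ ℂ ℂ)).hasFDerivAt).const_mul _)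

theorem heisenbergFrame_mem :
    IsCplxTangentField heisenbergSphere heisenbergFrame :=
  ⟨(contDiff_const.prodMk (contDiff_const.mul
      (Complex.conjCLE.contDiff.comp contDiff_fst))).contDiffOn,
    fun p hp => by rw [mem_cplxTangent_heisenbergSphere hp]; simp [heisenbergFrame]⟩

theorem rigidField_mem : IsTangentField heisenbergSphere rigidField :=
  ⟨contDiff_const.contDiffOn,
    fun p hp => by rw [mem_realTangent_heisenbergSphere hp]; simp [rigidField]⟩

theorem rigidField_hasFDerivAt (p : C2) : HasFDerivAt rigidField (0 : C2 →L[ℝ] C2) p :=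
  hasFDerivAt_const _ _

theorem heisenberg_isHeisenbergFrame (hU : IsOpen U) :
    IsHeisenbergFrame
      ((heisenbergSphere_retract.inter hU).del (heisenbergFrame_mem.inter hU))
      ((heisenbergSphere_retract.inter hU).delbar (heisenbergFrame_mem.inter hU))
      ((heisenbergSphere_retract.inter hU).derivation (rigidField_mem.inter hU))
      (algebraMap ℂ _ Complex.I) (z _) (w _) := by
  have h := heisenbergSphere_retract.inter hU
  have hE := heisenbergFrame_mem.inter hU
  have hT := rigidField_mem.inter hU
  refine { h.isCRFrame hE hT with
    comm := ?_, comm_T := ?_, L_z := ?_, Lb_z := h.delbar_z hE, T_z := ?_, L_w := ?_,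
    Lb_w := h.delbar_w hE, T_w := ?_, w_sub := ?_ }
  · intro F
    -- For `E = (1, 2i z̄)` one has `[E, iE] = -4 ∂/∂u`, and the factor `i/2` turns `-4` into `-2i`.
    rw [h.del_delbar_sub hE hT (c := -4), Algebra.smul_def]
    · congr 1
      rw [show Complex.I / 2 * ((-4 : ℝ) : ℂ) = -2 * Complex.I by push_cast; ring, map_mul, map_neg,
        map_ofNat]
    · intro p hp
      rw [hE.tangent.lieBracketWithin_eq hE.tangent_I hp (heisenbergFrame_hasFDerivAt p)
        ((heisenbergFrame_hasFDerivAt p).const_smul Complex.I)]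
      simp [heisenbergFrame, rigidField]
      linear_combination 4 * Complex.I_sq
  · intro F
    -- The frame does not depend on `w`, so `∂/∂u` commutes with `E` and `iE`. With the factor `0`
    -- the field on the right is arbitrary.
    have e1 := h.smul_commutator_derivation (c := 0) hT hE.tangent hT (fun p hp => by
      rw [hT.lieBracketWithin_eq hE.tangent hp (rigidField_hasFDerivAt p)
        (heisenbergFrame_hasFDerivAt p)]
      simp [rigidField]) F
    have e2 := h.smul_commutator_derivation (c := 0) hT hE.tangent_I hT (fun p hp => by
      rw [hT.lieBracketWithin_eq hE.tangent_I hp (rigidField_hasFDerivAt p)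
        ((heisenbergFrame_hasFDerivAt p).const_smul Complex.I)]
      simp [rigidField]) F
    rw [Complex.ofReal_zero, zero_smul, sub_eq_zero] at e1 e2
    rw [h.del_apply, h.del_apply, Derivation.map_smul, Derivation.map_sub, Derivation.map_smul,
      e1, e2]
  · exact smoothFunctions.ext fun p => by rw [h.del_z]; rfl
  · exact smoothFunctions.ext fun p => by rw [h.derivation_z]; rfl
  · exact smoothFunctions.ext fun p => by rw [h.del_w]; rfl
  · exact smoothFunctions.ext fun p => by rw [h.derivation_w]; rfl
  · refine smoothFunctions.ext fun p => ?_
    have hp : p.1.2.im = ‖p.1.1‖ ^ 2 := p.2.1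
    change p.1.2 - conj p.1.2 = 2 * Complex.I * p.1.1 * conj p.1.1
    rw [Complex.sub_conj, mul_assoc, Complex.mul_conj, hp, Complex.normSq_eq_norm_sq]
    push_cast; ring

theorem heisenberg_span {p v : C2} (hp : p ∈ heisenbergSphere)
    (hv : v ∈ realTangent heisenbergSphere p) : ∃ a b c : ℝ, v = a • heisenbergFrame p +
      b • Complex.I • heisenbergFrame p + c • rigidField p := by
  rw [mem_realTangent_heisenbergSphere hp] at hv
  refine ⟨v.1.re, v.1.im, v.2.re - (2 * Complex.I * conj p.1 * v.1).re, ?_⟩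
  simp at hv
  refine Prod.ext (Complex.ext ?_ ?_) (Complex.ext ?_ ?_) <;>
    simp [heisenbergFrame, rigidField] <;> linarith

theorem heisenberg_isLocallyConstant (hU : IsOpen U) {F : smoothFunctions (heisenbergSphere ∩ U)}
    (h1 : (heisenbergSphere_retract.inter hU).del (heisenbergFrame_mem.inter hU) F = 0)
    (h2 : (heisenbergSphere_retract.inter hU).delbar (heisenbergFrame_mem.inter hU) F = 0) :
    IsLocallyConstant F.1 := by
  refine (heisenbergSphere_retract.inter hU).isLocallyConstant_of_del_eq_zero _
    (rigidField_mem.inter hU) (fun p hp v hv => ?_) h1 h2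
    ((heisenberg_isHeisenbergFrame hU).T_eq_zero h1 h2)
  rw [realTangent_inter hU hp.2] at hv
  exact heisenberg_span hp.1 hv

end Heisenberg

end

/-! ### The quadrics `|z|² + ε|w|² = 1`: tangent spaces and structure equations. -/

noncomputable section

variable {M O U : Set C2} {π : C2 → C2} {V E : C2 → C2}

open smoothFunctions

section Quadric

/-- The quadric `|z|² + ε |w|² = 1`. -/
def quadric (ε : ℝ) : Set C2 := {p | ‖p.1‖ ^ 2 + ε * ‖p.2‖ ^ 2 = 1}

theorem quadric_one : quadric 1 = roundSphere := by simp [quadric, roundSphere]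

theorem quadric_neg_one : quadric (-1) = hyperboloid := by
  simp [quadric, hyperboloid, sub_eq_add_neg]

/-- The Hermitian form `|z|² + ε |w|²`. -/
def quadricForm (ε : ℝ) (p : C2) : ℝ := ‖p.1‖ ^ 2 + ε * ‖p.2‖ ^ 2

theorem quadricForm_contDiff (ε : ℝ) : ContDiff ℝ ∞ (quadricForm ε) :=
  (contDiff_fst.norm_sq ℝ).add (contDiff_const.mul (contDiff_snd.norm_sq ℝ))

theorem exists_hasFDerivAt_quadricForm (ε : ℝ) (p : C2) :
    ∃ N : C2 →L[ℝ] ℝ, HasFDerivAt (quadricForm ε) N p ∧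
      ∀ v : C2, N v = 2 * (conj p.1 * v.1 + ε * (conj p.2 * v.2)).re := by
  have h1 : HasFDerivAt (fun q : C2 => q.1) (ContinuousLinearMap.fst ℝ ℂ ℂ) p := hasFDerivAt_fst
  have h2 : HasFDerivAt (fun q : C2 => q.2) (ContinuousLinearMap.snd ℝ ℂ ℂ) p := hasFDerivAt_snd
  refine ⟨_, h1.norm_sq.add (h2.norm_sq.const_mul ε), fun v => ?_⟩
  simp [Complex.inner]
  ring

/-- The radial projection to the quadric. -/
def quadricProj (ε : ℝ) (p : C2) : C2 := (√(quadricForm ε p))⁻¹ • p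

theorem quadric_retract (ε : ℝ) :
    SmoothRetract (quadric ε) {p | 0 < quadricForm ε p} (quadricProj ε) where
  isOpen := isOpen_lt continuous_const (quadricForm_contDiff ε).continuous
  subset := fun p hp => by
    have : quadricForm ε p = 1 := hp
    simp [this]
  smooth := by
    refine ContDiffOn.smul (ContDiffOn.inv (ContDiffOn.sqrt (quadricForm_contDiff ε).contDiffOn
      fun p hp => ne_of_gt hp) fun p hp => ?_) contDiffOn_id
    exact (Real.sqrt_pos.2 hp).ne'
  mapsTo := fun p hp => by
    have hp : 0 < quadricForm ε p := hp
    have : quadricForm ε p = ‖p.1‖ ^ 2 + ε * ‖p.2‖ ^ 2 := rfl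
    simp only [quadric, quadricProj, Set.mem_ofPred_eq, Prod.smul_fst, Prod.smul_snd, norm_smul,
      mul_pow, norm_inv, Real.norm_eq_abs, sq_abs, inv_pow, Real.sq_sqrt hp.le]
    field_simp
    linarith
  fix := fun p hp => by
    have : quadricForm ε p = 1 := hp
    simp [quadricProj, this]

theorem mem_realTangent_quadric {ε : ℝ} {p v : C2} (hp : p ∈ quadric ε) :
    v ∈ realTangent (quadric ε) p ↔ (conj p.1 * v.1 + ε * (conj p.2 * v.2)).re = 0 := by
  obtain ⟨N, hN, hNv⟩ := exists_hasFDerivAt_quadricForm ε p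
  have h1 : quadricForm ε p = 1 := hp
  constructor
  · intro hv
    have e1 := hN.hasFDerivWithinAt.fderivWithin_apply_of_mem_realTangent hv
    have e2 := ((hasFDerivWithinAt_const (1 : ℝ) p (quadric ε)).congr
      (f₁ := quadricForm ε) (fun q hq => hq) h1).fderivWithin_apply_of_mem_realTangent hv
    rw [e2, hNv] at e1
    simp only [zero_apply] at e1
    linarith
  · intro hv
    rw [(quadric_retract ε).mem_realTangent_iff hp]
    -- On the quadric the derivative of the radial projection sends `v` to `v` plus a multiple of `N
    -- v` times `p`. It therefore fixes the kernel of `N`.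
    have e1 : DifferentiableAt ℝ (fun x : ℝ => (√x)⁻¹) (quadricForm ε p) := by
      rw [h1]
      exact (Real.hasDerivAt_sqrt one_ne_zero).differentiableAt.inv (by simp)
    have e2 := (e1.hasDerivAt.comp_hasFDerivAt p hN).smul (hasFDerivAt_id p)
    have e3 : HasFDerivAt (quadricProj ε) _ p := e2
    rw [e3.fderiv]
    simp [h1, hNv, hv]

theorem mem_cplxTangent_quadric {ε : ℝ} {p v : C2} (hp : p ∈ quadric ε) :
    v ∈ cplxTangent (quadric ε) p ↔ conj p.1 * v.1 + ε * (conj p.2 * v.2) = 0 := by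
  rw [cplxTangent, Set.mem_ofPred_eq, mem_realTangent_quadric hp, mem_realTangent_quadric hp]
  have : conj p.1 * (Complex.I • v).1 + ε * (conj p.2 * (Complex.I • v).2) =
    Complex.I * (conj p.1 * v.1 + ε * (conj p.2 * v.2)) := by simp; ring
  rw [this, Complex.I_mul_re, neg_eq_zero, Complex.ext_iff]
  rfl

/-- A frame of the complex tangent bundle of the quadric. -/
def quadricFrame (ε : ℝ) (p : C2) : C2 := (conj p.2, -ε * conj p.1)

theorem quadricFrame_hasFDerivAt (ε : ℝ) (p : C2) : HasFDerivAt (quadricFrame ε)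
    ((Complex.conjCLE.toContinuousLinearMap.comp (ContinuousLinearMap.snd ℝ ℂ ℂ)).prod
      ((-ε : ℂ) • (Complex.conjCLE.toContinuousLinearMap.comp
        (ContinuousLinearMap.fst ℝ ℂ ℂ)))) p :=
  ((Complex.conjCLE.toContinuousLinearMap.comp
      (ContinuousLinearMap.snd ℝ ℂ ℂ)).hasFDerivAt).prodMk
    (((Complex.conjCLE.toContinuousLinearMap.comp
      (ContinuousLinearMap.fst ℝ ℂ ℂ)).hasFDerivAt).const_mul _)

theorem quadricFrame_mem {ε : ℝ} (hε : ε * ε = 1) :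
    IsCplxTangentField (quadric ε) (quadricFrame ε) :=
  ⟨((Complex.conjCLE.contDiff.comp contDiff_snd).prodMk (contDiff_const.mul
      (Complex.conjCLE.contDiff.comp contDiff_fst))).contDiffOn,
    fun p hp => by
      rw [mem_cplxTangent_quadric hp]
      have hε' : (ε : ℂ) * ε = 1 := by exact_mod_cast hε
      simp only [quadricFrame]; linear_combination -conj p.1 * conj p.2 * hε'⟩

theorem standardField_mem (ε : ℝ) : IsTangentField (quadric ε) standardField :=
  ⟨(contDiff_const_smul Complex.I).contDiffOn,
    fun p hp => by
      rw [mem_realTangent_quadric hp]; simp [standardField]; ring⟩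

theorem quadric_isQuadricFrame {ε : ℝ} (hε : ε * ε = 1) (hU : IsOpen U) :
    IsQuadricFrame
      (((quadric_retract ε).inter hU).del ((quadricFrame_mem hε).inter hU))
      (((quadric_retract ε).inter hU).delbar ((quadricFrame_mem hε).inter hU))
      (((quadric_retract ε).inter hU).derivation ((standardField_mem ε).inter hU))
      (algebraMap ℂ _ Complex.I) (algebraMap ℂ _ ε) (z _) (w _) := by
  have h := (quadric_retract ε).inter hU
  have hE := (quadricFrame_mem hε).inter hU
  have hT := (standardField_mem ε).inter hU
  refine { h.isCRFrame hE hT with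
    ε_sq := ?_, star_ε := ?_, L_ε := Derivation.map_algebraMap _ _, comm := ?_, L_z := ?_,
    Lb_z := h.delbar_z hE, L_w := ?_, Lb_w := h.delbar_w hE, quadric := ?_ }
  · rw [← map_mul, ← Complex.ofReal_mul, hε, Complex.ofReal_one, map_one]
  · rw [← algebraMap_star_comm]; simp
  · intro F
    -- The frame is antilinear in the point, and applying it twice gives `-ε p`; this yields `[E,
    -- iE] = -2ε · ip`.
    rw [h.del_delbar_sub hE hT (c := -2 * ε), Algebra.smul_def]
    · congr 1
      rw [← map_neg, ← map_mul]
      congr 1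
      push_cast; ring
    · intro p hp
      rw [hE.tangent.lieBracketWithin_eq hE.tangent_I hp (quadricFrame_hasFDerivAt ε p)
        ((quadricFrame_hasFDerivAt ε p).const_smul Complex.I)]
      refine Prod.ext ?_ ?_ <;> simp [quadricFrame, standardField] <;> ring
  · exact smoothFunctions.ext fun p => by rw [h.del_z]; rfl
  · refine smoothFunctions.ext fun p => ?_
    rw [h.del_w]
    rfl
  · refine smoothFunctions.ext fun p => ?_
    have hp : ‖p.1.1‖ ^ 2 + ε * ‖p.1.2‖ ^ 2 = 1 := p.2.1
    change p.1.1 * conj p.1.1 + ε * p.1.2 * conj p.1.2 = 1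
    rw [mul_assoc, Complex.mul_conj, Complex.mul_conj, Complex.normSq_eq_norm_sq,
      Complex.normSq_eq_norm_sq]
    exact_mod_cast hp

theorem quadric_span {ε : ℝ} (hε : ε * ε = 1) {p v : C2} (hp : p ∈ quadric ε)
    (hv : v ∈ realTangent (quadric ε) p) : ∃ a b c : ℝ, v = a • quadricFrame ε p +
      b • Complex.I • quadricFrame ε p + c • standardField p := by
  rw [mem_realTangent_quadric hp] at hv
  have hp : ‖p.1‖ ^ 2 + ε * ‖p.2‖ ^ 2 = 1 := hp
  rw [← Complex.normSq_eq_norm_sq, ← Complex.normSq_eq_norm_sq] at hp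
  -- If `v = λE + c · ip`, the determinant of `p` and `v` isolates `λ` up to the factor `ε`, and the
  -- Hermitian product with `p` isolates `c`.
  obtain ⟨s, hs⟩ : ∃ s, s = p.2 * v.1 - p.1 * v.2 := ⟨_, rfl⟩
  obtain ⟨c, hc⟩ : ∃ c, c = (conj p.1 * v.1 + ε * (conj p.2 * v.2)).im := ⟨_, rfl⟩
  have hp' : conj p.1 * p.1 + ε * (conj p.2 * p.2) = 1 := by
    rw [mul_comm, Complex.mul_conj, mul_comm (conj _), Complex.mul_conj]; exact_mod_cast hp
  have hc' : conj p.1 * v.1 + ε * (conj p.2 * v.2) = c * Complex.I := by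
    apply Complex.ext
    · rw [hv]; simp
    · rw [← hc]; simp
  have hε' : (ε : ℂ) * ε = 1 := by exact_mod_cast hε
  refine ⟨(ε * s).re, (ε * s).im, c, ?_⟩
  rw [show ∀ (a b : ℝ) (x : C2), a • x + b • Complex.I • x = ((a : ℂ) + b * Complex.I) • x by
    intro a b x; rw [add_smul, mul_smul]; rfl, Complex.re_add_im]
  refine Prod.ext ?_ ?_ <;> simp only [quadricFrame, standardField, Prod.fst_add, Prod.smul_fst,
    Prod.snd_add, Prod.smul_snd, smul_eq_mul, Complex.real_smul, hs]
  · linear_combination -v.1 * hp' + p.1 * hc'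
  · linear_combination -v.2 * hp' + p.2 * hc' +
      conj p.1 * (p.2 * v.1 - p.1 * v.2) * hε'

theorem quadric_isLocallyConstant {ε : ℝ} (hε : ε * ε = 1) (hU : IsOpen U)
    {F : smoothFunctions (quadric ε ∩ U)}
    (h1 : ((quadric_retract ε).inter hU).del ((quadricFrame_mem hε).inter hU) F = 0)
    (h2 : ((quadric_retract ε).inter hU).delbar ((quadricFrame_mem hε).inter hU) F = 0) :
    IsLocallyConstant F.1 := by
  refine ((quadric_retract ε).inter hU).isLocallyConstant_of_del_eq_zero _
    ((standardField_mem ε).inter hU) (fun p hp v hv => ?_) h1 h2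
    ((quadric_isQuadricFrame hε hU).T_eq_zero h1 h2)
  rw [realTangent_inter hU hp.2] at hv
  exact quadric_span hε hp.1 hv

end Quadric

end

/-! ### Rigidity of Sasakian isomorphisms. -/

noncomputable section

variable {M O U V : Set C2} {π : C2 → C2}

open smoothFunctions

theorem IsLocallyConstant.exists_apply_eq {F : M → ℂ} (hF : IsLocallyConstant F)
    (hM : IsConnected M) : ∃ c : ℂ, ∀ p : M, F p = c := by
  have : PreconnectedSpace M := Subtype.preconnectedSpace hM.isPreconnected
  obtain ⟨q, hq⟩ := hM.nonempty
  exact ⟨F ⟨q, hq⟩, fun p => hF.apply_eq_of_preconnectedSpace p ⟨q, hq⟩⟩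

/-- Sasakian isomorphisms between open subsets of the quadric are linear. -/
theorem quadric_rigidity {ε : ℝ} (hε : ε * ε = 1) {f : C2 → C2} (hU : IsOpen U)
    (hc : IsConnected (quadric ε ∩ U))
    (hf : IsSasakiIso (quadric ε ∩ U) standardField (quadric ε ∩ V) standardField f) :
    ∃ A : Matrix (Fin 2) (Fin 2) ℂ,
      A.conjTranspose * Matrix.diagonal ![1, (ε : ℂ)] * A = Matrix.diagonal ![1, (ε : ℂ)] ∧
      ∀ p ∈ quadric ε ∩ U, f p = matrixAct A p := by
  have h := (quadric_retract ε).inter hU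
  have hE := (quadricFrame_mem hε).inter hU
  have hT := (standardField_mem ε).inter hU
  have hfr := quadric_isQuadricFrame hε hU
  obtain ⟨h1, h2⟩ := h.delbar_component hE hf.smooth fun p hp =>
    (hf.cplxTangent_map p hp _ (hE.2 p hp)).2
  -- Compatibility with the Reeb fields makes both components eigenfunctions of `T` with eigenvalue
  -- `i`.
  obtain ⟨h3, h4⟩ := h.derivation_component_eq hT hf.smooth
    (G₁ := algebraMap ℂ _ Complex.I * restrict (fun q => (f q).1) hf.smooth.fst)
    (G₂ := algebraMap ℂ _ Complex.I * restrict (fun q => (f q).2) hf.smooth.snd) fun p => by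
    rw [hf.reeb_map p p.2, one_smul]; rfl
  obtain ⟨a, b, c, d, ha, hb, hc', hd, e1, e2, e3, e4, e5⟩ := hfr.exists_linear h1 h2 h3 h4 (by
    refine smoothFunctions.ext fun p => ?_
    have hp : ‖(f p).1‖ ^ 2 + ε * ‖(f p).2‖ ^ 2 = 1 := (hf.bijOn.mapsTo p.2).1
    change (f p).1 * conj (f p).1 + ε * (f p).2 * conj (f p).2 = 1
    rw [mul_assoc, Complex.mul_conj, Complex.mul_conj, Complex.normSq_eq_norm_sq,
      Complex.normSq_eq_norm_sq]
    exact_mod_cast hp)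
  obtain ⟨a', ha'⟩ := (quadric_isLocallyConstant hε hU ha.1 ha.2).exists_apply_eq hc
  obtain ⟨b', hb'⟩ := (quadric_isLocallyConstant hε hU hb.1 hb.2).exists_apply_eq hc
  obtain ⟨c', hc''⟩ := (quadric_isLocallyConstant hε hU hc'.1 hc'.2).exists_apply_eq hc
  obtain ⟨d', hd'⟩ := (quadric_isLocallyConstant hε hU hd.1 hd.2).exists_apply_eq hc
  obtain ⟨q, hq⟩ := hc.nonempty
  have i1 : conj a' * a' + ε * conj c' * c' = 1 := by
    rw [← ha' ⟨q, hq⟩, ← hc'' ⟨q, hq⟩]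
    exact congrArg (fun G : smoothFunctions _ => G.1 ⟨q, hq⟩) e3
  have i2 : conj a' * b' + ε * conj c' * d' = 0 := by
    rw [← ha' ⟨q, hq⟩, ← hc'' ⟨q, hq⟩, ← hb' ⟨q, hq⟩, ← hd' ⟨q, hq⟩]
    exact congrArg (fun G : smoothFunctions _ => G.1 ⟨q, hq⟩) e4
  have i3 : conj b' * b' + ε * conj d' * d' = ε := by
    rw [← hb' ⟨q, hq⟩, ← hd' ⟨q, hq⟩]
    exact congrArg (fun G : smoothFunctions _ => G.1 ⟨q, hq⟩) e5
  have i4 : conj b' * a' + ε * conj d' * c' = 0 := by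
    have := congrArg conj i2
    simp at this
    linear_combination this
  refine ⟨!![a', b'; c', d'], ?_, fun p hp => Prod.ext ?_ ?_⟩
  · ext i j
    fin_cases i <;> fin_cases j <;>
      simp [Matrix.mul_apply, Fin.sum_univ_two, Matrix.diagonal]
    · linear_combination i1
    · linear_combination i2
    · linear_combination i4
    · linear_combination i3
  · have := congrArg (fun G : smoothFunctions _ => G.1 ⟨p, hp⟩) e1
    change (f p).1 = a.1 ⟨p, hp⟩ * p.1 + b.1 ⟨p, hp⟩ * p.2 at this
    rw [this, ha', hb']; simp [matrixAct]
  · have := congrArg (fun G : smoothFunctions _ => G.1 ⟨p, hp⟩) e2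
    change (f p).2 = c.1 ⟨p, hp⟩ * p.1 + d.1 ⟨p, hp⟩ * p.2 at this
    rw [this, hc'', hd']; simp [matrixAct]

theorem reebField_zero : reebField 0 0 0 = rigidField := by
  funext p
  simp [reebField, rigidField]

theorem exists_exp_I_eq {g : ℂ} (hg : g * conj g = 1) :
    ∃ φ ∈ Set.Ico 0 (2 * Real.pi), Complex.exp (Complex.I * φ) = g := by
  have hn : ‖g‖ = 1 := by
    rw [Complex.mul_conj, Complex.normSq_eq_norm_sq] at hg
    have : ‖g‖ ^ 2 = 1 := by exact_mod_cast hg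
    exact (pow_eq_one_iff_of_nonneg (norm_nonneg g) two_ne_zero).1 this
  have he : Complex.exp (Complex.I * g.arg) = g := by
    have := Complex.norm_mul_exp_arg_mul_I g
    rw [hn] at this
    simpa [mul_comm] using this
  rcases le_or_gt 0 g.arg with h0 | h0
  · exact ⟨g.arg, ⟨h0, by linarith [Complex.arg_le_pi g, Real.pi_pos]⟩, he⟩
  · refine ⟨g.arg + 2 * Real.pi, ⟨by linarith [Complex.neg_pi_lt_arg g, Real.pi_pos], by linarith⟩,
      ?_⟩
    push_cast
    rw [mul_add, Complex.exp_add, show Complex.I * (2 * Real.pi) = 2 * Real.pi * Complex.I by ring,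
      Complex.exp_two_pi_mul_I, mul_one, he]

/-- Sasakian isomorphisms between open subsets of the Heisenberg sphere are affine. -/
theorem heisenberg_rigidity {f : C2 → C2} (hU : IsOpen U)
    (hc : IsConnected (heisenbergSphere ∩ U))
    (hf : IsSasakiIso (heisenbergSphere ∩ U) rigidField (heisenbergSphere ∩ V) rigidField f) :
    ∃ (b : ℂ) (q : ℝ), ∃ φ ∈ Set.Ico 0 (2 * Real.pi),
      ∀ p ∈ heisenbergSphere ∩ U, f p = heisenbergAffine b q φ p := by
  have h := heisenbergSphere_retract.inter hU
  have hE := heisenbergFrame_mem.inter hU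
  have hT := rigidField_mem.inter hU
  have hfr := heisenberg_isHeisenbergFrame hU
  obtain ⟨h1, h2⟩ := h.delbar_component hE hf.smooth fun p hp =>
    (hf.cplxTangent_map p hp _ (hE.2 p hp)).2
  obtain ⟨h3, h4⟩ := h.derivation_component_eq hT hf.smooth (G₁ := 0) (G₂ := 1) fun p => by
    rw [hf.reeb_map p p.2, one_smul]; rfl
  obtain ⟨g, c, d, hg, hc', hd, hgg, e1, e2⟩ := hfr.exists_affine h1 h2 h3 h4 (by
    refine smoothFunctions.ext fun p => ?_
    have hp : (f p).2.im = ‖(f p).1‖ ^ 2 := (hf.bijOn.mapsTo p.2).1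
    change (f p).2 - conj (f p).2 = 2 * Complex.I * (f p).1 * conj (f p).1
    rw [Complex.sub_conj, mul_assoc, Complex.mul_conj, hp, Complex.normSq_eq_norm_sq]
    push_cast; ring)
  obtain ⟨g', hg'⟩ := (heisenberg_isLocallyConstant hU hg.1 hg.2).exists_apply_eq hc
  obtain ⟨c', hc''⟩ := (heisenberg_isLocallyConstant hU hc'.1 hc'.2).exists_apply_eq hc
  obtain ⟨d', hd'⟩ := (heisenberg_isLocallyConstant hU hd.1 hd.2).exists_apply_eq hc
  obtain ⟨q, hq⟩ := hc.nonempty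
  have i1 : g' * conj g' = 1 := by
    rw [← hg' ⟨q, hq⟩]
    exact congrArg (fun G : smoothFunctions _ => G.1 ⟨q, hq⟩) hgg
  obtain ⟨φ, hφ, hφg⟩ := exists_exp_I_eq i1
  -- Since `|g| = 1`, the first component `g z + c` equals `g (z + c ḡ)`. Only the real part of `d`
  -- is a parameter, as the imaginary part of the second component is dictated by the target sphere.
  refine ⟨c' * conj g', d'.re, φ, hφ, fun p hp => ?_⟩
  have j1 : (f p).1 = g' * (p.1 + c' * conj g') := by
    have : (f p).1 = g.1 ⟨p, hp⟩ * p.1 + c.1 ⟨p, hp⟩ :=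
      congrArg (fun G : smoothFunctions _ => G.1 ⟨p, hp⟩) e1
    rw [this, hg', hc'']
    linear_combination -c' * i1
  have j2 : (f p).2 = p.2 + 2 * Complex.I * g' * conj c' * p.1 + d' := by
    have : (f p).2 = p.2 + 2 * Complex.I * g.1 ⟨p, hp⟩ * conj (c.1 ⟨p, hp⟩) * p.1 +
        d.1 ⟨p, hp⟩ := congrArg (fun G : smoothFunctions _ => G.1 ⟨p, hp⟩) e2
    rw [this, hg', hc'', hd']
  have j3 : (f p).2.im = ‖(f p).1‖ ^ 2 := (hf.bijOn.mapsTo hp).1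
  rw [heisenbergAffine, hφg, ← j1, ← j3]
  refine Prod.ext rfl (Complex.ext ?_ ?_)
  · simp [j2]; ring
  · simp

end

/-! ### Homotheties given by local biholomorphisms, and their composition. -/

noncomputable section

/-- A local biholomorphism of `ℂ²` that maps `M` to `M'` and the field `Z` on `M` to `κ Z'`. -/
structure IsHoloHomothety (κ : ℝ) (M : Set C2) (Z : C2 → C2) (M' : Set C2) (Z' : C2 → C2)
    (e : OpenPartialHomeomorph C2 C2) : Prop where
  smooth : ContDiffOn ℂ ∞ e e.source
  smooth_symm : ContDiffOn ℂ ∞ e.symm e.target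
  mem_iff : ∀ p ∈ e.source, e p ∈ M' ↔ p ∈ M
  map_field : ∀ p ∈ e.source, p ∈ M → fderiv ℂ e p (Z p) = κ • Z' (e p)

namespace IsHoloHomothety

variable {κ κ' : ℝ} {M M' M'' : Set C2} {Z Z' Z'' : C2 → C2} {e e' : OpenPartialHomeomorph C2 C2}
  {p : C2}

theorem hasFDerivAt (h : IsHoloHomothety κ M Z M' Z' e) (hp : p ∈ e.source) :
    HasFDerivAt e (fderiv ℂ e p) p :=
  ((h.smooth.contDiffAt (e.open_source.mem_nhds hp)).differentiableAt (by simp)).hasFDerivAt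

theorem hasFDerivAt_symm (h : IsHoloHomothety κ M Z M' Z' e) (hp : p ∈ e.target) :
    HasFDerivAt e.symm (fderiv ℂ e.symm p) p :=
  ((h.smooth_symm.contDiffAt (e.open_target.mem_nhds hp)).differentiableAt (by simp)).hasFDerivAt

/-- The differential is complex linear and maps tangent vectors to tangent vectors. So it maps `T ∩
iT` into `T' ∩ iT'` and commutes with `i`. -/
theorem isSasakiHomothety (h : IsHoloHomothety κ M Z M' Z' e)
    (hZ : ∀ p ∈ M, Z p ∈ realTangent M p) :
    IsSasakiHomothety κ (M ∩ e.source) Z (M' ∩ e.target) Z' e where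
  bijOn := by
    refine ⟨fun q hq => ⟨(h.mem_iff q hq.2).2 hq.1, e.map_source hq.2⟩,
      e.injOn.mono Set.inter_subset_right, fun q hq => ?_⟩
    refine ⟨e.symm q, ⟨?_, e.map_target hq.2⟩, e.right_inv hq.2⟩
    rw [← h.mem_iff _ (e.map_target hq.2), e.right_inv hq.2]
    exact hq.1
  smooth := (h.smooth.restrict_scalars ℝ).mono Set.inter_subset_right
  smooth_inverse := ⟨e.symm, (h.smooth_symm.restrict_scalars ℝ).mono Set.inter_subset_right,
    fun q hq => e.left_inv hq.2, fun q hq => e.right_inv hq.2⟩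
  cplxTangent_map := fun p hp v hv => by
    have h1 := ((h.hasFDerivAt hp.2).restrictScalars ℝ).hasFDerivWithinAt (s := M ∩ e.source)
    have hm : Set.MapsTo e (M ∩ e.source) (M' ∩ e.target) :=
      fun q hq => ⟨(h.mem_iff q hq.2).2 hq.1, e.map_source hq.2⟩
    have h2 := h1.fderivWithin_apply_of_mem_realTangent hv.1
    have h3 := h1.fderivWithin_apply_of_mem_realTangent hv.2
    have h4 : (fderiv ℂ e p).restrictScalars ℝ (Complex.I • v) =
      Complex.I • (fderiv ℂ e p).restrictScalars ℝ v := (fderiv ℂ e p).map_smul _ _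
    have h5 := h1.map_mem_realTangent hm hv.1
    have h6 := h1.map_mem_realTangent hm hv.2
    rw [h2, h3]
    rw [h4] at h6 ⊢
    exact ⟨⟨h5, h6⟩, rfl⟩
  reeb_map := fun p hp => by
    have h1 := ((h.hasFDerivAt hp.2).restrictScalars ℝ).hasFDerivWithinAt (s := M ∩ e.source)
    rw [h1.fderivWithin_apply_of_mem_realTangent
      (by rw [realTangent_inter e.open_source hp.2]; exact hZ p hp.1)]
    exact h.map_field p hp.2 hp.1

theorem symm (h : IsHoloHomothety κ M Z M' Z' e) (hκ : κ ≠ 0) :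
    IsHoloHomothety κ⁻¹ M' Z' M Z e.symm where
  smooth := h.smooth_symm
  smooth_symm := h.smooth
  mem_iff := fun p hp => by
    rw [← h.mem_iff _ (e.map_target hp), e.right_inv hp]
  map_field := fun p hp hpM => by
    have hs := e.map_target hp
    have hm : e.symm p ∈ M := by rwa [← h.mem_iff _ hs, e.right_inv hp]
    have h1 := (h.hasFDerivAt_symm (p := e (e.symm p)) (by rwa [e.right_inv hp])).comp _
      (h.hasFDerivAt hs)
    have h2 : HasFDerivAt (e.symm ∘ e) (ContinuousLinearMap.id ℂ C2) (e.symm p) :=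
      (hasFDerivAt_id _).congr_of_eventuallyEq
        ((e.open_source.mem_nhds hs |> Filter.eventually_of_mem) fun q hq => e.left_inv hq)
    have h3 := congrArg (fun f => f (Z (e.symm p))) (h1.unique h2)
    have h4 := h.map_field _ hs hm
    rw [e.right_inv hp] at h3 h4
    simp only [ContinuousLinearMap.comp_apply, h4, ContinuousLinearMap.id_apply] at h3
    rw [← h3, (fderiv ℂ e.symm p).map_smul_of_tower, inv_smul_smul₀ hκ]

theorem trans (h : IsHoloHomothety κ M Z M' Z' e) (h' : IsHoloHomothety κ' M' Z' M'' Z'' e') :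
    IsHoloHomothety (κ * κ') M Z M'' Z'' (e.trans e') where
  smooth := by
    rw [OpenPartialHomeomorph.trans_source]
    exact h'.smooth.comp (h.smooth.mono Set.inter_subset_left) fun q hq => hq.2
  smooth_symm := by
    rw [OpenPartialHomeomorph.trans_target]
    exact h.smooth_symm.comp (h'.smooth_symm.mono Set.inter_subset_left) fun q hq => hq.2
  mem_iff := fun p hp => by
    rw [OpenPartialHomeomorph.trans_source] at hp
    rw [← h.mem_iff p hp.1, ← h'.mem_iff _ hp.2]; rfl
  map_field := fun p hp hpM => by
    rw [OpenPartialHomeomorph.trans_source] at hp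
    have h1 := (h'.hasFDerivAt hp.2).comp p (h.hasFDerivAt hp.1)
    have h2 : HasFDerivAt (e.trans e') _ p := h1
    rw [h2.fderiv, ContinuousLinearMap.comp_apply, h.map_field p hp.1 hpM,
      ContinuousLinearMap.map_smul_of_tower, h'.map_field _ hp.2 ((h.mem_iff p hp.1).2 hpM),
      mul_smul]
    rfl

/-- The homothety given by a pair of mutually inverse holomorphic maps. -/
theorem exists_of_inverse {U U' : Set C2} {F G : C2 → C2} (hU : IsOpen U)
    (hU' : IsOpen U') (hF : ContDiffOn ℂ ∞ F U) (hG : ContDiffOn ℂ ∞ G U')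
    (hFU : Set.MapsTo F U U') (hGU : Set.MapsTo G U' U) (hGF : Set.LeftInvOn G F U)
    (hFG : Set.RightInvOn G F U') (hM : ∀ q ∈ U, F q ∈ M' ↔ q ∈ M)
    (hZ : ∀ q ∈ U, q ∈ M → ∃ F' : C2 →L[ℂ] C2, HasFDerivAt F F' q ∧ F' (Z q) = κ • Z' (F q)) :
    ∃ e : OpenPartialHomeomorph C2 C2, e.source = U ∧ e.target = U' ∧ ⇑e = F ∧
      IsHoloHomothety κ M Z M' Z' e := by
  refine ⟨{
    toFun := F, invFun := G, source := U, target := U', map_source' := hFU, map_target' := hGU,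
    left_inv' := hGF, right_inv' := hFG, open_source := hU, open_target := hU',
    continuousOn_toFun := hF.continuousOn, continuousOn_invFun := hG.continuousOn },
    rfl, rfl, rfl, ⟨hF, hG, hM, fun q hq hqM => ?_⟩⟩
  obtain ⟨F', h1, h2⟩ := hZ q hq hqM
  change fderiv ℂ F q (Z q) = _
  rw [h1.fderiv]
  exact h2

end IsHoloHomothety

/-- The germs of `(M, Z)` at `p` and of `(M', Z')` at `p'` are related by a local
biholomorphism. -/
def HoloHomothetic (M : Set C2) (Z : C2 → C2) (p : C2) (M' : Set C2) (Z' : C2 → C2)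
    (p' : C2) : Prop :=
  ∃ κ : ℝ, κ ≠ 0 ∧ ∃ e : OpenPartialHomeomorph C2 C2, p ∈ e.source ∧ p ∈ M ∧ e p = p' ∧
    IsHoloHomothety κ M Z M' Z' e

namespace HoloHomothetic

variable {M M' M'' : Set C2} {Z Z' Z'' : C2 → C2} {p p' p'' : C2}

theorem symm (h : HoloHomothetic M Z p M' Z' p') : HoloHomothetic M' Z' p' M Z p := by
  obtain ⟨κ, hκ, e, h1, h2, rfl, h3⟩ := h
  exact ⟨κ⁻¹, inv_ne_zero hκ, e.symm, e.map_source h1, (h3.mem_iff p h1).2 h2, e.left_inv h1,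
    h3.symm hκ⟩

theorem trans (h : HoloHomothetic M Z p M' Z' p') (h' : HoloHomothetic M' Z' p' M'' Z'' p'') :
    HoloHomothetic M Z p M'' Z'' p'' := by
  obtain ⟨κ, hκ, e, h1, h2, rfl, h3⟩ := h
  obtain ⟨κ', hκ', e', h1', h2', rfl, h3'⟩ := h'
  refine ⟨κ * κ', mul_ne_zero hκ hκ', e.trans e', ?_, h2, rfl, h3.trans h3'⟩
  rw [OpenPartialHomeomorph.trans_source]
  exact ⟨h1, h1'⟩

theorem locallyHomothetic (h : HoloHomothetic M Z p M' Z' p')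
    (hZ : ∀ p ∈ M, Z p ∈ realTangent M p) : LocallyHomothetic M Z p M' Z' p' := by
  obtain ⟨κ, hκ, e, h1, h2, rfl, h3⟩ := h
  exact ⟨e.source, e.target, e.open_source, e.open_target, ⟨h2, h1⟩,
    ⟨(h3.mem_iff p h1).2 h2, e.map_source h1⟩, κ, hκ, e, rfl, h3.isSasakiHomothety hZ⟩

/-- Fields that agree near `p` up to a constant are homothetic at `p`. -/
theorem of_eqOn {κ : ℝ} (hκ : κ ≠ 0) {U : Set C2} (hU : IsOpen U) (hpU : p ∈ U) (hp : p ∈ M)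
    (hM : ∀ q ∈ U, q ∈ M' ↔ q ∈ M) (hZ : ∀ q ∈ U, q ∈ M → Z q = κ • Z' q) :
    HoloHomothetic M Z p M' Z' p := by
  refine ⟨κ, hκ, OpenPartialHomeomorph.ofSet U hU, hpU, hp, rfl, ⟨?_, ?_, hM, fun q hq hqM => ?_⟩⟩
  · exact contDiffOn_id
  · exact contDiffOn_id
  · have : HasFDerivAt (OpenPartialHomeomorph.ofSet U hU) (ContinuousLinearMap.id ℂ C2) q :=
      hasFDerivAt_id q
    rw [this.fderiv]
    exact hZ q hq hqM

/-- The homothety given by a pair of mutually inverse holomorphic maps. -/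
theorem of_inverse {κ : ℝ} (hκ : κ ≠ 0) {U U' : Set C2} {F G : C2 → C2} (hU : IsOpen U)
    (hU' : IsOpen U') (hF : ContDiffOn ℂ ∞ F U) (hG : ContDiffOn ℂ ∞ G U')
    (hFU : Set.MapsTo F U U') (hGU : Set.MapsTo G U' U) (hGF : Set.LeftInvOn G F U)
    (hFG : Set.RightInvOn G F U') (hpU : p ∈ U) (hp : p ∈ M) (hpp : F p = p')
    (hM : ∀ q ∈ U, F q ∈ M' ↔ q ∈ M)
    (hZ : ∀ q ∈ U, q ∈ M → ∃ F' : C2 →L[ℂ] C2, HasFDerivAt F F' q ∧ F' (Z q) = κ • Z' (F q)) :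
    HoloHomothetic M Z p M' Z' p' := by
  obtain ⟨e, rfl, -, rfl, he⟩ :=
    IsHoloHomothety.exists_of_inverse hU hU' hF hG hFU hGU hGF hFG hM hZ
  exact ⟨κ, hκ, e, hpU, hp, hpp, he⟩

end HoloHomothetic

end

/-! ### The model maps: linear maps, Cayley transform, exponential map. -/

noncomputable section

section Linear

/-- The linear map of `ℂ²` given by a matrix, as a continuous linear map. -/
def matrixActL (A : Matrix (Fin 2) (Fin 2) ℂ) : C2 →L[ℂ] C2 :=
  (A 0 0 • ContinuousLinearMap.fst ℂ ℂ ℂ + A 0 1 • ContinuousLinearMap.snd ℂ ℂ ℂ).prod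
    (A 1 0 • ContinuousLinearMap.fst ℂ ℂ ℂ + A 1 1 • ContinuousLinearMap.snd ℂ ℂ ℂ)

theorem coe_matrixActL (A : Matrix (Fin 2) (Fin 2) ℂ) : ⇑(matrixActL A) = matrixAct A := by
  funext p
  simp [matrixActL, matrixAct]

theorem matrixAct_mul (A B : Matrix (Fin 2) (Fin 2) ℂ) (p : C2) :
    matrixAct (A * B) p = matrixAct A (matrixAct B p) := by
  simp only [matrixAct, Matrix.mul_apply, Fin.sum_univ_two]
  refine Prod.ext ?_ ?_ <;> ring

theorem matrixAct_one (p : C2) : matrixAct 1 p = p := by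
  simp [matrixAct]

theorem mem_quadric_iff {ε : ℝ} {p : C2} :
    p ∈ quadric ε ↔ conj p.1 * p.1 + ε * (conj p.2 * p.2) = 1 := by
  rw [mul_comm, Complex.mul_conj, mul_comm (conj _), Complex.mul_conj, Complex.normSq_eq_norm_sq,
    Complex.normSq_eq_norm_sq, quadric, Set.mem_ofPred_eq]
  norm_cast

variable {ε : ℝ} {A : Matrix (Fin 2) (Fin 2) ℂ}

theorem matrixAct_mem_quadric
    (hA : A.conjTranspose * Matrix.diagonal ![1, (ε : ℂ)] * A = Matrix.diagonal ![1, (ε : ℂ)])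
    (p : C2) : matrixAct A p ∈ quadric ε ↔ p ∈ quadric ε := by
  have h (i j : Fin 2) := congrFun (congrFun hA i) j
  have h00 := h 0 0
  have h01 := h 0 1
  have h10 := h 1 0
  have h11 := h 1 1
  simp [Matrix.mul_apply, Fin.sum_univ_two, Matrix.diagonal] at h00 h01 h10 h11
  have key : conj (matrixAct A p).1 * (matrixAct A p).1 +
      ε * (conj (matrixAct A p).2 * (matrixAct A p).2) =
      conj p.1 * p.1 + ε * (conj p.2 * p.2) := by
    simp only [matrixAct, map_add, map_mul]
    linear_combination conj p.1 * p.1 * h00 + conj p.1 * p.2 * h01 + conj p.2 * p.1 * h10 +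
      conj p.2 * p.2 * h11
  rw [mem_quadric_iff, mem_quadric_iff, key]

theorem exists_isHoloHomothety_matrixAct (hε : ε * ε = 1)
    (hA : A.conjTranspose * Matrix.diagonal ![1, (ε : ℂ)] * A = Matrix.diagonal ![1, (ε : ℂ)]) :
    ∃ e : OpenPartialHomeomorph C2 C2, e.source = Set.univ ∧ e.target = Set.univ ∧
      ⇑e = matrixAct A ∧
      IsHoloHomothety 1 (quadric ε) standardField (quadric ε) standardField e := by
  have hε' : (ε : ℂ) * ε = 1 := by exact_mod_cast hε
  have hD : Matrix.diagonal ![1, (ε : ℂ)] * Matrix.diagonal ![1, (ε : ℂ)] = 1 := by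
    ext i j
    fin_cases i <;> fin_cases j <;> simp [hε']
  -- With `D = diag(1, ε)`, the relations `A* D A = D` and `D² = 1` say that `D A* D` is inverse to
  -- `A`.
  have hB : (Matrix.diagonal ![1, (ε : ℂ)] * A.conjTranspose * Matrix.diagonal ![1, (ε : ℂ)]) * A =
      1 := by
    rw [Matrix.mul_assoc, Matrix.mul_assoc, ← Matrix.mul_assoc _ _ A, hA, hD]
  have hB' := mul_eq_one_comm.1 hB
  refine IsHoloHomothety.exists_of_inverse isOpen_univ isOpen_univ
    (G := matrixAct (Matrix.diagonal ![1, (ε : ℂ)] * A.conjTranspose *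
      Matrix.diagonal ![1, (ε : ℂ)]))
    ?_ ?_ (fun _ _ => trivial) (fun _ _ => trivial) (fun q _ => ?_) (fun q _ => ?_)
    (fun q _ => matrixAct_mem_quadric hA q) (fun q _ _ => ⟨matrixActL A, ?_, ?_⟩)
  · rw [← coe_matrixActL]; exact (matrixActL A).contDiff.contDiffOn
  · rw [← coe_matrixActL]; exact (matrixActL _).contDiff.contDiffOn
  · rw [← matrixAct_mul, hB, matrixAct_one]
  · rw [← matrixAct_mul, hB', matrixAct_one]
  · rw [← coe_matrixActL]; exact (matrixActL A).hasFDerivAt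
  · rw [standardField, map_smul, coe_matrixActL, one_smul]; rfl

theorem isSasakiIso_matrixAct (hε : ε * ε = 1)
    (hA : A.conjTranspose * Matrix.diagonal ![1, (ε : ℂ)] * A = Matrix.diagonal ![1, (ε : ℂ)]) :
    IsSasakiIso (quadric ε) standardField (quadric ε) standardField (matrixAct A) := by
  obtain ⟨e, h1, h2, h3, h4⟩ := exists_isHoloHomothety_matrixAct hε hA
  have := h4.isSasakiHomothety (standardField_mem ε).2
  rwa [h1, h2, h3, Set.inter_univ] at this

/-- The quadric is homogeneous. -/
theorem quadric_homogeneous (hε : ε * ε = 1) {p : C2} (hp : p ∈ quadric ε) :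
    HoloHomothetic (quadric ε) standardField (1, 0) (quadric ε) standardField p := by
  have hε' : (ε : ℂ) * ε = 1 := by exact_mod_cast hε
  rw [mem_quadric_iff] at hp
  -- The first column is `p`, so `(1, 0)` goes to `p`. The second is the vector `-ε E` of the frame
  -- of `H` at `p`, which is orthogonal to `p` and has square `ε`.
  obtain ⟨e, h1, -, h3, h4⟩ := exists_isHoloHomothety_matrixAct
    (A := !![p.1, -ε * conj p.2; p.2, conj p.1]) hε (by
      ext i j
      fin_cases i <;> fin_cases j <;>
        simp [Matrix.mul_apply, Fin.sum_univ_two, Matrix.diagonal]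
      · linear_combination hp
      · ring
      · ring
      · linear_combination ε * hp)
  refine ⟨1, one_ne_zero, e, h1 ▸ trivial, by simp [mem_quadric_iff], ?_, h4⟩
  rw [h3]
  simp [matrixAct]

end Linear

theorem HasFDerivAt.inv_complex {g : C2 → ℂ} {g' : C2 →L[ℂ] ℂ} {q : C2} (hg : HasFDerivAt g g' q)
    (h0 : g q ≠ 0) : HasFDerivAt (fun x => (g x)⁻¹) (-(g q ^ 2)⁻¹ • g') q :=
  (hasDerivAt_inv h0).comp_hasFDerivAt q hg

theorem hasFDerivAt_fst_complex (q : C2) :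
    HasFDerivAt (fun x : C2 => x.1) (ContinuousLinearMap.fst ℂ ℂ ℂ) q := hasFDerivAt_fst

theorem hasFDerivAt_snd_complex (q : C2) :
    HasFDerivAt (fun x : C2 => x.2) (ContinuousLinearMap.snd ℂ ℂ ℂ) q := hasFDerivAt_snd

theorem mem_heisenbergSphere_iff {p : C2} :
    p ∈ heisenbergSphere ↔ p.2 - conj p.2 = 2 * Complex.I * (p.1 * conj p.1) := by
  rw [Complex.sub_conj, Complex.mul_conj, Complex.normSq_eq_norm_sq, mul_comm (2 * Complex.I),
    mul_comm _ Complex.I]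
  rw [heisenbergSphere, Set.mem_ofPred_eq]
  constructor
  · intro h; rw [h]; push_cast; ring
  · intro h
    have h2 : Complex.I * ((2 * p.2.im : ℝ) : ℂ) = Complex.I * ((2 * ‖p.1‖ ^ 2 : ℝ) : ℂ) := by
      rw [h]; push_cast; ring
    have h3 := mul_left_cancel₀ Complex.I_ne_zero h2
    have h4 : 2 * p.2.im = 2 * ‖p.1‖ ^ 2 := by exact_mod_cast h3
    linarith

/-- The Cayley transform to the quadric. -/
theorem heisenberg_quadric {ε s τ : ℝ} (hε : ε * ε = 1) (hs : s ≠ 0) (hτ : ε * s ^ 2 = τ) :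
    HoloHomothetic heisenbergSphere (reebField τ 0 (τ ^ 2)) 0 (quadric ε) standardField (1, 0) := by
  have hτ0 : τ ≠ 0 := by
    rintro rfl
    rcases mul_eq_zero.1 hτ with h | h
    · simp [h] at hε
    · exact hs (by simpa using h)
  have hτc : (τ : ℂ) ≠ 0 := by exact_mod_cast hτ0
  have hsc : (s : ℂ) ≠ 0 := by exact_mod_cast hs
  have hτs : (ε : ℂ) * s ^ 2 = τ := by exact_mod_cast hτ
  have hI := Complex.I_ne_zero
  have hI2 := Complex.I_sq
  have hd : ContDiff ℂ ∞ (fun q : C2 => 1 - Complex.I * τ * q.2) :=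
    contDiff_const.sub (contDiff_const.mul contDiff_snd)
  have hn : ContDiff ℂ ∞ (fun q : C2 => 1 + Complex.I * τ * q.2) :=
    contDiff_const.add (contDiff_const.mul contDiff_snd)
  have hd' : ContDiff ℂ ∞ (fun q : C2 => 1 + q.1) := contDiff_const.add contDiff_fst
  -- The factor `2τ` is read off at the origin, where `(0, 1)` goes to `(2iτ, 0)` at the point `(1,
  -- 0)`. The spheres match because `|1 - iτw|² - |1 + iτw|² = 4τ Im w`, while `ε |2sz|² = 4τ |z|²`.
  refine HoloHomothetic.of_inverse (κ := 2 * τ) (mul_ne_zero two_ne_zero hτ0)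
    (U := {q | 1 - Complex.I * τ * q.2 ≠ 0}) (U' := {q | 1 + q.1 ≠ 0})
    (F := fun q => ((1 + Complex.I * τ * q.2) * (1 - Complex.I * τ * q.2)⁻¹,
      2 * s * q.1 * (1 - Complex.I * τ * q.2)⁻¹))
    (G := fun q => (q.2 * (s * (1 + q.1))⁻¹, (q.1 - 1) * (Complex.I * τ * (1 + q.1))⁻¹))
    (isOpen_ne_fun hd.continuous continuous_const) (isOpen_ne_fun hd'.continuous continuous_const)
    ?_ ?_ ?_ ?_ ?_ ?_ ?_ ?_ ?_ ?_ ?_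
  · exact (hn.contDiffOn.mul (hd.contDiffOn.inv fun q hq => hq)).prodMk
      ((contDiff_const.mul contDiff_fst).contDiffOn.mul (hd.contDiffOn.inv fun q hq => hq))
  · exact (contDiff_snd.contDiffOn.mul ((contDiff_const.mul hd').contDiffOn.inv
      fun q hq => mul_ne_zero hsc hq)).prodMk
      ((contDiff_fst.sub contDiff_const).contDiffOn.mul
        ((contDiff_const.mul hd').contDiffOn.inv fun q hq =>
          mul_ne_zero (mul_ne_zero hI hτc) hq))
  · intro q (hq : _ ≠ 0)
    change 1 + (1 + Complex.I * τ * q.2) * (1 - Complex.I * τ * q.2)⁻¹ ≠ 0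
    have : 1 + (1 + Complex.I * τ * q.2) * (1 - Complex.I * τ * q.2)⁻¹ =
      2 * (1 - Complex.I * τ * q.2)⁻¹ := by field_simp; ring
    rw [this]
    exact mul_ne_zero two_ne_zero (inv_ne_zero hq)
  · intro q (hq : 1 + q.1 ≠ 0)
    change 1 - Complex.I * τ * ((q.1 - 1) * (Complex.I * τ * (1 + q.1))⁻¹) ≠ 0
    have : 1 - Complex.I * τ * ((q.1 - 1) * (Complex.I * τ * (1 + q.1))⁻¹) = 2 * (1 + q.1)⁻¹ := by
      field_simp; ring
    rw [this]
    exact mul_ne_zero two_ne_zero (inv_ne_zero hq)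
  · intro q (hq : _ ≠ 0)
    have h1 : 1 + (1 + Complex.I * τ * q.2) * (1 - Complex.I * τ * q.2)⁻¹ =
      2 * (1 - Complex.I * τ * q.2)⁻¹ := by field_simp; ring
    simp only [h1]
    refine Prod.ext ?_ ?_ <;> simp only
    · field_simp
    · field_simp; ring
  · intro q (hq : 1 + q.1 ≠ 0)
    have h1 : 1 - Complex.I * τ * ((q.1 - 1) * (Complex.I * τ * (1 + q.1))⁻¹) =
      2 * (1 + q.1)⁻¹ := by field_simp; ring
    simp only [h1]
    refine Prod.ext ?_ ?_ <;> simp only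
    · field_simp; ring
    · field_simp
  · simp
  · simp [heisenbergSphere]
  · simp
  · intro q (hq : _ ≠ 0)
    rw [mem_quadric_iff, mem_heisenbergSphere_iff]
    have hq' : 1 + Complex.I * τ * conj q.2 ≠ 0 := by
      have := (map_ne_zero (starRingEnd ℂ)).2 hq
      simpa using this
    simp only [map_mul, map_inv₀, map_sub, map_add, map_one, Complex.conj_I, Complex.conj_ofReal,
      map_ofNat, neg_mul, sub_neg_eq_add]
    constructor
    · intro h
      field_simp at h
      have : (2 * τ * Complex.I) * (q.2 - conj q.2 - 2 * Complex.I * (q.1 * conj q.1)) = 0 := by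
        linear_combination h - 4 * q.1 * conj q.1 * hτs - 4 * τ * q.1 * conj q.1 * hI2
      exact sub_eq_zero.1 ((mul_eq_zero.1 this).resolve_left
        (mul_ne_zero (mul_ne_zero two_ne_zero hτc) hI))
    · intro h
      field_simp
      linear_combination (2 * τ * Complex.I) * h + 4 * q.1 * conj q.1 * hτs +
        4 * τ * q.1 * conj q.1 * hI2
  · intro q (hq : _ ≠ 0) _
    have e1 := (((hasFDerivAt_snd_complex q).const_mul (Complex.I * τ)).const_sub 1).inv_complex hq
    have e2 := (((hasFDerivAt_snd_complex q).const_mul (Complex.I * τ)).const_add 1).mul e1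
    have e3 := ((hasFDerivAt_fst_complex q).const_mul (2 * s : ℂ)).mul e1
    refine ⟨_, e2.prodMk e3, ?_⟩
    refine Prod.ext ?_ ?_
    · simp [reebField, standardField]
      field_simp
      linear_combination (2 * τ ^ 2 * q.2 ^ 2) * hI2
    · simp [reebField, standardField]
      field_simp
      linear_combination (q.1 * τ * q.2) * hI2

/-- The rigid hypersurface `v = ε log (1 + ε |z|²)`. -/
def rigidSphere (ε : ℝ) : Set C2 :=
  {p | 0 < 1 + ε * ‖p.1‖ ^ 2 ∧ p.2.im = ε * Real.log (1 + ε * ‖p.1‖ ^ 2)}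

theorem rigidSphere_one : rigidSphere 1 = rigidSpherePos := by
  ext p
  have : 0 < 1 + ‖p.1‖ ^ 2 := by positivity
  simp [rigidSphere, rigidSpherePos, this]

theorem rigidSphere_neg_one : rigidSphere (-1) = rigidSphereNeg := by
  ext p
  simp only [rigidSphere, rigidSphereNeg, Set.mem_ofPred_eq, neg_mul, one_mul, ← sub_eq_add_neg,
    sub_pos, sq_lt_one_iff_abs_lt_one, abs_norm]

/-- Exponentiating removes the logarithm and the positivity condition together. The result is the
equation that the exponential map carries to the quadric. -/
theorem mem_rigidSphere_iff {ε : ℝ} (hε : ε * ε = 1) (p : C2) :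
    p ∈ rigidSphere ε ↔ Real.exp (-(ε * p.2.im)) * (1 + ε * ‖p.1‖ ^ 2) = 1 := by
  rw [rigidSphere, Set.mem_ofPred_eq]
  constructor
  · rintro ⟨h1, h2⟩
    rw [h2, ← mul_assoc, hε, one_mul, Real.exp_neg, Real.exp_log h1, inv_mul_cancel₀ h1.ne']
  · intro h
    have h1 : 1 + ε * ‖p.1‖ ^ 2 = Real.exp (ε * p.2.im) := by
      rw [Real.exp_neg] at h
      field_simp at h
      exact h
    rw [h1, Real.log_exp, ← mul_assoc, hε, one_mul]
    exact ⟨Real.exp_pos _, rfl⟩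

/-- The exponential map from the rigid sphere to the quadric. -/
theorem rigidSphere_quadric {ε : ℝ} (hε : ε * ε = 1) {p : C2} (hp : p ∈ rigidSphere ε) :
    ∃ q ∈ quadric ε,
      HoloHomothetic (rigidSphere ε) rigidField p (quadric ε) standardField q := by
  have hε' : (ε : ℂ) * ε = 1 := by exact_mod_cast hε
  have hε0 : ε ≠ 0 := left_ne_zero_of_mul_eq_one hε
  have hε1 : |ε| = 1 := by
    have : |ε| * |ε| = 1 := by rw [← abs_mul, hε, abs_one]
    nlinarith [abs_nonneg ε]
  -- This choice gives `|e^{kw}|² = e^{-ε Im w}`, which puts `(e^{kw}, z e^{kw})` on the quadric.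
  -- Along `∂/∂u` the map is multiplied by `k = (ε/2) i`, whence the homothety factor `ε/2`.
  set k : ℂ := Complex.I * ε / 2 with hk
  have hk0 : k ≠ 0 := by simp [hk, hε0]
  have hkre (x : ℂ) : (k * x).re = -(ε * x.im) / 2 := by
    simp [hk]; ring
  have hkim (x : ℂ) : (k * x).im = ε * x.re / 2 := by
    simp [hk]; ring
  have hF : ContDiff ℂ ∞ (fun q : C2 => Complex.exp (k * q.2)) :=
    (contDiff_const.mul contDiff_snd).cexp
  have hc : ContDiff ℂ ∞ (fun q : C2 => q.1 * Complex.exp (-(k * p.2))) :=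
    contDiff_fst.mul contDiff_const
  -- A local inverse is the principal logarithm centred at `p`. On the strip of half-width `2π`
  -- around `p` the imaginary part of `k (w - w_p)` stays below `π` in absolute value.
  have hslit : ∀ q : C2, |(q.2 - p.2).re| < 2 * Real.pi →
      Complex.log (Complex.exp (k * q.2) * Complex.exp (-(k * p.2))) = k * (q.2 - p.2) ∧
      Complex.exp (k * q.2) * Complex.exp (-(k * p.2)) ∈ Complex.slitPlane := by
    intro q hq
    rw [← Complex.exp_add, ← sub_eq_add_neg, ← mul_sub]
    have h1 : |(k * (q.2 - p.2)).im| < Real.pi := by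
      rw [hkim, abs_div, abs_mul, hε1, one_mul, abs_two]; linarith
    have h2 : Complex.log (Complex.exp (k * (q.2 - p.2))) = k * (q.2 - p.2) :=
      Complex.log_exp (abs_lt.1 h1).1 (abs_lt.1 h1).2.le
    refine ⟨h2, ?_⟩
    rw [Complex.mem_slitPlane_iff_arg, ← Complex.log_im, h2]
    exact ⟨(abs_lt.1 h1).2.ne, Complex.exp_ne_zero _⟩
  have hnorm (q : C2) : Complex.exp (k * q.2) * conj (Complex.exp (k * q.2)) =
      (Real.exp (-(ε * q.2.im)) : ℂ) := by
    rw [Complex.mul_conj, Complex.normSq_eq_norm_sq, Complex.norm_exp, hkre, ← Real.exp_nat_mul]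
    congr 2
    push_cast; ring
  have hmem : ∀ q : C2, ((Complex.exp (k * q.2), q.1 * Complex.exp (k * q.2)) : C2) ∈ quadric ε ↔
      q ∈ rigidSphere ε := by
    intro q
    rw [mem_rigidSphere_iff hε, mem_quadric_iff]
    have h2 : q.1 * conj q.1 = ((‖q.1‖ ^ 2 : ℝ) : ℂ) := by
      rw [Complex.mul_conj, Complex.normSq_eq_norm_sq]
    have : conj (Complex.exp (k * q.2)) * Complex.exp (k * q.2) +
        ε * (conj (q.1 * Complex.exp (k * q.2)) * (q.1 * Complex.exp (k * q.2))) =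
        ((Real.exp (-(ε * q.2.im)) * (1 + ε * ‖q.1‖ ^ 2) : ℝ) : ℂ) := by
      rw [map_mul]
      push_cast at h2 ⊢
      rw [← h2]
      push_cast at hnorm
      linear_combination (1 + ε * (q.1 * conj q.1)) * hnorm q
    rw [this]
    norm_cast
  refine ⟨(Complex.exp (k * p.2), p.1 * Complex.exp (k * p.2)), (hmem p).2 hp, ?_⟩
  refine HoloHomothetic.of_inverse (κ := ε / 2) (div_ne_zero hε0 two_ne_zero)
    (U := {q | |(q.2 - p.2).re| < 2 * Real.pi})
    (U' := {q | q.1 * Complex.exp (-(k * p.2)) ∈ Complex.slitPlane})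
    (F := fun q => (Complex.exp (k * q.2), q.1 * Complex.exp (k * q.2)))
    (G := fun q => (q.2 * q.1⁻¹, k⁻¹ * Complex.log (q.1 * Complex.exp (-(k * p.2))) + p.2))
    (isOpen_lt (by fun_prop) continuous_const)
    (Complex.isOpen_slitPlane.preimage hc.continuous) (hF.prodMk (contDiff_fst.mul hF)).contDiffOn
    ?_ ?_ ?_ ?_ ?_ ?_ hp rfl (fun q _ => hmem q) ?_
  · refine (contDiff_snd.contDiffOn.mul (contDiff_fst.contDiffOn.inv fun q hq h0 => ?_)).prodMk
      ((contDiff_const.contDiffOn.mul ?_).add contDiff_const.contDiffOn)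
    · have hq : q.1 * Complex.exp (-(k * p.2)) ∈ Complex.slitPlane := hq
      rw [h0, zero_mul] at hq
      exact Complex.slitPlane_ne_zero hq rfl
    · exact fun q hq => (ContDiffAt.comp (g := Complex.log) q
        (Complex.contDiffAt_log hq) hc.contDiffAt).contDiffWithinAt
  · intro q hq
    exact (hslit q hq).2
  · intro q hq
    have hq : q.1 * Complex.exp (-(k * p.2)) ∈ Complex.slitPlane := hq
    change |(k⁻¹ * Complex.log _ + p.2 - p.2).re| < _
    rw [add_sub_cancel_right]
    have h1 := hkim (k⁻¹ * Complex.log (q.1 * Complex.exp (-(k * p.2))))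
    rw [mul_inv_cancel_left₀ hk0, Complex.log_im] at h1
    have h2 := congrArg abs h1
    rw [abs_div, abs_mul, hε1, one_mul, abs_two] at h2
    have h3 := (Complex.mem_slitPlane_iff_arg.1 hq).1
    have h4 := abs_lt.2 ⟨Complex.neg_pi_lt_arg (q.1 * Complex.exp (-(k * p.2))),
      lt_of_le_of_ne (Complex.arg_le_pi _) h3⟩
    linarith
  · intro q hq
    refine Prod.ext ?_ ?_ <;> simp only
    · rw [mul_inv_cancel_right₀ (Complex.exp_ne_zero _)]
    · rw [(hslit q hq).1, inv_mul_cancel_left₀ hk0, sub_add_cancel]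
  · intro q hq
    have hq : q.1 * Complex.exp (-(k * p.2)) ∈ Complex.slitPlane := hq
    have h0 := Complex.slitPlane_ne_zero hq
    have h1 : Complex.exp (k * (k⁻¹ * Complex.log (q.1 * Complex.exp (-(k * p.2))) + p.2)) =
        q.1 := by
      rw [mul_add, mul_inv_cancel_left₀ hk0, Complex.exp_add, Complex.exp_log h0, mul_assoc,
        ← Complex.exp_add, neg_add_cancel, Complex.exp_zero, mul_one]
    refine Prod.ext ?_ ?_ <;> simp only [h1]
    rw [inv_mul_cancel_right₀ (left_ne_zero_of_mul h0)]
  · simp [Real.pi_pos]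
  · intro q _ _
    have e1 := ((hasFDerivAt_snd_complex q).const_mul k).cexp
    refine ⟨_, e1.prodMk ((hasFDerivAt_fst_complex q).mul e1), ?_⟩
    refine Prod.ext ?_ ?_ <;> simp [rigidField, standardField, hk] <;> ring

theorem heisenberg_locallyHomothetic_quadric {ε s τ : ℝ} (hε : ε * ε = 1) (hs : s ≠ 0)
    (hτ : ε * s ^ 2 = τ)
    (ht : ∀ p ∈ heisenbergSphere, reebField τ 0 (τ ^ 2) p ∈ realTangent heisenbergSphere p) :
    (∀ p ∈ rigidSphere ε, LocallyHomothetic heisenbergSphere (reebField τ 0 (τ ^ 2)) 0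
      (rigidSphere ε) rigidField p) ∧
    (∀ p ∈ quadric ε, LocallyHomothetic heisenbergSphere (reebField τ 0 (τ ^ 2)) 0
      (quadric ε) standardField p) := by
  have h1 := heisenberg_quadric hε hs hτ
  refine ⟨fun p hp => ?_, fun p hp => ?_⟩
  · obtain ⟨q, hq, h2⟩ := rigidSphere_quadric hε hp
    exact ((h1.trans (quadric_homogeneous hε hq)).trans h2.symm).locallyHomothetic ht
  · exact (h1.trans (quadric_homogeneous hε hp)).locallyHomothetic ht

end

/-! ### Infinitesimal CR automorphisms of the Heisenberg sphere as quadratic polynomial fields. -/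

noncomputable section

open smoothFunctions

variable {M O U : Set C2} {π : C2 → C2} {X Y Z : C2 → C2}

/-- Infinitesimal CR automorphisms of the Heisenberg sphere are the tangent fields with CR
components. -/
theorem isInfCRAut_heisenberg_iff (hU : IsOpen U) :
    IsInfCRAut (heisenbergSphere ∩ U) X ↔ IsTangentField (heisenbergSphere ∩ U) X ∧
      ∀ p ∈ heisenbergSphere ∩ U,
        fderivWithin ℝ X (heisenbergSphere ∩ U) p (Complex.I • heisenbergFrame p) =
          Complex.I • fderivWithin ℝ X (heisenbergSphere ∩ U) p (heisenbergFrame p) := by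
  have h := heisenbergSphere_retract.inter hU
  have hE := heisenbergFrame_mem.inter hU
  have hsmul : ∀ {Y : C2 → C2}, IsCplxTangentField (heisenbergSphere ∩ U) Y →
      ∀ p ∈ heisenbergSphere ∩ U, ∀ v ∈ realTangent (heisenbergSphere ∩ U) p,
      fderivWithin ℝ (fun q => Complex.I • Y q) (heisenbergSphere ∩ U) p v =
        Complex.I • fderivWithin ℝ Y (heisenbergSphere ∩ U) p v := by
    intro Y hY p hp v hv
    have h1 := (h.hasFDerivWithinAt hY.1 hp)
    have h2 : HasFDerivWithinAt (fun q => Complex.I • Y q) _ _ p := h1.const_smul Complex.I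
    rw [h2.fderivWithin_apply_of_mem_realTangent hv,
      h1.fderivWithin_apply_of_mem_realTangent hv]
    rfl
  constructor
  · rintro ⟨hX, hY⟩
    refine ⟨hX, fun p hp => ?_⟩
    have := (hY _ hE p hp).2
    rw [VectorField.lieBracketWithin, VectorField.lieBracketWithin, hsmul hE p hp _ (hX.2 p hp),
      smul_sub, sub_right_inj] at this
    exact this
  · rintro ⟨hX, hI⟩
    -- `H` is complex one-dimensional, so `Y p` is a complex multiple of the frame vector. Complex
    -- linearity of `dX` on the frame then gives `[X, iY] = i[X, Y]`, and since both brackets are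
    -- tangent, `[X, Y]` lies in `H`.
    refine ⟨hX, fun Y hY p hp => ?_⟩
    have hYE : Y p = (Y p).1.re • heisenbergFrame p +
        (Y p).1.im • Complex.I • heisenbergFrame p := by
      have h1 := hY.2 p hp
      rw [cplxTangent_inter hU hp.2, mem_cplxTangent_heisenbergSphere hp.1] at h1
      rw [show ∀ (a b : ℝ) (x : C2), a • x + b • Complex.I • x = ((a : ℂ) + b * Complex.I) • x by
        intro a b x; rw [add_smul, mul_smul]; rfl, Complex.re_add_im]
      refine Prod.ext ?_ ?_
      · simp [heisenbergFrame]
      · rw [h1]; simp [heisenbergFrame]; ring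
    have e1 : VectorField.lieBracketWithin ℝ X (fun q => Complex.I • Y q)
        (heisenbergSphere ∩ U) p =
        Complex.I • VectorField.lieBracketWithin ℝ X Y (heisenbergSphere ∩ U) p := by
      rw [VectorField.lieBracketWithin, VectorField.lieBracketWithin, hsmul hY p hp _ (hX.2 p hp),
        smul_sub, hYE]
      simp only [smul_add, map_add, smul_comm Complex.I (_ : ℝ), map_smul, hI p hp]
      rw [smul_smul Complex.I Complex.I, Complex.I_mul_I]
      simp [smul_smul]
    refine ⟨⟨h.lieBracketWithin_mem hX hY.tangent hp, ?_⟩, e1⟩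
    rw [← e1]
    exact h.lieBracketWithin_mem hX hY.tangent_I hp

/-- The polynomial fields that generate the CR automorphisms of the Heisenberg sphere. -/
def crField (α β a : ℂ) (r t : ℝ) (p : C2) : C2 :=
  (α + β * p.1 + a * p.2 + 2 * Complex.I * conj a * p.1 ^ 2 + r * p.1 * p.2,
    t + 2 * Complex.I * conj α * p.1 + (β + conj β) * p.2 + 2 * Complex.I * conj a * p.1 * p.2 +
      r * p.2 ^ 2)

theorem reebField_eq_crField (τ : ℝ) (a : ℂ) (ρ : ℝ) :
    reebField τ a ρ = crField 0 (Complex.I * τ) a ρ 1 := by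
  funext p
  simp only [reebField, crField, map_mul, Complex.conj_I, Complex.conj_ofReal]
  refine Prod.ext ?_ ?_ <;> simp

variable {α β a : ℂ} {r t : ℝ}

/-- The differential of a polynomial field. -/
theorem crField_hasFDerivAt (α β a : ℂ) (r t : ℝ) (p : C2) :
    ∃ D : C2 →L[ℂ] C2, HasFDerivAt (crField α β a r t) D p ∧ ∀ v : C2, D v =
      ((β + 4 * Complex.I * conj a * p.1 + r * p.2) * v.1 + (a + r * p.1) * v.2,
        (2 * Complex.I * conj α + 2 * Complex.I * conj a * p.2) * v.1 +
          (β + conj β + 2 * Complex.I * conj a * p.1 + 2 * r * p.2) * v.2) := by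
  have h1 := hasFDerivAt_fst_complex p
  have h2 := hasFDerivAt_snd_complex p
  refine ⟨_, (((((h1.const_mul β).const_add α).add (h2.const_mul a)).add
    ((h1.pow 2).const_mul (2 * Complex.I * conj a))).add ((h1.const_mul (r : ℂ)).mul h2)).prodMk
    (((((h1.const_mul (2 * Complex.I * conj α)).const_add (t : ℂ)).add
      (h2.const_mul (β + conj β))).add ((h1.const_mul (2 * Complex.I * conj a)).mul h2)).add
      ((h2.pow 2).const_mul (r : ℂ))), fun v => ?_⟩
  refine Prod.ext ?_ ?_ <;> simp <;> ring

theorem crField_contDiff (α β a : ℂ) (r t : ℝ) : ContDiff ℝ ∞ (crField α β a r t) := by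
  have h1 : ContDiff ℝ ∞ (fun q : C2 => q.1) := contDiff_fst
  have h2 : ContDiff ℝ ∞ (fun q : C2 => q.2) := contDiff_snd
  unfold crField
  fun_prop

theorem crField_mem_realTangent {p : C2} (hp : p ∈ heisenbergSphere) :
    crField α β a r t p ∈ realTangent heisenbergSphere p := by
  rw [mem_realTangent_heisenbergSphere hp]
  rw [mem_heisenbergSphere_iff] at hp
  have key : (crField α β a r t p).2 - conj (crField α β a r t p).2 = 2 * Complex.I *
      (conj p.1 * (crField α β a r t p).1 + conj (conj p.1 * (crField α β a r t p).1)) := by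
    simp only [crField, map_add, map_mul, map_pow, Complex.conj_I, Complex.conj_conj,
      Complex.conj_ofReal, map_ofNat]
    linear_combination (β + conj β - 2 * Complex.I * a * conj p.1 + 2 * Complex.I * conj a * p.1 +
      r * (p.2 + conj p.2)) * hp
  rw [Complex.sub_conj, Complex.add_conj] at key
  have : Complex.I * ((2 * (crField α β a r t p).2.im : ℝ) : ℂ) =
      Complex.I * ((2 * (2 * (conj p.1 * (crField α β a r t p).1).re) : ℝ) : ℂ) := by
    rw [mul_comm, key]; push_cast; ring
  have h2 := Complex.ofReal_injective (mul_left_cancel₀ Complex.I_ne_zero this)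
  linarith

theorem crField_isTangentField (hU : IsOpen U) :
    IsTangentField (heisenbergSphere ∩ U) (crField α β a r t) :=
  IsTangentField.inter ⟨(crField_contDiff α β a r t).contDiffOn,
    fun _ hp => crField_mem_realTangent hp⟩ hU

theorem IsInfCRAut.congr (hX : IsInfCRAut M X) (h : Set.EqOn Y X M) : IsInfCRAut M Y := by
  refine ⟨⟨hX.1.1.congr h, fun p hp => h hp ▸ hX.1.2 p hp⟩, fun W hW p hp => ?_⟩
  simp only [VectorField.lieBracketWithin, h hp, fderivWithin_congr h (h hp)]
  exact hX.2 W hW p hp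

theorem crField_isInfCRAut (hU : IsOpen U) :
    IsInfCRAut (heisenbergSphere ∩ U) (crField α β a r t) := by
  rw [isInfCRAut_heisenberg_iff hU]
  refine ⟨crField_isTangentField hU, fun p hp => ?_⟩
  have hE := (heisenbergFrame_mem.inter hU).2 p hp
  obtain ⟨D, hD, -⟩ := crField_hasFDerivAt α β a r t p
  have h1 := (hD.restrictScalars ℝ).hasFDerivWithinAt (s := heisenbergSphere ∩ U)
  rw [h1.fderivWithin_apply_of_mem_realTangent hE.1, h1.fderivWithin_apply_of_mem_realTangent hE.2]
  exact D.map_smul _ _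

/-- Infinitesimal CR automorphisms are, locally, the polynomial fields. -/
theorem IsInfCRAut.exists_coefficients (hU : IsOpen U) (hX : IsInfCRAut (heisenbergSphere ∩ U) X) :
    ∃ α β a r t : (heisenbergSphere ∩ U : Set C2) → ℂ, IsLocallyConstant α ∧ IsLocallyConstant β ∧
      IsLocallyConstant a ∧ IsLocallyConstant r ∧ IsLocallyConstant t ∧
      ∀ p (hp : p ∈ heisenbergSphere ∩ U),
        X p = crField (α ⟨p, hp⟩) (β ⟨p, hp⟩) (a ⟨p, hp⟩) (r ⟨p, hp⟩).re (t ⟨p, hp⟩).re p := by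
  have h := heisenbergSphere_retract.inter hU
  have hE := heisenbergFrame_mem.inter hU
  have hfr := heisenberg_isHeisenbergFrame hU
  obtain ⟨hXt, hI⟩ := (isInfCRAut_heisenberg_iff hU).1 hX
  obtain ⟨h1, h2⟩ := h.delbar_component hE hXt.1 hI
  obtain ⟨α, β, a, r, t, hα, hβ, ha, hr, ht, hrs, hts, e1, e2⟩ := hfr.exists_coefficients h1 h2 (by
    refine smoothFunctions.ext fun p => ?_
    have hp := hXt.2 p p.2
    rw [realTangent_inter hU p.2.2, mem_realTangent_heisenbergSphere p.2.1] at hp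
    change (X p).2 - conj (X p).2 = 2 * Complex.I * (conj p.1.1 * (X p).1 + p.1.1 * conj (X p).1)
    have h3 : p.1.1 * conj (X p).1 = conj (conj p.1.1 * (X p).1) := by simp
    rw [Complex.sub_conj, h3, Complex.add_conj, hp]
    push_cast; ring)
  refine ⟨α.1, β.1, a.1, r.1, t.1, heisenberg_isLocallyConstant hU hα.1 hα.2,
    heisenberg_isLocallyConstant hU hβ.1 hβ.2, heisenberg_isLocallyConstant hU ha.1 ha.2,
    heisenberg_isLocallyConstant hU hr.1 hr.2, heisenberg_isLocallyConstant hU ht.1 ht.2,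
    fun p hp => ?_⟩
  have hr' : (((r.1 ⟨p, hp⟩).re : ℝ) : ℂ) = r.1 ⟨p, hp⟩ :=
    Complex.conj_eq_iff_re.1 (congrArg (fun G : smoothFunctions _ => G.1 ⟨p, hp⟩) hrs)
  have ht' : (((t.1 ⟨p, hp⟩).re : ℝ) : ℂ) = t.1 ⟨p, hp⟩ :=
    Complex.conj_eq_iff_re.1 (congrArg (fun G : smoothFunctions _ => G.1 ⟨p, hp⟩) hts)
  rw [crField, hr', ht']
  exact Prod.ext (congrArg (fun G : smoothFunctions _ => G.1 ⟨p, hp⟩) e1)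
    (congrArg (fun G : smoothFunctions _ => G.1 ⟨p, hp⟩) e2)

theorem IsInfCRAut.exists_eq_crField (hU : IsOpen U) (hc : IsConnected (heisenbergSphere ∩ U))
    (hX : IsInfCRAut (heisenbergSphere ∩ U) X) :
    ∃ (α β a : ℂ) (r t : ℝ), Set.EqOn X (crField α β a r t) (heisenbergSphere ∩ U) := by
  obtain ⟨α, β, a, r, t, hα, hβ, ha, hr, ht, h⟩ := hX.exists_coefficients hU
  obtain ⟨α', hα'⟩ := hα.exists_apply_eq hc
  obtain ⟨β', hβ'⟩ := hβ.exists_apply_eq hc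
  obtain ⟨a', ha'⟩ := ha.exists_apply_eq hc
  obtain ⟨r', hr'⟩ := hr.exists_apply_eq hc
  obtain ⟨t', ht'⟩ := ht.exists_apply_eq hc
  exact ⟨α', β', a', r'.re, t'.re, fun p hp => by rw [h p hp, hα', hβ', ha', hr', ht']⟩

/-- Without connectedness the coefficients are only locally constant. They are frozen on a
neighbourhood where all five keep their values at `p`. -/
theorem IsInfCRAut.exists_nhds_eq_crField (hU : IsOpen U)
    (hX : IsInfCRAut (heisenbergSphere ∩ U) X) {p : C2} (hp : p ∈ heisenbergSphere ∩ U) :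
    ∃ (α β a : ℂ) (r t : ℝ) (V : Set C2), IsOpen V ∧ p ∈ V ∧ V ⊆ U ∧
      Set.EqOn X (crField α β a r t) (heisenbergSphere ∩ V) := by
  obtain ⟨α, β, a, r, t, hα, hβ, ha, hr, ht, h⟩ := hX.exists_coefficients hU
  have hl := hα.prodMk (hβ.prodMk (ha.prodMk (hr.prodMk ht)))
  obtain ⟨W, hW, hWe⟩ := isOpen_induced_iff.1 (hl {(α ⟨p, hp⟩, β ⟨p, hp⟩, a ⟨p, hp⟩, r ⟨p, hp⟩,
    t ⟨p, hp⟩)})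
  have hmem (q : C2) (hq : q ∈ heisenbergSphere ∩ U) : q ∈ W ↔ _ :=
    Set.ext_iff.1 hWe ⟨q, hq⟩
  refine ⟨α ⟨p, hp⟩, β ⟨p, hp⟩, a ⟨p, hp⟩, (r ⟨p, hp⟩).re, (t ⟨p, hp⟩).re, W ∩ U, hW.inter hU,
    ⟨(hmem p hp).2 rfl, hp.2⟩, Set.inter_subset_right, fun q hq => ?_⟩
  have h1 := (hmem q ⟨hq.1, hq.2.2⟩).1 hq.2.1
  simp only [Set.mem_preimage, Set.mem_singleton_iff, Prod.mk.injEq] at h1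
  obtain ⟨e1, e2, e3, e4, e5⟩ := h1
  rw [h q ⟨hq.1, hq.2.2⟩, e1, e2, e3, e4, e5]

/-- A polynomial field that vanishes on a non-empty open subset has vanishing coefficients. -/
theorem crField_coefficients_eq_zero (hU : IsOpen U) (hne : (heisenbergSphere ∩ U).Nonempty)
    (h0 : ∀ p ∈ heisenbergSphere ∩ U, crField α β a r t p = 0) :
    α = 0 ∧ β = 0 ∧ a = 0 ∧ r = 0 ∧ t = 0 := by
  have hfr := heisenberg_isHeisenbergFrame hU
  obtain ⟨q, hq⟩ := hne
  have hc (c : ℂ) (D : Derivation ℂ (smoothFunctions (heisenbergSphere ∩ U))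
    (smoothFunctions (heisenbergSphere ∩ U))) : D (algebraMap ℂ _ c) = 0 := D.map_algebraMap c
  obtain ⟨e1, e2, e3, e4, e5⟩ := hfr.coefficients_eq_zero
    (α := algebraMap ℂ _ α) (β := algebraMap ℂ _ β) (a := algebraMap ℂ _ a)
    (r := algebraMap ℂ _ (r : ℂ)) (t := algebraMap ℂ _ (t : ℂ))
    ⟨hc _ _, hc _ _⟩ ⟨hc _ _, hc _ _⟩ ⟨hc _ _, hc _ _⟩ ⟨hc _ _, hc _ _⟩
    (smoothFunctions.ext fun p => congrArg Prod.fst (h0 p p.2))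
    (smoothFunctions.ext fun p => congrArg Prod.snd (h0 p p.2))
  have key {c : ℂ} (h : algebraMap ℂ (smoothFunctions (heisenbergSphere ∩ U)) c = 0) : c = 0 :=
    congrArg (fun G : smoothFunctions _ => G.1 ⟨q, hq⟩) h
  exact ⟨key e1, key e2, key e3, by exact_mod_cast key e4, by exact_mod_cast key e5⟩

end

/-! ### The Lie algebra of coefficients and the centralizer of the Reeb field. -/

noncomputable section

variable {U : Set C2}

/-- The coefficients `(α, β, a, r, t)` of a polynomial field `crField α β a r t`. -/
abbrev CRCoeff : Type := ℂ × ℂ × ℂ × ℝ × ℝ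

namespace CRCoeff

/-- The polynomial field with given coefficients. -/
def field (c : CRCoeff) : C2 → C2 := crField c.1 c.2.1 c.2.2.1 c.2.2.2.1 c.2.2.2.2

/-- The coefficients of the Lie bracket of two polynomial fields. -/
def bracket (c d : CRCoeff) : CRCoeff :=
  (d.2.1 * c.1 + d.2.2.1 * c.2.2.2.2 - c.2.1 * d.1 - c.2.2.1 * d.2.2.2.2,
    4 * Complex.I * (conj d.2.2.1 * c.1 - conj c.2.2.1 * d.1) +
      2 * Complex.I * (d.2.2.1 * conj c.1 - c.2.2.1 * conj d.1) +
      d.2.2.2.1 * c.2.2.2.2 - c.2.2.2.1 * d.2.2.2.2,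
    d.2.2.1 * conj c.2.1 - c.2.2.1 * conj d.2.1 + d.2.2.2.1 * c.1 - c.2.2.2.1 * d.1,
    -4 * (conj d.2.2.1 * c.2.2.1).im + 2 * d.2.2.2.1 * c.2.1.re - 2 * c.2.2.2.1 * d.2.1.re,
    -4 * (conj d.1 * c.1).im + 2 * d.2.1.re * c.2.2.2.2 - 2 * c.2.1.re * d.2.2.2.2)

theorem field_zero : field 0 = 0 := by
  funext p; simp [field, crField]

theorem zero_bracket (c : CRCoeff) : bracket 0 c = 0 := by
  simp [bracket]

theorem bracket_zero (c : CRCoeff) : bracket c 0 = 0 := by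
  simp [bracket]

/-- This is what closes a centralizer under brackets: if `c` and `d` commute with `e`, both terms on
the right vanish. -/
theorem jacobi (c d e : CRCoeff) :
    bracket (bracket c d) e = bracket (bracket c e) d + bracket c (bracket d e) := by
  obtain ⟨⟨c1, c2⟩, ⟨c3, c4⟩, ⟨c5, c6⟩, c7, c8⟩ := c
  obtain ⟨⟨d1, d2⟩, ⟨d3, d4⟩, ⟨d5, d6⟩, d7, d8⟩ := d
  obtain ⟨⟨e1, e2⟩, ⟨e3, e4⟩, ⟨e5, e6⟩, e7, e8⟩ := e
  refine Prod.ext (Complex.ext ?_ ?_) (Prod.ext (Complex.ext ?_ ?_)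
    (Prod.ext (Complex.ext ?_ ?_) (Prod.ext ?_ ?_))) <;> simp [bracket] <;> ring

theorem fderiv_field_sub (c d : CRCoeff) (p : C2) {D D' : C2 →L[ℂ] C2}
    (hD : HasFDerivAt c.field D p) (hD' : HasFDerivAt d.field D' p) :
    D' (c.field p) - D (d.field p) = (bracket c d).field p := by
  obtain ⟨E, hE, h1⟩ := crField_hasFDerivAt c.1 c.2.1 c.2.2.1 c.2.2.2.1 c.2.2.2.2 p
  obtain ⟨E', hE', h2⟩ := crField_hasFDerivAt d.1 d.2.1 d.2.2.1 d.2.2.2.1 d.2.2.2.2 p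
  rw [hD.unique hE, hD'.unique hE', h1, h2]
  -- Real and imaginary parts are written through conjugates, which makes the claim a polynomial
  -- identity in independent variables.
  have him (x : ℂ) : (x.im : ℂ) = -Complex.I / 2 * (x - conj x) := by
    rw [Complex.sub_conj]; push_cast; linear_combination (x.im : ℂ) * Complex.I_sq
  have hre (x : ℂ) : (x.re : ℂ) = (x + conj x) / 2 := by
    rw [Complex.add_conj]; push_cast; ring
  refine Prod.ext ?_ ?_
  · simp only [field, crField, bracket, Prod.fst_sub, map_add, map_sub, map_mul, Complex.conj_conj,
      Complex.conj_ofReal, Complex.ofReal_add, Complex.ofReal_sub, Complex.ofReal_mul, him, hre,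
      Complex.ofReal_neg, Complex.ofReal_ofNat]
    ring
  · simp only [field, crField, bracket, Prod.snd_sub, map_add, map_sub, map_mul, Complex.conj_conj,
      Complex.conj_ofReal, Complex.ofReal_add, Complex.ofReal_sub, Complex.ofReal_mul, him, hre,
      Complex.ofReal_neg, Complex.ofReal_ofNat, Complex.conj_I, map_ofNat]
    ring

theorem lieBracketWithin_field (hU : IsOpen U) (c d : CRCoeff) {p : C2}
    (hp : p ∈ heisenbergSphere ∩ U) :
    VectorField.lieBracketWithin ℝ c.field d.field (heisenbergSphere ∩ U) p =
      (bracket c d).field p := by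
  obtain ⟨E, hE, -⟩ := crField_hasFDerivAt c.1 c.2.1 c.2.2.1 c.2.2.2.1 c.2.2.2.2 p
  obtain ⟨E', hE', -⟩ := crField_hasFDerivAt d.1 d.2.1 d.2.2.1 d.2.2.2.1 d.2.2.2.2 p
  rw [← fderiv_field_sub c d p hE hE']
  exact (crField_isTangentField hU).lieBracketWithin_eq (crField_isTangentField hU) hp
    (hE.restrictScalars ℝ) (hE'.restrictScalars ℝ)

/-- The polynomial field with given coefficients, restricted to `M`. -/
def restrictedField (M : Set C2) : CRCoeff →ₗ[ℝ] (C2 → C2) where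
  toFun c := M.indicator c.field
  map_add' c d := by
    rw [← Set.indicator_add']
    congr 1
    funext p
    refine Prod.ext ?_ ?_ <;> simp [field, crField] <;> ring
  map_smul' x c := by
    funext p
    by_cases hp : p ∈ M
    · refine Prod.ext ?_ ?_ <;> simp [field, crField, hp] <;> ring
    · simp [hp]

theorem restrictedField_eqOn (M : Set C2) (c : CRCoeff) :
    Set.EqOn (restrictedField M c) c.field M :=
  fun _ hp => Set.indicator_of_mem hp _

theorem eq_zero_of_field (hU : IsOpen U) (hne : (heisenbergSphere ∩ U).Nonempty) {c : CRCoeff}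
    (h : ∀ p ∈ heisenbergSphere ∩ U, c.field p = 0) : c = 0 := by
  obtain ⟨h1, h2, h3, h4, h5⟩ := crField_coefficients_eq_zero hU hne h
  exact Prod.ext h1 (Prod.ext h2 (Prod.ext h3 (Prod.ext h4 h5)))

theorem restrictedField_injective (hU : IsOpen U) (hne : (heisenbergSphere ∩ U).Nonempty) :
    Function.Injective (restrictedField (heisenbergSphere ∩ U)) := by
  rw [injective_iff_map_eq_zero]
  intro c hc
  refine eq_zero_of_field hU hne fun p hp => ?_
  rw [← restrictedField_eqOn _ c hp, hc]; rfl

theorem lieBracketWithin_congr {M : Set C2} {X X' Y Y' : C2 → C2} (hX : Set.EqOn X X' M)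
    (hY : Set.EqOn Y Y' M) {p : C2} (hp : p ∈ M) :
    VectorField.lieBracketWithin ℝ X Y M p = VectorField.lieBracketWithin ℝ X' Y' M p := by
  rw [VectorField.lieBracketWithin, VectorField.lieBracketWithin, hX hp, hY hp,
    fderivWithin_congr hX (hX hp), fderivWithin_congr hY (hY hp)]

/-- The dimension of the Sasakian automorphism algebra is that of the centralizer. -/
theorem hasDim {Q : Type*} [AddCommGroup Q] [Module ℝ Q] [Module.Finite ℝ Q] (hU : IsOpen U)
    (hc : IsConnected (heisenbergSphere ∩ U)) (e : CRCoeff) (j : Q →ₗ[ℝ] CRCoeff)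
    (hj : Function.Injective j) (hjr : ∀ c, bracket c e = 0 ↔ c ∈ LinearMap.range j) :
    SasakiAutAlgebraHasDim (heisenbergSphere ∩ U) e.field (Module.finrank ℝ Q) := by
  set M := heisenbergSphere ∩ U with hM
  have hmem : ∀ X : C2 → C2, X ∈ LinearMap.range (restrictedField M ∘ₗ j) ↔
      ∃ c, bracket c e = 0 ∧ X = restrictedField M c := by
    intro X
    constructor
    · rintro ⟨q, rfl⟩
      exact ⟨j q, (hjr _).2 ⟨q, rfl⟩, rfl⟩
    · rintro ⟨c, h, rfl⟩
      obtain ⟨q, rfl⟩ := (hjr _).1 h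
      exact ⟨q, rfl⟩
  refine ⟨LinearMap.range (restrictedField M ∘ₗ j), fun X => ?_, fun X hX Y hY => ?_, inferInstance,
    LinearMap.finrank_range_of_inj ((restrictedField_injective hU hc.nonempty).comp hj)⟩
  · rw [hmem]
    constructor
    · rintro ⟨c, h, rfl⟩
      refine ⟨⟨(crField_isInfCRAut hU).congr (restrictedField_eqOn M c), fun p hp => ?_⟩,
        fun p hp => Set.indicator_of_notMem hp _⟩
      rw [lieBracketWithin_congr (restrictedField_eqOn M c) (fun _ _ => rfl) hp,
        lieBracketWithin_field hU c e hp, h, field_zero]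
      rfl
    · rintro ⟨⟨h1, h2⟩, h3⟩
      obtain ⟨α, β, a, r, t, h⟩ := h1.exists_eq_crField hU hc
      have h' : Set.EqOn X (field (α, β, a, r, t)) M := h
      refine ⟨(α, β, a, r, t), ?_, ?_⟩
      -- The bracket of polynomial fields is again a polynomial field, so its vanishing on the open
      -- piece forces its coefficients to vanish.
      · refine eq_zero_of_field hU hc.nonempty fun p hp => ?_
        rw [← lieBracketWithin_field hU _ e hp, ← lieBracketWithin_congr h' (fun _ _ => rfl) hp]
        exact h2 p hp
      · funext p
        by_cases hp : p ∈ M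
        · rw [h' hp, restrictedField_eqOn M _ hp]
        · rw [h3 p hp]
          exact (Set.indicator_of_notMem hp _).symm
  · rw [hmem] at hX hY ⊢
    obtain ⟨c, h1, rfl⟩ := hX
    obtain ⟨d, h2, rfl⟩ := hY
    refine ⟨bracket c d, by rw [jacobi, h1, h2, zero_bracket, bracket_zero, add_zero], ?_⟩
    refine Set.indicator_congr fun p hp => ?_
    rw [lieBracketWithin_congr (restrictedField_eqOn M c) (restrictedField_eqOn M d) hp,
      lieBracketWithin_field hU c d hp]

/-- The coefficients of `reebField`. -/
def reeb (τ : ℝ) (a : ℂ) (ρ : ℝ) : CRCoeff := (0, Complex.I * τ, a, ρ, 1)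

theorem field_reeb (τ : ℝ) (a : ℂ) (ρ : ℝ) : (reeb τ a ρ).field = reebField τ a ρ := by
  rw [reebField_eq_crField]; rfl

/-- Written this way, the first two equations determine the third and fourth coefficients from `α`
and `t`. The centralizer is then parametrized by `α`, `Im β` and `t`, subject to the third and
fourth equations and to reality in the second. -/
theorem bracket_reeb_eq_zero_iff (τ : ℝ) (a : ℂ) (ρ : ℝ) (c : CRCoeff) :
    bracket c (reeb τ a ρ) = 0 ↔
      c.2.2.1 = Complex.I * τ * c.1 + a * c.2.2.2.2 ∧
      (c.2.2.2.1 : ℂ) = 4 * Complex.I * conj a * c.1 + 2 * Complex.I * a * conj c.1 +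
        ρ * c.2.2.2.2 ∧
      a * conj c.2.1 + Complex.I * τ * c.2.2.1 + ρ * c.1 = 0 ∧
      -2 * (conj a * c.2.2.1).im + ρ * c.2.1.re = 0 ∧ c.2.1.re = 0 := by
  simp only [bracket, reeb, Prod.mk_eq_zero, map_mul, Complex.conj_I, Complex.conj_ofReal, map_zero,
    mul_zero, Complex.ofReal_one, mul_one, sub_zero, Complex.zero_im, zero_mul]
  simp only [Complex.re_mul_ofReal, Complex.I_re, zero_mul, mul_zero, sub_zero, zero_add, zero_sub,
    neg_eq_zero]
  refine and_congr ⟨fun h => ?_, fun h => ?_⟩ (and_congr ⟨fun h => ?_, fun h => ?_⟩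
    (and_congr ⟨fun h => ?_, fun h => ?_⟩ (and_congr ⟨fun h => ?_, fun h => ?_⟩
      ⟨fun h => ?_, fun h => ?_⟩)))
  · linear_combination -h
  · linear_combination -h
  · linear_combination -h
  · linear_combination -h
  · linear_combination h
  · linear_combination h
  · linarith
  · linarith
  · linarith
  · linarith

end CRCoeff

open CRCoeff

theorem sasakiAutAlgebraHasDim_four (hU : IsOpen U) (hc : IsConnected (heisenbergSphere ∩ U))
    (τ : ℝ) : SasakiAutAlgebraHasDim (heisenbergSphere ∩ U) (reebField τ 0 (τ ^ 2)) 4 := by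
  -- For `a = 0` and `ρ = τ²` the third equation reads `(iτ)² α + τ² α = 0` and is void, so `α`, `Im
  -- β` and `t` are free.
  let j : ℂ × ℝ × ℝ →ₗ[ℝ] CRCoeff :=
    { toFun := fun q => (q.1, Complex.I * q.2.1, Complex.I * τ * q.1, τ ^ 2 * q.2.2, q.2.2)
      map_add' := fun q q' => by
        refine Prod.ext ?_ (Prod.ext ?_ (Prod.ext ?_ (Prod.ext ?_ ?_))) <;> simp <;> ring
      map_smul' := fun x q => by
        refine Prod.ext ?_ (Prod.ext ?_ (Prod.ext ?_ (Prod.ext ?_ ?_))) <;> simp <;> ring }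
  have := hasDim hU hc (reeb τ 0 (τ ^ 2)) j (fun q q' h => ?_) (fun c => ?_)
  · rw [field_reeb] at this
    simpa [Module.finrank_prod] using this
  · simp only [j, LinearMap.coe_mk, AddHom.coe_mk, Prod.mk.injEq] at h
    refine Prod.ext h.1 (Prod.ext ?_ h.2.2.2.2)
    simpa using h.2.1
  · rw [bracket_reeb_eq_zero_iff]
    obtain ⟨α, β, a, r, t⟩ := c
    simp only [LinearMap.mem_range, LinearMap.coe_mk, AddHom.coe_mk, j, Prod.mk.injEq]
    constructor
    · rintro ⟨h1, h2, -, -, h5⟩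
      simp only [map_zero, zero_mul, mul_zero, add_zero, zero_add] at h1 h2
      refine ⟨(α, β.im, t), rfl, ?_, h1.symm, ?_, rfl⟩
      · apply Complex.ext <;> simp [h5]
      · have : r = τ ^ 2 * t := by exact_mod_cast h2
        exact this.symm
    · rintro ⟨q, rfl, rfl, rfl, rfl, rfl⟩
      refine ⟨by simp, by simp, ?_, by simp, by simp⟩
      push_cast
      linear_combination τ ^ 2 * q.1 * Complex.I_sq

theorem sasakiAutAlgebraHasDim_two (hU : IsOpen U) (hc : IsConnected (heisenbergSphere ∩ U))
    {τ : ℝ} {a : ℂ} {ρ : ℝ} (h : ¬(a = 0 ∧ ρ = τ ^ 2)) :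
    SasakiAutAlgebraHasDim (heisenbergSphere ∩ U) (reebField τ a ρ) 2 := by
  by_cases ha : a = 0
  · have hρ : (ρ : ℂ) - τ ^ 2 ≠ 0 := fun h0 => h ⟨ha, by exact_mod_cast sub_eq_zero.1 h0⟩
    subst ha
    -- Now the third equation is `(ρ - τ²) α = 0`, which kills `α` and leaves `Im β` and `t`.
    let j : ℝ × ℝ →ₗ[ℝ] CRCoeff :=
      { toFun := fun q => (0, Complex.I * q.1, 0, ρ * q.2, q.2)
        map_add' := fun q q' => by
          refine Prod.ext ?_ (Prod.ext ?_ (Prod.ext ?_ (Prod.ext ?_ ?_))) <;> simp <;> ring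
        map_smul' := fun x q => by
          refine Prod.ext ?_ (Prod.ext ?_ (Prod.ext ?_ (Prod.ext ?_ ?_))) <;> simp <;> ring }
    have := hasDim hU hc (reeb τ 0 ρ) j (fun q q' h => ?_) (fun c => ?_)
    · rw [field_reeb] at this
      simpa [Module.finrank_prod] using this
    · simp only [j, LinearMap.coe_mk, AddHom.coe_mk, Prod.mk.injEq] at h
      refine Prod.ext ?_ h.2.2.2.2
      simpa using h.2.1
    · rw [bracket_reeb_eq_zero_iff]
      obtain ⟨α, β, a, r, t⟩ := c
      simp only [LinearMap.mem_range, LinearMap.coe_mk, AddHom.coe_mk, j, Prod.mk.injEq]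
      constructor
      · rintro ⟨h1, h2, h3, -, h5⟩
        simp only [map_zero, zero_mul, mul_zero, add_zero, zero_add] at h1 h2 h3
        have hα : α = 0 := by
          have : ((ρ : ℂ) - τ ^ 2) * α = 0 := by
            rw [h1] at h3
            linear_combination h3 - τ ^ 2 * α * Complex.I_sq
          exact (mul_eq_zero.1 this).resolve_left hρ
        refine ⟨(β.im, t), hα.symm, ?_, by rw [h1, hα, mul_zero], ?_, rfl⟩
        · apply Complex.ext <;> simp [h5]
        · have : r = ρ * t := by exact_mod_cast h2
          exact this.symm
      · rintro ⟨q, rfl, rfl, rfl, rfl, rfl⟩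
        simp
  -- For `a ≠ 0` reality in the second equation forces `α = i s a` with `s` real. Then `s` and `t`
  -- determine everything, because the third equation can be solved for `β`.
  · let j : ℝ × ℝ →ₗ[ℝ] CRCoeff :=
      { toFun := fun q => (Complex.I * q.1 * a, Complex.I * ((ρ - τ ^ 2) * q.1 + τ * q.2),
          (q.2 - τ * q.1) * a, -2 * Complex.normSq a * q.1 + ρ * q.2, q.2)
        map_add' := fun q q' => by
          refine Prod.ext ?_ (Prod.ext ?_ (Prod.ext ?_ (Prod.ext ?_ ?_))) <;> simp <;> ring
        map_smul' := fun x q => by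
          refine Prod.ext ?_ (Prod.ext ?_ (Prod.ext ?_ (Prod.ext ?_ ?_))) <;> simp <;> ring }
    have := hasDim hU hc (reeb τ a ρ) j (fun q q' h => ?_) (fun c => ?_)
    · rw [field_reeb] at this
      simpa [Module.finrank_prod] using this
    · simp only [j, LinearMap.coe_mk, AddHom.coe_mk, Prod.mk.injEq] at h
      refine Prod.ext ?_ h.2.2.2.2
      simpa [ha] using h.1
    · rw [bracket_reeb_eq_zero_iff]
      obtain ⟨α, β, b, r, t⟩ := c
      simp only [LinearMap.mem_range, LinearMap.coe_mk, AddHom.coe_mk, j, Prod.mk.injEq]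
      have hn : (Complex.normSq a : ℂ) = a * conj a := (Complex.mul_conj a).symm
      constructor
      · rintro ⟨h1, h2, h3, -, h5⟩
        -- For `α = u a` the imaginary part of `4i ā α + 2i a ᾱ` is `6 |a|² Re u`, and it must
        -- vanish because the fourth coefficient is real.
        have hre : (α / a).re = 0 := by
          have e1 : (4 * Complex.I * conj a * α + 2 * Complex.I * a * conj α +
            ρ * t : ℂ).im = 6 * (α / a).re * Complex.normSq a := by
            have e2 : α = α / a * a := by field_simp
            generalize α / a = u at e2
            subst e2
            simp [Complex.normSq_apply]
            ring
          rw [← h2, Complex.ofReal_im] at e1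
          have := Complex.normSq_pos.2 ha
          have e3 := mul_eq_zero.1 e1.symm
          rcases e3 with e3 | e3
          · linarith
          · exact absurd e3 this.ne'
        have hα : α = Complex.I * ((α / a).im : ℂ) * a := by
          have e2 : α / a = Complex.I * ((α / a).im : ℂ) := by
            apply Complex.ext <;> simp [hre]
          rw [← e2]; field_simp
        generalize (α / a).im = s at hα
        have hb : b = (t - τ * s) * a := by
          rw [h1, hα]; linear_combination (τ * s * a) * Complex.I_sq
        have hβ : conj β = -β := by
          apply Complex.ext <;> simp [h5]
        refine ⟨(s, t), hα.symm, ?_, hb.symm, ?_, rfl⟩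
        · rw [hβ, hb, hα] at h3
          refine mul_left_cancel₀ ha ?_
          linear_combination h3
        · have : (r : ℂ) = ((-2 * Complex.normSq a * s + ρ * t : ℝ) : ℂ) := by
            push_cast
            rw [h2, hn, hα]
            simp only [map_mul, Complex.conj_I, Complex.conj_ofReal]
            linear_combination (2 * s * a * conj a) * Complex.I_sq
          exact_mod_cast this.symm
      · rintro ⟨q, rfl, rfl, rfl, rfl, rfl⟩
        have hβ : (Complex.I * ((ρ - τ ^ 2) * q.1 + τ * q.2) : ℂ).re = 0 := by
          rw [show (Complex.I * ((ρ - τ ^ 2) * q.1 + τ * q.2) : ℂ) =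
            Complex.I * (((ρ - τ ^ 2) * q.1 + τ * q.2 : ℝ) : ℂ) by push_cast; ring,
            Complex.re_mul_ofReal, Complex.I_re, zero_mul]
        refine ⟨?_, ?_, ?_, ?_, ?_⟩
        · linear_combination -(τ * q.1 * a) * Complex.I_sq
        · push_cast
          rw [hn]
          simp only [map_mul, Complex.conj_I, Complex.conj_ofReal]
          linear_combination -(2 * q.1 * a * conj a) * Complex.I_sq
        · simp only [map_mul, map_add, map_sub, map_pow, Complex.conj_I, Complex.conj_ofReal]
          ring
        · have : conj a * ((q.2 - τ * q.1) * a) =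
            (((q.2 - τ * q.1) * Complex.normSq a : ℝ) : ℂ) := by
            push_cast; rw [hn]; ring
          rw [this, Complex.ofReal_im]
          rw [hβ]; simp
        · exact hβ

end

/-! ### Reduction of a Reeb field to normal form. -/

noncomputable section

/-- Heisenberg translations map polynomial fields to polynomial fields. -/
theorem holoHomothetic_translate (α β a : ℂ) (r t : ℝ) {p : C2} (hp : p ∈ heisenbergSphere) :
    ∃ (α' β' a' : ℂ) (r' t' : ℝ),
      HoloHomothetic heisenbergSphere (crField α β a r t) p heisenbergSphere
        (crField α' β' a' r' t') 0 ∧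
      (t' : ℂ) = (crField α β a r t p).2 - 2 * Complex.I * conj p.1 * (crField α β a r t p).1 := by
  obtain ⟨t', ht'⟩ : ∃ t' : ℝ, (t' : ℂ) =
      (crField α β a r t p).2 - 2 * Complex.I * conj p.1 * (crField α β a r t p).1 := by
    have h1 := (mem_realTangent_heisenbergSphere hp).1
      (crField_mem_realTangent (α := α) (β := β) (a := a) (r := r) (t := t) hp)
    refine ⟨_, Complex.conj_eq_iff_re.1 (Complex.conj_eq_iff_im.2 ?_)⟩
    rw [Complex.sub_im, h1]
    simp
    ring
  have hpc := mem_heisenbergSphere_iff.1 hp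
  -- These are the coefficients of the first component after substituting the inverse translation.
  -- Tangency and `t'` then account for the second component.
  refine ⟨α + β * p.1 + a * p.2 + 2 * Complex.I * conj a * p.1 ^ 2 + r * p.1 * p.2,
    β + 2 * Complex.I * a * conj p.1 + 4 * Complex.I * conj a * p.1 + r * p.2 +
      2 * Complex.I * r * (p.1 * conj p.1), a + r * p.1, r, t', ?_, ht'⟩
  have h1 : ContDiff ℂ ∞ (fun q : C2 => q.1) := contDiff_fst
  have h2 : ContDiff ℂ ∞ (fun q : C2 => q.2) := contDiff_snd
  refine HoloHomothetic.of_inverse (κ := 1) one_ne_zero isOpen_univ isOpen_univ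
    (F := fun q => (q.1 - p.1, q.2 - p.2 - 2 * Complex.I * conj p.1 * (q.1 - p.1)))
    (G := fun q => (q.1 + p.1, q.2 + p.2 + 2 * Complex.I * conj p.1 * q.1))
    ?_ ?_ (fun _ _ => trivial) (fun _ _ => trivial) (fun q _ => ?_) (fun q _ => ?_) trivial hp ?_
    (fun q _ => ?_) (fun q _ _ => ?_)
  · exact ContDiff.contDiffOn (by fun_prop)
  · exact ContDiff.contDiffOn (by fun_prop)
  · refine Prod.ext ?_ ?_ <;> simp only <;> ring
  · refine Prod.ext ?_ ?_ <;> simp only <;> ring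
  · simp
  · rw [mem_heisenbergSphere_iff, mem_heisenbergSphere_iff]
    simp only [map_sub, map_mul, map_ofNat, Complex.conj_I, Complex.conj_conj]
    constructor
    · intro h; linear_combination h + hpc
    · intro h; linear_combination h - hpc
  · refine ⟨_, ((hasFDerivAt_fst_complex q).sub_const p.1).prodMk
      (((hasFDerivAt_snd_complex q).sub_const p.2).sub
        (((hasFDerivAt_fst_complex q).sub_const p.1).const_mul (2 * Complex.I * conj p.1))), ?_⟩
    rw [one_smul]
    refine Prod.ext ?_ ?_
    · simp only [crField, ContinuousLinearMap.prod_apply, ContinuousLinearMap.coe_fst', map_add,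
        map_mul, Complex.conj_ofReal]
      ring
    · simp only [crField, ContinuousLinearMap.prod_apply, ContinuousLinearMap.coe_fst',
        ContinuousLinearMap.coe_snd', ht', sub_apply, smul_apply, smul_eq_mul, map_add,
        map_mul, map_pow, map_ofNat, Complex.conj_I, Complex.conj_conj, Complex.conj_ofReal]
      linear_combination (2 * Complex.I * (conj a + r * conj p.1) * (q.1 - p.1) +
        r * (q.2 - p.2 - 2 * Complex.I * conj p.1 * (q.1 - p.1))) * hpc

/-- The denominator of `projectiveMap`. -/
def projectiveDen (b : ℂ) (s : ℝ) (q : C2) : ℂ :=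
  1 - 2 * Complex.I * conj b * q.1 - (s + Complex.I * (b * conj b)) * q.2

/-- The projective automorphisms of the Heisenberg sphere that fix the origin and are unipotent. -/
def projectiveMap (b : ℂ) (s : ℝ) (q : C2) : C2 :=
  ((q.1 + b * q.2) * (projectiveDen b s q)⁻¹, q.2 * (projectiveDen b s q)⁻¹)

theorem projectiveDen_contDiff (b : ℂ) (s : ℝ) : ContDiff ℂ ∞ (projectiveDen b s) := by
  have h1 : ContDiff ℂ ∞ (fun q : C2 => q.1) := contDiff_fst
  have h2 : ContDiff ℂ ∞ (fun q : C2 => q.2) := contDiff_snd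
  unfold projectiveDen
  fun_prop

/-- The denominators of the maps with parameters `(b, s)` and `(-b, -s)` are reciprocal along the
map, which makes these two maps inverse to each other. -/
theorem projectiveDen_projectiveMap {b : ℂ} {s : ℝ} {q : C2} (hq : projectiveDen b s q ≠ 0) :
    projectiveDen (-b) (-s) (projectiveMap b s q) = (projectiveDen b s q)⁻¹ := by
  obtain ⟨D, hD⟩ : ∃ D, D = projectiveDen b s q := ⟨_, rfl⟩
  rw [projectiveMap, ← hD]
  rw [← hD] at hq
  rw [projectiveDen] at hD ⊢
  simp only [map_neg, Complex.ofReal_neg]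
  field_simp
  rw [hD]
  ring

theorem projectiveMap_projectiveMap {b : ℂ} {s : ℝ} {q : C2} (hq : projectiveDen b s q ≠ 0) :
    projectiveMap (-b) (-s) (projectiveMap b s q) = q := by
  rw [projectiveMap, projectiveDen_projectiveMap hq, inv_inv, projectiveMap]
  refine Prod.ext ?_ ?_ <;> simp only <;> field_simp
  ring

theorem projectiveMap_contDiffOn (b : ℂ) (s : ℝ) :
    ContDiffOn ℂ ∞ (projectiveMap b s) {q | projectiveDen b s q ≠ 0} := by
  have h := (projectiveDen_contDiff b s).contDiffOn.inv (s := {q | projectiveDen b s q ≠ 0})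
    fun q hq => hq
  exact ((contDiff_fst.add (contDiff_const.mul contDiff_snd)).contDiffOn.mul h).prodMk
    (contDiff_snd.contDiffOn.mul h)

theorem projectiveMap_mem_iff {b : ℂ} {s : ℝ} {q : C2} (hq : projectiveDen b s q ≠ 0) :
    projectiveMap b s q ∈ heisenbergSphere ↔ q ∈ heisenbergSphere := by
  obtain ⟨D, hD⟩ : ∃ D, D = projectiveDen b s q := ⟨_, rfl⟩
  obtain ⟨D', hD'⟩ : ∃ D', conj D = D' := ⟨_, rfl⟩
  rw [mem_heisenbergSphere_iff, mem_heisenbergSphere_iff, projectiveMap, ← hD]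
  rw [← hD] at hq
  have hq' : D' ≠ 0 := hD' ▸ (map_ne_zero (starRingEnd ℂ)).2 hq
  have hD2 : D' = 1 + 2 * Complex.I * b * conj q.1 - (s - Complex.I * (b * conj b)) * conj q.2 := by
    rw [← hD', hD, projectiveDen]
    simp only [map_sub, map_one, map_mul, map_add, map_ofNat, Complex.conj_I, Complex.conj_conj,
      Complex.conj_ofReal]
    ring
  rw [projectiveDen] at hD
  simp only [map_mul, map_inv₀, map_add, hD']
  constructor
  · intro h
    field_simp at h
    rw [hD, hD2] at h
    linear_combination h
  · intro h
    field_simp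
    rw [hD, hD2]
    linear_combination h

/-- Every field that is transversal at the origin is homothetic to one of the normal forms. -/
theorem holoHomothetic_normalForm (α β a : ℂ) (r : ℝ) :
    ∃ (τ : ℝ) (a' : ℂ) (ρ : ℝ),
      HoloHomothetic heisenbergSphere (crField α β a r 1) 0 heisenbergSphere
        (reebField τ a' ρ) 0 := by
  -- The differential of the projective map at the origin is `(z + b w, w)` and sends the value `(α,
  -- 1)` to `(α + b, 1)`, so `b = -α` removes the first entry. The real parameter `s` then shifts
  -- the coefficient at `z` by a real number and removes its real part.
  obtain ⟨b, hb⟩ : ∃ b, b = -α := ⟨_, rfl⟩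
  obtain ⟨s, hs⟩ : ∃ s, s = -β.re := ⟨_, rfl⟩
  -- The transformed field is again quadratic. This expression is its coefficient at `w²` in the
  -- second component, and it is self-conjugate.
  obtain ⟨ρ, hρ⟩ : ∃ ρ : ℝ, (ρ : ℂ) = (s - Complex.I * (b * conj b)) *
      (2 * Complex.I * conj b * α + (s + Complex.I * (b * conj b))) -
      2 * Complex.I * b * (conj a + conj b * β + (s + Complex.I * (b * conj b)) * conj α) + r +
      2 * Complex.I * conj b * a + (s + Complex.I * (b * conj b)) * (β + conj β) := by
    refine ⟨_, Complex.conj_eq_iff_re.1 ?_⟩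
    simp only [map_sub, map_mul, map_add, map_ofNat, Complex.conj_I, Complex.conj_conj,
      Complex.conj_ofReal]
    ring
  obtain ⟨τ, hτ⟩ : ∃ τ : ℝ, Complex.I * τ = β + 4 * Complex.I * conj b * α +
      2 * Complex.I * b * conj α + (s + 3 * Complex.I * (b * conj b)) := by
    refine ⟨β.im - 3 * Complex.normSq α, ?_⟩
    rw [hb, hs]
    apply Complex.ext <;> simp [Complex.normSq_apply] <;> ring
  refine ⟨τ, (s - Complex.I * (b * conj b)) * (α + b) - b * (β + 2 * Complex.I * b * conj α) + a +
    b * (β + conj β), ρ, ?_⟩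
  have hα : α = -b := by rw [hb, neg_neg]
  have hs' : (s : ℂ) = -(β + conj β) / 2 := by
    rw [hs, Complex.add_conj]; push_cast; ring
  refine HoloHomothetic.of_inverse (κ := 1) one_ne_zero
    (U := {q | projectiveDen b s q ≠ 0}) (U' := {q | projectiveDen (-b) (-s) q ≠ 0})
    (F := projectiveMap b s) (G := projectiveMap (-b) (-s))
    (isOpen_ne_fun (projectiveDen_contDiff _ _).continuous continuous_const)
    (isOpen_ne_fun (projectiveDen_contDiff _ _).continuous continuous_const)
    (projectiveMap_contDiffOn _ _) (projectiveMap_contDiffOn _ _)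
    (fun q hq => ?_) (fun q hq => ?_) (fun q hq => ?_) (fun q hq => ?_) ?_ ?_ ?_
    (fun q hq => projectiveMap_mem_iff hq) (fun q hq _ => ?_)
  · change projectiveDen _ _ _ ≠ 0
    rw [projectiveDen_projectiveMap hq]
    exact inv_ne_zero hq
  · have := projectiveDen_projectiveMap hq
    rw [neg_neg, neg_neg] at this
    change projectiveDen _ _ _ ≠ 0
    rw [this]
    exact inv_ne_zero hq
  · exact projectiveMap_projectiveMap hq
  · have := projectiveMap_projectiveMap hq
    rwa [neg_neg, neg_neg] at this
  · simp [projectiveDen]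
  · simp [heisenbergSphere]
  · simp [projectiveMap]
  · have h1 := hasFDerivAt_fst_complex q
    have h2 := hasFDerivAt_snd_complex q
    have hD : HasFDerivAt (projectiveDen b s) _ q :=
      ((h1.const_mul (2 * Complex.I * conj b)).const_sub 1).sub
        (h2.const_mul (s + Complex.I * (b * conj b)))
    have hq : projectiveDen b s q ≠ 0 := hq
    have h3 := hD.inv_complex hq
    refine ⟨_, ((h1.add (h2.const_mul b)).mul h3).prodMk (h2.mul h3), ?_⟩
    rw [one_smul]
    obtain ⟨D, hD'⟩ : ∃ D, D = projectiveDen b s q := ⟨_, rfl⟩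
    rw [projectiveMap, ← hD']
    rw [← hD'] at hq
    rw [projectiveDen] at hD'
    refine Prod.ext ?_ ?_
    · simp only [crField, reebField, hτ, hρ]
      simp
      field_simp
      rw [hD', hα]
      simp only [map_neg, map_ofNat]
      ring
    · simp only [crField, reebField, hρ]
      simp
      field_simp
      rw [hD', hα, hs']
      simp only [map_neg, map_ofNat]
      ring

/-- Every Reeb field is locally homothetic to one of the normal forms. -/
theorem IsReebField.locallyHomothetic {U : Set C2} {X : C2 → C2} (hU : IsOpen U)
    (hX : IsReebField (heisenbergSphere ∩ U) X) {p : C2} (hp : p ∈ heisenbergSphere ∩ U) :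
    ∃ (τ : ℝ) (a : ℂ) (ρ : ℝ),
      LocallyHomothetic (heisenbergSphere ∩ U) X p heisenbergSphere (reebField τ a ρ) 0 := by
  obtain ⟨α, β, a, r, t, V, hV, hpV, hVU, hXV⟩ := hX.1.exists_nhds_eq_crField hU hp
  have h1 : HoloHomothetic (heisenbergSphere ∩ U) X p heisenbergSphere (crField α β a r t) p :=
    HoloHomothetic.of_eqOn one_ne_zero hV hpV hp (fun q hq => ⟨fun h => ⟨h, hVU hq⟩, fun h => h.1⟩)
      fun q hq hqM => by rw [one_smul, hXV ⟨hqM.1, hq⟩]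
  obtain ⟨α', β', a', r', t', h2, ht'⟩ := holoHomothetic_translate α β a r t hp.1
  -- `t'` is the component of `X p` modulo `H`, so `t' = 0` would contradict transversality.
  -- Division by `t'` is the only step of this chain with a homothety factor other than `1`.
  have ht0 : t' ≠ 0 := by
    rintro rfl
    refine hX.2 p hp ?_
    rw [cplxTangent_inter hU hp.2, mem_cplxTangent_heisenbergSphere hp.1, hXV ⟨hp.1, hpV⟩]
    rw [Complex.ofReal_zero] at ht'
    linear_combination -ht'
  have ht0' : (t' : ℂ) ≠ 0 := by exact_mod_cast ht0
  have h3 : HoloHomothetic heisenbergSphere (crField α' β' a' r' t') 0 heisenbergSphere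
      (crField (α' / t') (β' / t') (a' / t') (r' / t') 1) 0 :=
    HoloHomothetic.of_eqOn ht0 isOpen_univ trivial (by simp [heisenbergSphere]) (fun _ _ => Iff.rfl)
      fun q _ _ => by
        refine Prod.ext ?_ ?_ <;> simp [crField] <;> field_simp
  obtain ⟨τ, b, ρ, h4⟩ := holoHomothetic_normalForm (α' / t') (β' / t') (a' / t') (r' / t')
  exact ⟨τ, b, ρ, (((h1.trans h2).trans h3).trans h4).locallyHomothetic hX.1.1.2⟩

end

/-! ### Affine automorphisms of the Heisenberg sphere, and the translation of the matrix conditions.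
-/

noncomputable section

theorem IsSasakiHomothety.congr {κ : ℝ} {M M' : Set C2} {Z Z' f g : C2 → C2}
    (h : IsSasakiHomothety κ M Z M' Z' f) (hfg : Set.EqOn g f M) :
    IsSasakiHomothety κ M Z M' Z' g where
  bijOn := h.bijOn.congr hfg.symm
  smooth := h.smooth.congr hfg
  smooth_inverse := by
    obtain ⟨k, hk, h1, h2⟩ := h.smooth_inverse
    refine ⟨k, hk, fun p hp => by rw [hfg hp, h1 hp], fun q hq => ?_⟩
    obtain ⟨p, hp, rfl⟩ := h.bijOn.surjOn hq
    rw [h1 hp, hfg hp]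
  cplxTangent_map := fun p hp => by
    rw [fderivWithin_congr hfg (hfg hp), hfg hp]
    exact h.cplxTangent_map p hp
  reeb_map := fun p hp => by
    rw [fderivWithin_congr hfg (hfg hp), hfg hp]
    exact h.reeb_map p hp

/-- On the sphere `Im w = |z|²` can be substituted, and the map becomes a holomorphic polynomial
map, to which the criterion for biholomorphisms applies. -/
theorem heisenbergAffine_eq {b : ℂ} {q φ : ℝ} {p : C2} (hp : p ∈ heisenbergSphere) :
    heisenbergAffine b q φ p = (Complex.exp (Complex.I * φ) * (p.1 + b),
      p.2 + q + 2 * Complex.I * conj b * p.1 + Complex.I * (b * conj b)) := by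
  have hp : p.2.im = ‖p.1‖ ^ 2 := hp
  rw [← Complex.normSq_eq_norm_sq, Complex.normSq_apply] at hp
  refine Prod.ext rfl ?_
  rw [heisenbergAffine, norm_mul, mul_comm Complex.I, Complex.norm_exp_ofReal_mul_I, one_mul,
    ← Complex.normSq_eq_norm_sq, Complex.normSq_apply]
  apply Complex.ext
  · simp
    ring
  · simp [hp]
    ring

theorem isSasakiIso_heisenbergAffine (b : ℂ) (q φ : ℝ) :
    IsSasakiIso heisenbergSphere rigidField heisenbergSphere rigidField
      (heisenbergAffine b q φ) := by
  obtain ⟨c, hc⟩ : ∃ c, c = Complex.exp (Complex.I * φ) := ⟨_, rfl⟩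
  have hc0 : c ≠ 0 := hc ▸ Complex.exp_ne_zero _
  have hcc : c * conj c = 1 := by
    rw [hc, Complex.mul_conj, Complex.normSq_eq_norm_sq, mul_comm Complex.I,
      Complex.norm_exp_ofReal_mul_I]
    simp
  have h1 : ContDiff ℂ ∞ (fun p : C2 => p.1) := contDiff_fst
  have h2 : ContDiff ℂ ∞ (fun p : C2 => p.2) := contDiff_snd
  obtain ⟨e, he1, he2, he3, he⟩ := IsHoloHomothety.exists_of_inverse (κ := 1)
    (M := heisenbergSphere) (Z := rigidField) (M' := heisenbergSphere) (Z' := rigidField)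
    (F := fun p => (c * (p.1 + b), p.2 + q + 2 * Complex.I * conj b * p.1 +
      Complex.I * (b * conj b)))
    (G := fun p => (c⁻¹ * p.1 - b, p.2 - q - 2 * Complex.I * conj b * (c⁻¹ * p.1 - b) -
      Complex.I * (b * conj b)))
    isOpen_univ isOpen_univ (ContDiff.contDiffOn (by fun_prop)) (ContDiff.contDiffOn (by fun_prop))
    (fun _ _ => trivial) (fun _ _ => trivial)
    (fun p _ => by refine Prod.ext ?_ ?_ <;> simp [hc0]; ring)
    (fun p _ => by refine Prod.ext ?_ ?_ <;> simp [hc0]; ring)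
    (fun p _ => by
      rw [mem_heisenbergSphere_iff, mem_heisenbergSphere_iff]
      simp only [map_add, map_mul, map_ofNat, Complex.conj_I, Complex.conj_conj,
        Complex.conj_ofReal]
      constructor
      · intro h
        linear_combination h + 2 * Complex.I * (p.1 + b) * (conj p.1 + conj b) * hcc
      · intro h
        linear_combination h - 2 * Complex.I * (p.1 + b) * (conj p.1 + conj b) * hcc)
    fun p _ _ => ⟨_, (((hasFDerivAt_fst_complex p).add_const b).const_mul c).prodMk
      ((((hasFDerivAt_snd_complex p).add_const (q : ℂ)).add
        ((hasFDerivAt_fst_complex p).const_mul (2 * Complex.I * conj b))).add_const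
          (Complex.I * (b * conj b))), by simp [rigidField]⟩
  have h := he.isSasakiHomothety rigidField_mem.2
  rw [he1, he2, he3, Set.inter_univ] at h
  exact h.congr fun p hp => by rw [heisenbergAffine_eq hp, hc]

theorem reebField_mem_realTangent {τ ρ : ℝ} {a : ℂ} {p : C2} (hp : p ∈ heisenbergSphere) :
    reebField τ a ρ p ∈ realTangent heisenbergSphere p :=
  reebField_eq_crField τ a ρ ▸ crField_mem_realTangent hp

theorem reebField_zero_notMem_cplxTangent (τ : ℝ) (a : ℂ) (ρ : ℝ) :
    reebField τ a ρ 0 ∉ cplxTangent heisenbergSphere 0 := by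
  rw [mem_cplxTangent_heisenbergSphere (by simp [heisenbergSphere])]
  simp [reebField]

theorem isUnitaryMatrix_iff {A : Matrix (Fin 2) (Fin 2) ℂ} : IsUnitaryMatrix A ↔
    A.conjTranspose * Matrix.diagonal ![1, ((1 : ℝ) : ℂ)] * A =
      Matrix.diagonal ![1, ((1 : ℝ) : ℂ)] := by
  have h : Matrix.diagonal ![1, ((1 : ℝ) : ℂ)] = 1 := by
    ext i j
    fin_cases i <;> fin_cases j <;> simp
  rw [IsUnitaryMatrix, Matrix.mem_unitaryGroup_iff', h, mul_one, Matrix.star_eq_conjTranspose]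

theorem isPseudoUnitaryMatrix_iff {A : Matrix (Fin 2) (Fin 2) ℂ} : IsPseudoUnitaryMatrix A ↔
    A.conjTranspose * Matrix.diagonal ![1, ((-1 : ℝ) : ℂ)] * A =
      Matrix.diagonal ![1, ((-1 : ℝ) : ℂ)] := by
  rw [IsPseudoUnitaryMatrix, Complex.ofReal_neg, Complex.ofReal_one]

end

theorem theorem2 :
    -- Every spherical Sasakian structure is locally homothetic to one of the family.
    (∀ (U : Set C2) (X : C2 → C2), IsOpen U → IsReebField (heisenbergSphere ∩ U) X →
      ∀ p ∈ heisenbergSphere ∩ U, ∃ (τ : ℝ) (a : ℂ) (ρ : ℝ),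
        LocallyHomothetic (heisenbergSphere ∩ U) X p heisenbergSphere (reebField τ a ρ) 0) ∧
    -- The members of the family, and the dimension of the Lie algebra of infinitesimal automorphisms.
    (∀ (τ : ℝ) (a : ℂ) (ρ : ℝ),
      reebField τ a ρ 0 ∉ cplxTangent heisenbergSphere 0 ∧
      ∀ U : Set C2, IsOpen U → IsConnected (heisenbergSphere ∩ U) →
        (∀ p ∈ heisenbergSphere ∩ U, reebField τ a ρ p ∉ cplxTangent (heisenbergSphere ∩ U) p) →
        IsReebField (heisenbergSphere ∩ U) (reebField τ a ρ) ∧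
        (τ = 0 ∧ a = 0 ∧ ρ = 0 →
          SasakiAutAlgebraHasDim (heisenbergSphere ∩ U) (reebField τ a ρ) 4) ∧
        (a = 0 ∧ ρ = τ ^ 2 ∧ 0 < τ →
          SasakiAutAlgebraHasDim (heisenbergSphere ∩ U) (reebField τ a ρ) 4) ∧
        (a = 0 ∧ ρ = τ ^ 2 ∧ τ < 0 →
          SasakiAutAlgebraHasDim (heisenbergSphere ∩ U) (reebField τ a ρ) 4) ∧
        (¬ (a = 0 ∧ ρ = τ ^ 2) →
          SasakiAutAlgebraHasDim (heisenbergSphere ∩ U) (reebField τ a ρ) 2)) ∧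
    -- Case 1: the automorphisms of the Heisenberg sphere.
    ((∀ (U V : Set C2) (f : C2 → C2), IsOpen U → IsOpen V →
        IsConnected (heisenbergSphere ∩ U) →
        IsSasakiIso (heisenbergSphere ∩ U) (reebField 0 0 0)
          (heisenbergSphere ∩ V) (reebField 0 0 0) f →
        ∃ (b : ℂ) (q : ℝ), ∃ φ ∈ Set.Ico 0 (2 * Real.pi),
          ∀ p ∈ heisenbergSphere ∩ U, f p = heisenbergAffine b q φ p) ∧
      (∀ (b : ℂ) (q φ : ℝ),
        IsSasakiIso heisenbergSphere (reebField 0 0 0) heisenbergSphere (reebField 0 0 0)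
          (heisenbergAffine b q φ))) ∧
    -- Case 2: the round sphere.
    ((∀ τ : ℝ, 0 < τ →
        (∀ p ∈ rigidSpherePos,
          LocallyHomothetic heisenbergSphere (reebField τ 0 (τ ^ 2)) 0
            rigidSpherePos rigidField p) ∧
        (∀ p ∈ roundSphere,
          LocallyHomothetic heisenbergSphere (reebField τ 0 (τ ^ 2)) 0
            roundSphere standardField p)) ∧
      (∀ (U V : Set C2) (f : C2 → C2), IsOpen U → IsOpen V → IsConnected (roundSphere ∩ U) →
        IsSasakiIso (roundSphere ∩ U) standardField (roundSphere ∩ V) standardField f →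
        ∃ A : Matrix (Fin 2) (Fin 2) ℂ, IsUnitaryMatrix A ∧
          ∀ p ∈ roundSphere ∩ U, f p = matrixAct A p) ∧
      (∀ A : Matrix (Fin 2) (Fin 2) ℂ, IsUnitaryMatrix A →
        IsSasakiIso roundSphere standardField roundSphere standardField (matrixAct A))) ∧
    -- Case 3: the hyperboloid.
    ((∀ τ : ℝ, τ < 0 →
        (∀ p ∈ rigidSphereNeg,
          LocallyHomothetic heisenbergSphere (reebField τ 0 (τ ^ 2)) 0
            rigidSphereNeg rigidField p) ∧
        (∀ p ∈ hyperboloid,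
          LocallyHomothetic heisenbergSphere (reebField τ 0 (τ ^ 2)) 0
            hyperboloid standardField p)) ∧
      (∀ (U V : Set C2) (f : C2 → C2), IsOpen U → IsOpen V → IsConnected (hyperboloid ∩ U) →
        IsSasakiIso (hyperboloid ∩ U) standardField (hyperboloid ∩ V) standardField f →
        ∃ A : Matrix (Fin 2) (Fin 2) ℂ, IsPseudoUnitaryMatrix A ∧
          ∀ p ∈ hyperboloid ∩ U, f p = matrixAct A p) ∧
      (∀ A : Matrix (Fin 2) (Fin 2) ℂ, IsPseudoUnitaryMatrix A →
        IsSasakiIso hyperboloid standardField hyperboloid standardField (matrixAct A))) := by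
  have h1 : (1 : ℝ) * 1 = 1 := one_mul 1
  have h2 : (-1 : ℝ) * -1 = 1 := by norm_num
  refine ⟨fun U X hU hX p hp => hX.locallyHomothetic hU hp, fun τ a ρ =>
    ⟨reebField_zero_notMem_cplxTangent τ a ρ, fun U hU hc hZ =>
      ⟨⟨reebField_eq_crField τ a ρ ▸ crField_isInfCRAut hU, hZ⟩, ?_, ?_, ?_,
        sasakiAutAlgebraHasDim_two hU hc⟩⟩, ⟨?_, fun b q φ => ?_⟩,
    ⟨fun τ hτ => ?_, ?_, fun A hA => ?_⟩, ⟨fun τ hτ => ?_, ?_, fun A hA => ?_⟩⟩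
  · rintro ⟨rfl, rfl, rfl⟩
    have h := sasakiAutAlgebraHasDim_four hU hc 0
    rwa [zero_pow two_ne_zero] at h
  · rintro ⟨rfl, rfl, -⟩
    exact sasakiAutAlgebraHasDim_four hU hc τ
  · rintro ⟨rfl, rfl, -⟩
    exact sasakiAutAlgebraHasDim_four hU hc τ
  · intro U V f hU _ hc hf
    rw [reebField_zero] at hf
    exact heisenberg_rigidity hU hc hf
  · rw [reebField_zero]
    exact isSasakiIso_heisenbergAffine b q φ
  · rw [← rigidSphere_one, ← quadric_one]
    exact heisenberg_locallyHomothetic_quadric h1 (Real.sqrt_pos.2 hτ).ne'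
      (by rw [Real.sq_sqrt hτ.le, one_mul]) fun p hp => reebField_mem_realTangent hp
  · intro U V f hU _ hc hf
    rw [← quadric_one] at hc hf ⊢
    obtain ⟨A, hA, hf⟩ := quadric_rigidity h1 hU hc hf
    exact ⟨A, isUnitaryMatrix_iff.2 hA, hf⟩
  · rw [← quadric_one]
    exact isSasakiIso_matrixAct h1 (isUnitaryMatrix_iff.1 hA)
  · rw [← rigidSphere_neg_one, ← quadric_neg_one]
    exact heisenberg_locallyHomothetic_quadric h2 (Real.sqrt_pos.2 (neg_pos.2 hτ)).ne'
      (by rw [Real.sq_sqrt (neg_pos.2 hτ).le, neg_one_mul, neg_neg])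
      fun p hp => reebField_mem_realTangent hp
  · intro U V f hU _ hc hf
    rw [← quadric_neg_one] at hc hf ⊢
    obtain ⟨A, hA, hf⟩ := quadric_rigidity h2 hU hc hf
    exact ⟨A, isPseudoUnitaryMatrix_iff.2 hA, hf⟩
  · rw [← quadric_neg_one]
    exact isSasakiIso_matrixAct h2 (isPseudoUnitaryMatrix_iff.1 hA)
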